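/- Let $S$ be a smooth $n$-dimensional manifold (Hausdorff, second countable), $\pi:T^*S\to S$ its cotangent bundle with the canonical symplectic form $\omega=\sum dy_i\wedge dx^i$, and $V=\ker d\pi$ the vertical lagrangian sub-bundle of $T(T^*S)$. Let $H:T^*S\to\mathbb R$ be a smooth convex hamiltonian, i.e. its Hessian along every cotangent space is positive definite. Let $M\subset T^*S$ be an embedded smooth submanifold and $f:M\to B$ a smooth submersion whose fibres are compact lagrangian submanifolds (for instance a fibre bundle; $M$ itself may be a lagrangian submanifold and $B$ a point), and let $F$ be a fibre of $f$, with inclusion $\iota_F:F\to T^*S$. Assume that $F$ is invariant under the hamiltonian flow of $H$ ($\dot x=\partial H/\partial y$, $\dot y=-\partial H/\partial x$), and let $\varphi|F$ be the restricted flow. A point $x\in F$ is non-wandering if for every neighbourhood $U$ of $x$ in $F$ there is $t>1$ with $\varphi_t(U)\cap U\ne\emptyset$. Maslov cocycle. For a smooth almost complex structure $J$ on $T^*S$ compatible with $\omega$ (so that $h=g+i\omega$, $g(u,v)=\omega(Ju,v)$, is hermitian), let $\det^2$ of a lagrangian plane of $T_\theta(T^*S)$ be the squared determinant of an orthonormal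 basis of the plane written in a unitary basis of $T_\theta(T^*S)$. The quotient $\Theta(\theta)=\det^2(\ker d_\theta f)/\det^2(V_\theta)\in U(1)$ does not depend on the bases, and the class $d\in H^1(M;\mathbb Z)$ is the pullback by $\Theta:M\to U(1)$ of the generator of $H^1(U(1);\mathbb Z)$ (it is the primary difference of the sections $\ker df$ and $V|_M$ of the bundle of lagrangian planes). Thus $\iota_F^*(d)$ is trivial iff $\Theta|_F=e^{2\pi i h}$ for a continuous $h:F\to\mathbb R$. Maslov cycle. Let $\mathfrak m_\zeta=\{\theta\in M:\ \ker d_\theta f\cap V_\theta\ne 0\}$. The set $\mathfrak m_\zeta\cap F$ is regarded as a co-oriented codimension-one cycle on $F$ with multiplicities given by crossing forms: if $\gamma$ is a differentiable curve in $F$ with $\gamma(0)=\theta\in\mathfrak m_\zeta$, the crossing form is the quadratic form $v(0)\mapsto\omega(v'(0),v(0))$ on $T_\theta F\cap V_\theta$, where $v(t)\in T_{\gamma(t)}F$ and the derivative is taken in a natural chart of $T^*S$; if it is non-degenerate, $\gamma$ crosses the cycle at $\theta$ with multiplicity equal to its signature. The cycle is trivial if it is a boundary: there is a locally constant function $c:F\setminus\mathfrak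 m_\zeta\to\mathbb Z$ such that along every differentiable curve $\gamma$ with a non-degenerate crossing at $t=0$ the jump $c(\gamma(\varepsilon))-c(\gamma(-\varepsilon))$, for all small $\varepsilon>0$, is the signature of the crossing form. Claim. Suppose that every point of $F$ is non-wandering for $\varphi|F$. Then the following are equivalent (for every compatible $J$): (i) $\mathfrak m_\zeta\cap F$ is a trivial cycle; (ii) the Maslov cocycle $\iota_F^*(d)$ is trivial in $H^1(F;\mathbb Z)$; (iii) $\rho=\pi\circ\iota_F:F\to S$ is a local diffeomorphism. -/

import Mathlib

open Set Filter Topology Manifold Bundle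
open scoped Manifold ContDiff Bundle

noncomputable section

/-! ### The cotangent bundle and its canonical symplectic form -/

/-- The cotangent bundle `T^*S` of an `n`-dimensional manifold `S`, with the topology and smooth
structure that Mathlib gives to the bundle of continuous linear maps `TS → ℝ`. -/
abbrev CotangentBundle (n : ℕ) (S : Type*) [TopologicalSpace S]
    [ChartedSpace (EuclideanSpace ℝ (Fin n)) S] [IsManifold (𝓡 n) ∞ S] : Type _ :=
  TotalSpace (EuclideanSpace ℝ (Fin n) →L[ℝ] ℝ) (fun q : S => TangentSpace (𝓡 n) q →L[ℝ] ℝ)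

/-- The model space `ℝⁿ × (ℝⁿ)^*` of `T^*S`. -/
abbrev CotangentModel (n : ℕ) : Type :=
  EuclideanSpace ℝ (Fin n) × (EuclideanSpace ℝ (Fin n) →L[ℝ] ℝ)

/-- The model with corners of `T^*S` (there is no boundary). -/
abbrev cotangentI (n : ℕ) :
    ModelWithCorners ℝ (CotangentModel n)
      (ModelProd (EuclideanSpace ℝ (Fin n)) (EuclideanSpace ℝ (Fin n) →L[ℝ] ℝ)) :=
  (𝓡 n).prod 𝓘(ℝ, EuclideanSpace ℝ (Fin n) →L[ℝ] ℝ)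

/-- The form `∑ dyᵢ ∧ dxⁱ` on `ℝⁿ × (ℝⁿ)^*`: `((a, α), (b, β)) ↦ α b - β a`. -/
def stdSymplectic (n : ℕ) : LinearMap.BilinForm ℝ (CotangentModel n) :=
  LinearMap.mk₂ ℝ (fun u v => u.2 v.1 - v.2 u.1)
    (fun u u' v => by simp; ring) (fun c u v => by simp; ring)
    (fun u v v' => by simp; ring) (fun c u v => by simp; ring)

section

variable {n : ℕ} {S : Type*} [TopologicalSpace S]
  [ChartedSpace (EuclideanSpace ℝ (Fin n)) S] [IsManifold (𝓡 n) ∞ S]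

/-- The canonical symplectic form `ω = ∑ dyᵢ ∧ dxⁱ` on `T^*S`. In Mathlib the tangent space at `θ`
is the model space, a vector being read in the preferred chart at `θ`; for `T^*S` this is the
chart `(x, y)` induced by the preferred chart `x` of `S` at the foot point of `θ`, so the
canonical form is the standard form of the model. -/
def canonicalForm (θ : CotangentBundle n S) :
    LinearMap.BilinForm ℝ (TangentSpace (cotangentI n) θ) :=
  stdSymplectic n

/-- The foot point projection `π : T^*S → S`. -/
def footPoint : CotangentBundle n S → S := TotalSpace.proj

/-- The vertical plane `V_θ = ker d_θ π`. -/
def verticalPlane (θ : CotangentBundle n S) : Submodule ℝ (TangentSpace (cotangentI n) θ) :=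
  (mfderiv (cotangentI n) (𝓡 n) footPoint θ).ker

/-- Lagrangian planes in `T_θ (T^*S)`: `n`-dimensional subspaces on which `ω` vanishes. -/
def IsLagrangianPlane {θ : CotangentBundle n S}
    (L : Submodule ℝ (TangentSpace (cotangentI n) θ)) : Prop :=
  Module.finrank ℝ L = n ∧ ∀ u ∈ L, ∀ v ∈ L, canonicalForm θ u v = 0

/-! ### Convex hamiltonians, their flows, non-wandering points -/

/-- `H` is convex: on every cotangent space its Hessian is positive definite. -/
def IsConvexHamiltonian (H : CotangentBundle n S → ℝ) : Prop :=
  ∀ (q : S) (p η : TangentSpace (𝓡 n) q →L[ℝ] ℝ), η ≠ 0 →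
    0 < iteratedDeriv 2 (fun t : ℝ => H ⟨q, p + t • η⟩) 0

/-- `c : ℝ → T^*S` is an integral curve of the hamiltonian vector field `X_H`
(`ẋ = ∂H/∂y`, `ẏ = -∂H/∂x`), which is characterised by `ω(X_H, ·) = -dH`. -/
def IsHamiltonianCurve (H : CotangentBundle n S → ℝ) (c : ℝ → CotangentBundle n S) : Prop :=
  MDifferentiable 𝓘(ℝ, ℝ) (cotangentI n) c ∧
    ∀ (t : ℝ) (v : TangentSpace (cotangentI n) (c t)),
      canonicalForm (c t) (mfderiv 𝓘(ℝ, ℝ) (cotangentI n) c t (1 : ℝ)) v =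
        -(mfderiv (cotangentI n) 𝓘(ℝ, ℝ) H (c t) v : ℝ)

/-- The submanifold `ι : F → T^*S` is invariant under the hamiltonian flow of `H`, and `φ` is the
restriction of that flow to it: for every `x`, the curve `t ↦ ι (φ t x)` is the
integral curve of `X_H` that starts at `ι x`. -/
def IsRestrictedHamiltonianFlow {F : Type*} (H : CotangentBundle n S → ℝ)
    (ι : F → CotangentBundle n S) (φ : ℝ → F → F) : Prop :=
  ∀ x : F, φ 0 x = x ∧ IsHamiltonianCurve H (fun t => ι (φ t x))

/-- The non-wandering set of a flow: every neighbourhood `U` of `x` has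
`φ_t(U) ∩ U ≠ ∅` for some `t > 1`. -/
def nonWanderingSet {X : Type*} [TopologicalSpace X] (φ : ℝ → X → X) : Set X :=
  {x | ∀ U ∈ 𝓝 x, ∃ t : ℝ, 1 < t ∧ (φ t '' U ∩ U).Nonempty}

/-! ### The lagrangian fibration -/

section Fibration

variable {m k : ℕ} {M B : Type*}
  [TopologicalSpace M] [ChartedSpace (EuclideanSpace ℝ (Fin m)) M]
  [TopologicalSpace B] [ChartedSpace (EuclideanSpace ℝ (Fin k)) B]

/-- The section `r(θ) = ker d_θ f` of the bundle of lagrangian planes over `M`, the tangent space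
of `M` being mapped into that of `T^*S` by the differential of the inclusion `i`. -/
def fibrePlane (i : M → CotangentBundle n S) (f : M → B) (x : M) :
    Submodule ℝ (TangentSpace (cotangentI n) (i x)) :=
  Submodule.map (mfderiv (𝓡 m) (cotangentI n) i x : _ →ₗ[ℝ] _)
    (mfderiv (𝓡 m) (𝓡 k) f x).ker

/-- `i` embeds `M` as a submanifold of `T^*S`, and `f` is a smooth submersion of `M` onto an
open subset of `B` whose fibres are compact lagrangian submanifolds. -/
structure IsLagrangianFibration (i : M → CotangentBundle n S) (f : M → B) : Prop where
  embedding : IsSmoothEmbedding (𝓡 m) (cotangentI n) ∞ i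
  smooth : ContMDiff (𝓡 m) (𝓡 k) ∞ f
  submersion : ∀ x : M, Function.Surjective (mfderiv (𝓡 m) (𝓡 k) f x)
  compact_fibre : ∀ b : B, IsCompact (f ⁻¹' {b})
  lagrangian : ∀ x : M, IsLagrangianPlane (fibrePlane (m := m) (k := k) i f x)

/-- The relative Maslov cycle `m_ζ` as a set: the points of `M` at which `ker d f` and the vertical
plane have a non-trivial intersection. -/
def maslovSet (i : M → CotangentBundle n S) (f : M → B) : Set M :=
  {x | fibrePlane (m := m) (k := k) i f x ⊓ verticalPlane (i x) ≠ ⊥}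

end Fibration

/-! ### The Maslov cocycle -/

/-- A smooth almost complex structure `J` on `T^*S` compatible with `ω`, i.e. such that
`g(u, v) = ω(J u, v)` is a riemannian metric and
`g + i ω` is hermitian, complex linear in the first variable. -/
structure IsCompatibleComplexStructure
    (J : ∀ θ : CotangentBundle n S,
      TangentSpace (cotangentI n) θ →L[ℝ] TangentSpace (cotangentI n) θ) : Prop where
  smooth : ContMDiff (cotangentI n)
    ((cotangentI n).prod 𝓘(ℝ, CotangentModel n →L[ℝ] CotangentModel n)) ∞
    (fun θ => TotalSpace.mk' (CotangentModel n →L[ℝ] CotangentModel n)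
      (E := fun θ : CotangentBundle n S =>
        TangentSpace (cotangentI n) θ →L[ℝ] TangentSpace (cotangentI n) θ) θ (J θ))
  sq : ∀ θ u, J θ (J θ u) = -u
  symplectic : ∀ θ u v, canonicalForm θ (J θ u) (J θ v) = canonicalForm θ u v
  pos : ∀ θ u, u ≠ 0 → 0 < canonicalForm θ (J θ u) u

/-- The hermitian inner product `g + i ω`, where `g(u, v) = ω(J u, v)`. -/
def hermForm {θ : CotangentBundle n S}
    (Jθ : TangentSpace (cotangentI n) θ →L[ℝ] TangentSpace (cotangentI n) θ)
    (u v : TangentSpace (cotangentI n) θ) : ℂ :=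
  (canonicalForm θ (Jθ u) v : ℂ) + (canonicalForm θ u v : ℂ) * Complex.I

/-- `b` is a unitary basis of `T_θ(T^*S)`. If all `b j` lie in a lagrangian plane, it is
equivalently a `g`-orthonormal basis of that plane. -/
def IsUnitaryFrame {θ : CotangentBundle n S}
    (Jθ : TangentSpace (cotangentI n) θ →L[ℝ] TangentSpace (cotangentI n) θ)
    (b : Fin n → TangentSpace (cotangentI n) θ) : Prop :=
  ∀ j l, hermForm Jθ (b j) (b l) = if j = l then 1 else 0

/-- If `b` is a unitary basis, which identifies `T_θ(T^*S)` with `ℂⁿ`, and `e` is an orthonormal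
basis of a lagrangian plane `L`, this is the value `det² (L) ∈ U(1)`. -/
def detSq {θ : CotangentBundle n S}
    (Jθ : TangentSpace (cotangentI n) θ →L[ℝ] TangentSpace (cotangentI n) θ)
    (b e : Fin n → TangentSpace (cotangentI n) θ) : ℂ :=
  (Matrix.of fun l j => hermForm Jθ (e j) (b l)).det ^ 2

/-- `z = det² (L) / det² (L')` for lagrangian planes `L, L'` of `T_θ(T^*S)`, where `det²` is
computed in a unitary basis of `T_θ(T^*S)`. The quotient depends neither on that basis nor on the
orthonormal bases of `L` and `L'`. -/
def IsDetSqQuotient {θ : CotangentBundle n S}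
    (Jθ : TangentSpace (cotangentI n) θ →L[ℝ] TangentSpace (cotangentI n) θ)
    (L L' : Submodule ℝ (TangentSpace (cotangentI n) θ)) (z : ℂ) : Prop :=
  ∃ b e e' : Fin n → TangentSpace (cotangentI n) θ,
    IsUnitaryFrame Jθ b ∧ (IsUnitaryFrame Jθ e ∧ ∀ j, e j ∈ L) ∧
      (IsUnitaryFrame Jθ e' ∧ ∀ j, e' j ∈ L') ∧ z = detSq Jθ b e / detSq Jθ b e'

/-- The map `det²(r) / det²(s) : M → U(1)`, for `r = ker d f` and `s` the vertical section.
The pullback of the generator `dϑ` of `H¹(U(1); ℤ)` by this map is the primary difference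
`d = μ_r - μ_s ∈ H¹(M; ℤ)` (the Maslov cocycle). -/
def maslovMap {m k : ℕ} {M B : Type*}
    [TopologicalSpace M] [ChartedSpace (EuclideanSpace ℝ (Fin m)) M]
    [TopologicalSpace B] [ChartedSpace (EuclideanSpace ℝ (Fin k)) B]
    (J : ∀ θ : CotangentBundle n S,
      TangentSpace (cotangentI n) θ →L[ℝ] TangentSpace (cotangentI n) θ)
    (i : M → CotangentBundle n S) (f : M → B) (x : M) : ℂ :=
  Classical.epsilon (IsDetSqQuotient (J (i x))
    (fibrePlane (m := m) (k := k) i f x) (verticalPlane (i x)))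

/-- For `u : X → U(1)`, `u = exp (2π i ϑ)`, the cocycle `u^*(dϑ)` is trivial in `H¹(X; ℤ)`: it is
the coboundary `dh` of a function `h : X → ℝ` with `u = exp (2π i h)`. -/
def IsTrivialCocycle {X : Type*} [TopologicalSpace X] (u : X → ℂ) : Prop :=
  ∃ h : X → ℝ, Continuous h ∧ ∀ x, u x = Complex.exp (2 * Real.pi * Complex.I * (h x : ℂ))

/-! ### The Maslov cycle of a lagrangian submanifold -/

section Cycle

variable {F : Type*} [TopologicalSpace F] [ChartedSpace (EuclideanSpace ℝ (Fin n)) F]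

/-- The kernel of `d_x (π ∘ ι)`, that is, `T_xF ∩ V` for the lagrangian submanifold
`ι : F → T^*S`. -/
def crossingKernel (ι : F → CotangentBundle n S) (x : F) :
    Submodule ℝ (TangentSpace (𝓡 n) x) :=
  (mfderiv (𝓡 n) (𝓡 n) (footPoint ∘ ι) x).ker

/-- The crossing form at `x` of the planes `TF` with the vertical planes, in the direction
`w ∈ T_xF`: the quadratic form `v(0) ↦ ω(v'(0), v(0))` on `T_xF ∩ V`, where `v(t)` is a curve of
vectors tangent to `F` along a curve in `F` with velocity `w` at `t = 0`, and the derivative is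
taken in the natural chart of `T^*S` at `ι x` (in which the vertical plane is constant). With
`v(t)` the image of a vector `ξ` that is constant in the chart of `F`, `v'(0) = D²ι(w, ξ)`.
Its sign is that of the co-orientation for which `e^{it}ℝ ⊕ iℝⁿ⁻¹` crosses the planes meeting
`iℝⁿ` positively at `t = π/2`. -/
def crossingForm (ι : F → CotangentBundle n S) (x : F) (w : TangentSpace (𝓡 n) x) :
    QuadraticForm ℝ (crossingKernel ι x) :=
  let ι' : EuclideanSpace ℝ (Fin n) → CotangentModel n :=
    writtenInExtChartAt (𝓡 n) (cotangentI n) x ι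
  let x' : EuclideanSpace ℝ (Fin n) := extChartAt (𝓡 n) x x
  let D : EuclideanSpace ℝ (Fin n) →L[ℝ] CotangentModel n := fderiv ℝ ι' x'
  let D₂ : EuclideanSpace ℝ (Fin n) →L[ℝ] CotangentModel n :=
    fderiv ℝ (fun z => fderiv ℝ ι' z) x' w
  let Γ : LinearMap.BilinForm ℝ (EuclideanSpace ℝ (Fin n)) :=
    (stdSymplectic n).compl₁₂ D₂.toLinearMap D.toLinearMap
  QuadraticMap.restrict (LinearMap.BilinMap.toQuadraticMap Γ) (crossingKernel ι x)

/-- The Maslov cycle of the lagrangian submanifold `ι : F → T^*S`, with support `Z ⊆ F` and with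
the co-orientation and multiplicities given by the signatures of the crossing forms, is trivial,
i.e. it is a boundary: there is a codimension-0 chain, given by a locally constant integer
multiplicity `c` on `F ∖ Z`, which jumps, along every differentiable curve with a non-degenerate
crossing, by the multiplicity of the cycle there. -/
def IsTrivialMaslovCycle (ι : F → CotangentBundle n S) (Z : Set F) : Prop :=
  ∃ c : F → ℤ, (∀ x ∉ Z, ∀ᶠ y in 𝓝 x, c y = c x) ∧
    ∀ γ : ℝ → F, MDifferentiable 𝓘(ℝ, ℝ) (𝓡 n) γ → γ 0 ∈ Z →
      ∀ Q : QuadraticForm ℝ (crossingKernel ι (γ 0)),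
        Q = crossingForm ι (γ 0) (mfderiv 𝓘(ℝ, ℝ) (𝓡 n) γ 0 (1 : ℝ)) →
        Q.polarBilin.SeparatingLeft →
        ∀ᶠ ε : ℝ in 𝓝[>] 0, c (γ ε) - c (γ (-ε)) = (sigPos Q : ℤ) - (sigNeg Q : ℤ)

end Cycle

end

end

/-! All three conditions are equivalent to the emptiness of the crossing set, the points of `F` at
which `TF` meets the vertical planes (`crossingSet`). For (iii) this is the inverse function
theorem, since the kernel of the differential of `π ∘ ι` is `TF ∩ V`. If there is no crossing, the
cycle is trivially a boundary and the argument of the tangent planes is a global continuous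
function. The content is the converse: over a non-wandering flow, triviality of the cycle or of the
cocycle excludes crossings.

Two facts drive this. By convexity, all crossings along the flow have the same sign
(`IsLagrangianImmersion.crossing_neg`): differentiating the isotropy of `TF` and the vanishing of
`dH` on `TF` shows that the crossing form in the direction of the hamiltonian field is minus the
Hessian of `H` along the fibre. Also, a function that is locally constant off the crossing set and
drops at each crossing cannot increase along an orbit, whereas an orbit that starts near a crossing
point `x` and returns there would have to go from the value just after the drop to the value just
before it (`eq_empty_of_decreasing_across`).

For the cycle the dropping function is the chain `c`, whose jump is minus the negative index. For
the cocycle `Θ = exp (2πih)` it is `h - arg / π`, where `arg` is a continuous argument of `det (L) /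
det (V)`, defined for planes `L` transverse to `V`. It is built as follows. A basis of `L` gives a
complex symmetric matrix relative to `V` (`lagMatrix`) with non-positive imaginary part, invertible
exactly when `L` is transverse to `V`. Invertible matrices of this kind can be joined to `-i` by a
segment along which the determinant does not vanish, so the determinant has a preferred logarithm
(`logDet`); it is continuous, and its imaginary part is invariant under congruence, hence
independent of the basis (`im_logDet_congr`). At a crossing, rescaling the kernel directions by `|t|
^ (-1/2)` makes the matrix converge to `±1 ⊕ W` as `t → 0±`, and the argument is strictly larger for
the sign `+` (`im_logDet_fromBlocks_lt`, `lagArg_jump`). -/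

noncomputable section

set_option linter.unusedSectionVars false

/-! ### A continuous argument of the determinant of dissipative matrices -/

section LogDet

open Matrix Complex

/-- Along a nowhere vanishing path, the integral of the logarithmic derivative is a logarithm of
the quotient of the end points. -/
theorem exp_integral_deriv_div {f : ℝ → ℂ} (hf : ContDiff ℝ 1 f)
    (h0 : ∀ s ∈ Icc (0 : ℝ) 1, f s ≠ 0) :
    exp (∫ s in (0 : ℝ)..1, deriv f s / f s) * f 0 = f 1 := by
  have hd : Differentiable ℝ f := hf.differentiable (by norm_num)
  have hc : ContinuousOn (fun s => deriv f s / f s) (Icc 0 1) :=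
    (hf.continuous_deriv le_rfl).continuousOn.div hf.continuous.continuousOn h0
  -- Integrating factor: `g` has zero derivative, so `g 0 = g 1`. Only right derivatives on `[0, 1)`
  -- are needed, which avoids the endpoint `1`.
  let g : ℝ → ℂ := fun t => exp (-∫ s in (0 : ℝ)..t, deriv f s / f s) * f t
  have hint : IntervalIntegrable (fun s => deriv f s / f s) MeasureTheory.volume 0 1 :=
    ContinuousOn.intervalIntegrable (by rwa [uIcc_of_le zero_le_one])
  have hprim : ContinuousOn (fun t => ∫ s in (0 : ℝ)..t, deriv f s / f s) (Icc 0 1) := by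
    have := intervalIntegral.continuousOn_primitive_interval'
      (a := (0 : ℝ)) hint (by simp)
    rwa [uIcc_of_le zero_le_one] at this
  have hg : ContinuousOn g (Icc 0 1) :=
    (hprim.neg.cexp).mul hf.continuous.continuousOn
  have hg' : ∀ t ∈ Ico (0 : ℝ) 1, HasDerivWithinAt g 0 (Ici t) t := by
    intro t ht
    have htI : t ∈ Icc (0 : ℝ) 1 := Ico_subset_Icc_self ht
    have hmeas : MeasureTheory.StronglyMeasurable (fun s => deriv f s / f s) := by
      refine Measurable.stronglyMeasurable ?_
      exact (hf.continuous_deriv le_rfl).measurable.div hf.continuous.measurable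
    have h1 : HasDerivAt (fun u => ∫ s in (0 : ℝ)..u, deriv f s / f s)
        (deriv f t / f t) t := by
      refine intervalIntegral.integral_hasDerivAt_right ?_
        hmeas.stronglyMeasurableAtFilter ?_
      · refine hint.mono_set ?_
        rw [uIcc_of_le zero_le_one, uIcc_of_le ht.1]
        exact Icc_subset_Icc_right ht.2.le
      · exact (hf.continuous_deriv le_rfl).continuousAt.div hf.continuous.continuousAt (h0 t htI)
    have h2 := (h1.neg.cexp).mul (hd t).hasDerivAt
    have h3 : exp (-∫ s in (0 : ℝ)..t, deriv f s / f s) * -(deriv f t / f t) * f t +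
        exp (-∫ s in (0 : ℝ)..t, deriv f s / f s) * deriv f t = 0 := by
      have := h0 t htI
      field_simp
      ring
    exact (h3 ▸ h2).hasDerivWithinAt
  have := constant_of_has_deriv_right_zero hg hg' 1 (by simp)
  simp only [g, intervalIntegral.integral_same, neg_zero, exp_zero, one_mul] at this
  rw [← this, ← mul_assoc, ← exp_add]
  simp

variable {ι : Type*} [Fintype ι] [DecidableEq ι]

/-- The segment from `-i` to the matrix `Z`. -/
def detSegment (Z : Matrix ι ι ℂ) (s : ℝ) : Matrix ι ι ℂ :=
  (((1 - s : ℝ) : ℂ) * -I) • (1 : Matrix ι ι ℂ) + (s : ℂ) • Z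

/-- The determinant along the segment from `-i` to `Z`. -/
def detPath (Z : Matrix ι ι ℂ) (s : ℝ) : ℂ := (detSegment Z s).det

/-- The logarithm of `det Z / det (-i)`, continued along the segment from `-i` to `Z`. -/
def logDet (Z : Matrix ι ι ℂ) : ℂ := ∫ s in (0 : ℝ)..1, deriv (detPath Z) s / detPath Z s

/-- A complex matrix is dissipative if its quadratic form has non-positive imaginary part. -/
def IsDissipative (Z : Matrix ι ι ℂ) : Prop := ∀ c : ι → ℂ, (star c ⬝ᵥ Z *ᵥ c).im ≤ 0

/-- A complex matrix is strictly dissipative if its quadratic form has negative imaginary part. -/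
def IsStrictlyDissipative (Z : Matrix ι ι ℂ) : Prop :=
  ∀ c : ι → ℂ, c ≠ 0 → (star c ⬝ᵥ Z *ᵥ c).im < 0

theorem IsStrictlyDissipative.isDissipative {Z : Matrix ι ι ℂ} (h : IsStrictlyDissipative Z) :
    IsDissipative Z := fun c => by
  rcases eq_or_ne c 0 with rfl | hc
  · simp
  · exact (h c hc).le

theorem IsStrictlyDissipative.det_ne_zero {Z : Matrix ι ι ℂ} (h : IsStrictlyDissipative Z) :
    Z.det ≠ 0 := fun h0 => by
  obtain ⟨c, hc, hZ⟩ := Matrix.exists_mulVec_eq_zero_iff.2 h0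
  have := h c hc
  simp [hZ] at this

theorem star_dotProduct_self_eq (c : ι → ℂ) :
    star c ⬝ᵥ c = ((∑ k, normSq (c k) : ℝ) : ℂ) := by
  simp only [dotProduct, ofReal_sum, Pi.star_apply, RCLike.star_def]
  exact Finset.sum_congr rfl fun k _ => (normSq_eq_conj_mul_self).symm

theorem sum_normSq_pos {c : ι → ℂ} (hc : c ≠ 0) : 0 < ∑ k, normSq (c k) := by
  obtain ⟨k, hk⟩ := Function.ne_iff.1 hc
  exact Finset.sum_pos' (fun _ _ => normSq_nonneg _) ⟨k, Finset.mem_univ _, normSq_pos.2 hk⟩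

theorem im_quadratic_detSegment (Z : Matrix ι ι ℂ) (s : ℝ) (c : ι → ℂ) :
    (star c ⬝ᵥ detSegment Z s *ᵥ c).im =
      -((1 - s) * ∑ k, normSq (c k)) + s * (star c ⬝ᵥ Z *ᵥ c).im := by
  have : star c ⬝ᵥ detSegment Z s *ᵥ c =
      (((1 - s : ℝ) : ℂ) * -I) * (star c ⬝ᵥ c) + (s : ℂ) * (star c ⬝ᵥ Z *ᵥ c) := by
    simp only [detSegment, Matrix.add_mulVec, Matrix.smul_mulVec, dotProduct_add, dotProduct_smul,
      Matrix.one_mulVec, smul_eq_mul]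
  rw [this, star_dotProduct_self_eq, add_im, im_ofReal_mul, mul_assoc, im_ofReal_mul]
  simp [-ofReal_sum]

theorem IsStrictlyDissipative.segment {Z : Matrix ι ι ℂ} (h : IsStrictlyDissipative Z)
    {s : ℝ} (hs : s ∈ Icc (0 : ℝ) 1) : IsStrictlyDissipative (detSegment Z s) := fun c hc => by
  rw [im_quadratic_detSegment]
  have h1 := sum_normSq_pos hc
  have h2 := h c hc
  rcases eq_or_lt_of_le hs.1 with h0 | h0
  · subst h0; simpa using h1
  · have : 0 ≤ (1 - s) * ∑ k, normSq (c k) := mul_nonneg (by linarith [hs.2]) h1.le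
    nlinarith

/-- A kernel vector at a parameter `s < 1` would have quadratic form with imaginary part at most
`-(1 - s)|c|²`, because the starting matrix `-i` is strictly dissipative. Only `s = 1` remains,
where the determinant is nonzero by hypothesis. Strictness of `Z` is not needed, which allows the
limit `±1 ⊕ W` at a crossing. -/
theorem IsDissipative.detPath_ne_zero {Z : Matrix ι ι ℂ} (h : IsDissipative Z) (hZ : Z.det ≠ 0)
    {s : ℝ} (hs : s ∈ Icc (0 : ℝ) 1) : detPath Z s ≠ 0 := fun h0 => by
  obtain ⟨c, hc, hsc⟩ := Matrix.exists_mulVec_eq_zero_iff.2 h0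
  have h1 := sum_normSq_pos hc
  have h2 := im_quadratic_detSegment Z s c
  rw [hsc] at h2
  simp only [dotProduct_zero, zero_im] at h2
  have h3 : s * (star c ⬝ᵥ Z *ᵥ c).im ≤ 0 := mul_nonpos_of_nonneg_of_nonpos hs.1 (h c)
  have h4 : (1 - s) * ∑ k, normSq (c k) = 0 :=
    le_antisymm (by linarith) (mul_nonneg (by linarith [hs.2]) h1.le)
  have h5 : s = 1 := by
    rcases mul_eq_zero.1 h4 with h | h
    · linarith
    · exact absurd h h1.ne'
  subst h5
  exact hZ (by simpa [detPath, detSegment] using h0)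

/-- The determinant along the segment, as a function of the matrix and of the parameter. -/
theorem contDiff_detPath :
    ContDiff ℝ 1 (fun p : (ι → ι → ℂ) × ℝ => detPath (Matrix.of p.1) p.2) := by
  simp only [detPath, Matrix.det_apply, detSegment]
  refine ContDiff.sum fun σ _ => ContDiff.const_smul _ (contDiff_prod fun k _ => ?_)
  simp only [Matrix.add_apply, Matrix.smul_apply, Matrix.of_apply, smul_eq_mul]
  refine ContDiff.add ?_ ?_
  · have h1 : ContDiff ℝ 1 fun p : (ι → ι → ℂ) × ℝ => 1 - p.2 := contDiff_const.sub contDiff_snd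
    have h2 : ContDiff ℝ 1 fun p : (ι → ι → ℂ) × ℝ => ((1 - p.2 : ℝ) : ℂ) :=
      ofRealCLM.contDiff.comp h1
    exact (h2.mul contDiff_const).mul contDiff_const
  · refine ContDiff.mul (ofRealCLM.contDiff.comp contDiff_snd) ?_
    have h1 : ContDiff ℝ 1 fun f : ι → ι → ℂ => f (σ k) k := contDiff_apply_apply ℝ ℂ (σ k) k
    exact h1.comp contDiff_fst

theorem contDiff_detPath_right (Z : Matrix ι ι ℂ) : ContDiff ℝ 1 (detPath Z) := by
  have h : ContDiff ℝ 1 (fun s : ℝ => ((fun k l => Z k l : ι → ι → ℂ), s)) :=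
    ContDiff.prodMk contDiff_const contDiff_id
  have h1 := (contDiff_detPath (ι := ι)).comp h
  have e : Matrix.of (fun k l => Z k l) = Z := rfl
  simp only [Function.comp_def, e] at h1
  exact h1

theorem continuous_entries :
    Continuous fun p : Matrix ι ι ℂ × ℝ => ((fun k l => p.1 k l : ι → ι → ℂ), p.2) :=
  (continuous_pi fun k => continuous_pi fun l => continuous_fst.matrix_elem k l).prodMk
    continuous_snd

theorem continuous_deriv_detPath :
    Continuous (fun p : (Matrix ι ι ℂ) × ℝ => deriv (detPath p.1) p.2) := by
  have h := contDiff_detPath (ι := ι)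
  have h1 : ∀ p : (ι → ι → ℂ) × ℝ, deriv (detPath (Matrix.of p.1)) p.2 =
      fderiv ℝ (fun p : (ι → ι → ℂ) × ℝ => detPath (Matrix.of p.1) p.2) p (0, 1) := by
    intro p
    have h2 := (h.differentiable (by norm_num) p).hasFDerivAt.comp_hasDerivAt p.2
      ((hasDerivAt_const p.2 p.1).prodMk (hasDerivAt_id p.2))
    exact h2.deriv
  have h2 : Continuous fun p : (ι → ι → ℂ) × ℝ => deriv (detPath (Matrix.of p.1)) p.2 := by
    simp only [h1]
    exact (h.continuous_fderiv (by norm_num)).clm_apply continuous_const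
  have h3 := h2.comp (continuous_entries (ι := ι))
  have e : ∀ Z : Matrix ι ι ℂ, Matrix.of (fun k l => Z k l) = Z := fun _ => rfl
  simp only [Function.comp_def, e] at h3
  exact h3

theorem continuous_detPath :
    Continuous (fun p : (Matrix ι ι ℂ) × ℝ => detPath p.1 p.2) := by
  have h3 := (contDiff_detPath (ι := ι)).continuous.comp (continuous_entries (ι := ι))
  have e : ∀ Z : Matrix ι ι ℂ, Matrix.of (fun k l => Z k l) = Z := fun _ => rfl
  simp only [Function.comp_def, e] at h3
  exact h3

/-- The integrand is controlled only for parameters in `[0, 1]`; composing with the projection of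
the line onto the interval makes it continuous everywhere without changing the integral. -/
theorem continuous_integral_of_continuous_Icc {X : Type*} [TopologicalSpace X] {q : X → ℝ → ℂ}
    (h : Continuous fun p : X × Icc (0 : ℝ) 1 => q p.1 p.2) :
    Continuous fun x => ∫ s in (0 : ℝ)..1, q x s := by
  have h' : Continuous fun p : X × ℝ => q p.1 (projIcc (0 : ℝ) 1 zero_le_one p.2) :=
    h.comp (f := fun p : X × ℝ => (p.1, projIcc (0 : ℝ) 1 zero_le_one p.2))
      (continuous_fst.prodMk (continuous_projIcc.comp continuous_snd))
  refine (intervalIntegral.continuous_parametric_intervalIntegral_of_continuous'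
    (μ := MeasureTheory.volume)
    (f := fun x s => q x (projIcc (0 : ℝ) 1 zero_le_one s)) h' 0 1).congr fun x => ?_
  refine intervalIntegral.integral_congr fun s hs => ?_
  rw [uIcc_of_le zero_le_one] at hs
  simp [projIcc_of_mem zero_le_one hs]

/-- Continuity across the whole set, with no choice of branch: each matrix has its own segment to
the common base point `-i`, and the integrand depends continuously on the matrix. -/
theorem continuousOn_logDet :
    ContinuousOn (logDet (ι := ι)) {Z | IsDissipative Z ∧ Z.det ≠ 0} := by
  rw [continuousOn_iff_continuous_domRestrict]
  have hv : Continuous fun p : {Z : Matrix ι ι ℂ | IsDissipative Z ∧ Z.det ≠ 0} × Icc (0 : ℝ) 1 =>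
      ((p.1 : Matrix ι ι ℂ), (p.2 : ℝ)) :=
    (continuous_subtype_val.comp continuous_fst).prodMk
      (continuous_subtype_val.comp continuous_snd)
  have h1 := continuous_deriv_detPath.comp hv
  have h2 := continuous_detPath.comp hv
  have h3 := h1.div h2 fun p => p.1.2.1.detPath_ne_zero p.1.2.2 p.2.2
  simp only [Function.comp_def] at h3
  exact continuous_integral_of_continuous_Icc h3

theorem IsDissipative.exp_logDet {Z : Matrix ι ι ℂ} (h : IsDissipative Z) (hZ : Z.det ≠ 0) :
    exp (logDet Z) * (-I) ^ Fintype.card ι = Z.det := by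
  have := exp_integral_deriv_div (contDiff_detPath_right Z) fun s hs => h.detPath_ne_zero hZ hs
  have h0 : detPath Z 0 = (-I) ^ Fintype.card ι := by
    simp only [detPath, detSegment, sub_zero, ofReal_one, one_mul, ofReal_zero, zero_smul,
      add_zero, Matrix.det_smul, Matrix.det_one, mul_one]
  have h1 : detPath Z 1 = Z.det := by simp [detPath, detSegment]
  rw [h0, h1] at this
  exact this

theorem logDet_submatrix {κ : Type*} [Fintype κ] [DecidableEq κ] (e : κ ≃ ι)
    (Z : Matrix ι ι ℂ) : logDet (Z.submatrix e e) = logDet Z := by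
  have : detPath (Z.submatrix e e) = detPath Z := by
    funext s
    rw [detPath, detPath, ← Matrix.det_submatrix_equiv_self e]
    congr 1
    ext k l
    simp [detSegment, Matrix.one_apply]
  simp [logDet, this]

/-- On strictly dissipative matrices the continuous argument of the determinant is invariant under
congruence. -/
theorem im_logDet_congr {Z G : Matrix ι ι ℂ} (hZ : IsStrictlyDissipative Z) (hG : G.det ≠ 0) :
    (logDet (Gᴴ * Z * G)).im = (logDet Z).im := by
  have hcong : ∀ {Y : Matrix ι ι ℂ}, IsStrictlyDissipative Y →
      IsStrictlyDissipative (Gᴴ * Y * G) := by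
    intro Y hY c hc
    have h1 : star c ⬝ᵥ (Gᴴ * Y * G) *ᵥ c = star (G *ᵥ c) ⬝ᵥ Y *ᵥ (G *ᵥ c) := by
      rw [Matrix.star_mulVec, ← Matrix.dotProduct_mulVec, Matrix.mulVec_mulVec,
        Matrix.mulVec_mulVec, Matrix.mul_assoc]
    rw [h1]
    refine hY _ fun h0 => hG ?_
    exact Matrix.exists_mulVec_eq_zero_iff.1 ⟨c, hc, h0⟩
  -- The difference of the two arguments along the segment from `-i` to `Z` is continuous.
  -- Congruence multiplies the determinant by `|det G|² > 0`, so `g` takes values in `2πℤ`; it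
  -- vanishes at `s = 0`, hence also at `s = 1`.
  let g : ℝ → ℝ := fun s => (logDet (Gᴴ * detSegment Z s * G)).im - (logDet (detSegment Z s)).im
  have hseg : Continuous (detSegment Z) := by
    refine continuous_matrix fun k l => ?_
    simp only [detSegment, Matrix.add_apply, Matrix.smul_apply, smul_eq_mul]
    fun_prop
  have hg : ContinuousOn g (Icc 0 1) := by
    refine ContinuousOn.sub ?_ ?_
    · refine continuous_im.comp_continuousOn ((continuousOn_logDet (ι := ι)).comp
        (Continuous.continuousOn ?_) fun s hs => ?_)
      · exact (continuous_const.matrix_mul hseg).matrix_mul continuous_const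
      · exact ⟨(hcong (hZ.segment hs)).isDissipative, (hcong (hZ.segment hs)).det_ne_zero⟩
    · exact continuous_im.comp_continuousOn ((continuousOn_logDet (ι := ι)).comp
        hseg.continuousOn fun s hs =>
          ⟨(hZ.segment hs).isDissipative, (hZ.segment hs).det_ne_zero⟩)
  have hexp : ∀ s ∈ Icc (0 : ℝ) 1, exp (g s * I) = 1 := by
    intro s hs
    have hY := hZ.segment hs
    have e1 := hY.isDissipative.exp_logDet hY.det_ne_zero
    have e2 := (hcong hY).isDissipative.exp_logDet (hcong hY).det_ne_zero
    have hr : (Gᴴ * detSegment Z s * G).det = (normSq G.det : ℂ) * (detSegment Z s).det := by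
      rw [Matrix.det_mul, Matrix.det_mul, Matrix.det_conjTranspose, normSq_eq_conj_mul_self]
      simp only [RCLike.star_def]
      ring
    have hI : (-I) ^ Fintype.card ι ≠ 0 := pow_ne_zero _ (neg_ne_zero.2 I_ne_zero)
    have e3 : exp (logDet (Gᴴ * detSegment Z s * G)) =
        (normSq G.det : ℂ) * exp (logDet (detSegment Z s)) := by
      apply mul_right_cancel₀ hI
      rw [e2, hr, ← e1, mul_assoc]
    have e4 : exp (logDet (Gᴴ * detSegment Z s * G) - logDet (detSegment Z s)) =
        (normSq G.det : ℂ) := by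
      rw [exp_sub, e3, mul_div_assoc, div_self (exp_ne_zero _), mul_one]
    set w := logDet (Gᴴ * detSegment Z s * G) - logDet (detSegment Z s) with hw
    have hgs : g s = w.im := by simp [g, hw]
    have e5 : Real.exp w.re = normSq G.det := by
      rw [← norm_exp, e4, norm_real, Real.norm_of_nonneg (normSq_nonneg _)]
    have e6 : exp w = exp (w.re) * exp (w.im * I) := by
      rw [← exp_add, re_add_im]
    rw [e4, ← ofReal_exp, e5] at e6
    have : (normSq G.det : ℂ) ≠ 0 := by
      rw [Ne, ofReal_eq_zero, normSq_eq_zero]; exact hG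
    rw [hgs]
    exact (mul_left_cancel₀ this (by rw [mul_one]; exact e6)).symm
  -- A determinant path that is a fixed constant times a real function has real logarithmic
  -- derivative, hence no argument. This applies at `s = 0`, where both segments consist of `-i`
  -- times hermitian matrices.
  have him0 : ∀ r : ℝ → ℝ, ContDiff ℝ 1 r → ∀ Y : Matrix ι ι ℂ,
      (∀ s, detPath Y s = (-I) ^ Fintype.card ι * (r s : ℂ)) → (logDet Y).im = 0 := by
    intro r hr Y hY
    have : ∀ s, deriv (detPath Y) s / detPath Y s = ((@deriv ℝ _ ℝ _ _ _ r s / r s : ℝ) : ℂ) := by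
      intro s
      have hd : HasDerivAt (detPath Y) ((-I) ^ Fintype.card ι * ((deriv r s : ℝ) : ℂ)) s := by
        rw [funext hY]
        exact ((hr.differentiable (by norm_num) s).hasDerivAt.ofReal_comp).const_mul _
      rw [hd.deriv, hY s, mul_div_mul_left _ _ (pow_ne_zero _ (neg_ne_zero.2 I_ne_zero)),
        ofReal_div]
    simp only [logDet, this]
    rw [intervalIntegral.integral_ofReal, ofReal_im]
  have hg0 : g 0 = 0 := by
    have hs0 : detSegment Z 0 = -I • (1 : Matrix ι ι ℂ) := by simp [detSegment]
    have h1 : (logDet (detSegment Z 0)).im = 0 := by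
      refine him0 (fun _ => 1) contDiff_const _ fun s => ?_
      have : detSegment (detSegment Z 0) s = -I • (1 : Matrix ι ι ℂ) := by
        rw [hs0, detSegment, smul_smul, ← add_smul]
        congr 1
        push_cast
        ring
      rw [detPath, this, Matrix.det_smul]
      simp
    have h2 : (logDet (Gᴴ * detSegment Z 0 * G)).im = 0 := by
      let P : ℝ → Matrix ι ι ℂ := fun s => ((1 - s : ℝ) : ℂ) • 1 + (s : ℂ) • (Gᴴ * G)
      have hP : ∀ s, detSegment (Gᴴ * detSegment Z 0 * G) s = -I • P s := by
        intro s
        rw [hs0, detSegment, Matrix.mul_smul, Matrix.mul_one, Matrix.smul_mul]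
        simp only [P, smul_add, smul_smul]
        rw [mul_comm, mul_comm (s : ℂ)]
      have hH : ∀ s, (P s).IsHermitian := by
        intro s
        simp only [P, Matrix.IsHermitian, Matrix.conjTranspose_add, Matrix.conjTranspose_smul,
          Matrix.conjTranspose_one, Matrix.conjTranspose_mul, Matrix.conjTranspose_conjTranspose,
          RCLike.star_def, conj_ofReal]
      have hpath : ∀ s, detPath (Gᴴ * detSegment Z 0 * G) s =
          (-I) ^ Fintype.card ι * ((P s).det.re : ℂ) := by
        intro s
        rw [detPath, hP, Matrix.det_smul]
        congr 1
        have : star (P s).det = (P s).det := by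
          rw [← Matrix.det_conjTranspose, (hH s).eq]
        exact (conj_eq_iff_re.1 this).symm
      refine him0 (fun s => (P s).det.re) ?_ _ hpath
      have h3 : ∀ s, (P s).det =
          ((-I) ^ Fintype.card ι)⁻¹ * detPath (Gᴴ * detSegment Z 0 * G) s := by
        intro s
        rw [detPath, hP, Matrix.det_smul, inv_mul_cancel_left₀]
        exact pow_ne_zero _ (neg_ne_zero.2 I_ne_zero)
      simp only [h3]
      exact reCLM.contDiff.comp (contDiff_const.mul (contDiff_detPath_right _))
    simp only [g, h1, h2, sub_zero]
  have hg1 : g 1 = 0 := by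
    by_contra hne
    have hπ : ∀ s ∈ Icc (0 : ℝ) 1, ∃ k : ℤ, g s = k * (2 * Real.pi) := by
      intro s hs
      obtain ⟨k, hk⟩ := exp_eq_one_iff.1 (hexp s hs)
      refine ⟨k, ?_⟩
      have : (g s : ℂ) = ((k * (2 * Real.pi) : ℝ) : ℂ) := by
        apply mul_right_cancel₀ I_ne_zero
        rw [hk]; push_cast; ring
      exact_mod_cast this
    obtain ⟨k, hk⟩ := hπ 1 (by simp)
    have hk0 : k ≠ 0 := by rintro rfl; simp at hk; exact hne hk
    have hpi := Real.pi_pos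
    -- A nonzero multiple of `2π` at the end would force `g` through `π` or `-π`, which are not
    -- multiples of `2π`.
    have key : ∀ y, y ∈ uIcc (g 0) (g 1) → |y| = Real.pi → False := by
      intro y hy hyabs
      obtain ⟨s, hs, hsy⟩ := intermediate_value_uIcc (by rwa [uIcc_of_le zero_le_one]) hy
      rw [uIcc_of_le zero_le_one] at hs
      obtain ⟨l, hl⟩ := hπ s hs
      rw [← hsy, hl, abs_mul, abs_of_pos (by positivity : (0 : ℝ) < 2 * Real.pi)] at hyabs
      have h2 : |(l : ℝ)| * 2 = 1 := by
        apply mul_right_cancel₀ hpi.ne'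
        linarith
      have h3 : |l| * 2 = 1 := by exact_mod_cast h2
      omega
    rw [hg0, hk] at key
    rcases lt_or_gt_of_ne hk0 with h | h
    · have : (k : ℝ) ≤ -1 := by exact_mod_cast Int.le_sub_one_of_lt h
      exact key (-Real.pi) (mem_uIcc.2 (Or.inr ⟨by nlinarith, by linarith⟩))
        (by rw [abs_neg, abs_of_pos hpi])
    · have : (1 : ℝ) ≤ k := by exact_mod_cast h
      exact key Real.pi (mem_uIcc.2 (Or.inl ⟨hpi.le, by nlinarith⟩)) (abs_of_pos hpi)
  have : detSegment Z 1 = Z := by simp [detSegment]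
  simp only [g, this] at hg1
  linarith

/-- The continuous argument of the determinant of `-1 ⊕ W` is smaller than that of `1 ⊕ W`. -/
theorem im_logDet_fromBlocks_lt {κ : Type*} [Fintype κ] [DecidableEq κ] [Nonempty κ]
    {W : Matrix ι ι ℂ} (hW : IsStrictlyDissipative W) :
    (logDet (Matrix.fromBlocks (-1 : Matrix κ κ ℂ) 0 0 W)).im <
      (logDet (Matrix.fromBlocks (1 : Matrix κ κ ℂ) 0 0 W)).im := by
  -- The scalar moving on the segment from `-i` to `c`, for `c = 1` or `c = -1`. The determinant
  -- path of the block matrix is a power of `u` times the path of `W`.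
  let u : ℝ → ℝ → ℂ := fun c s => ((1 - s : ℝ) : ℂ) * -I + (s : ℂ) * (c : ℂ)
  let D : ℝ → Matrix (κ ⊕ ι) (κ ⊕ ι) ℂ := fun c =>
    Matrix.fromBlocks ((c : ℂ) • (1 : Matrix κ κ ℂ)) 0 0 W
  have hD : ∀ c s, detPath (D c) s = u c s ^ Fintype.card κ * detPath W s := by
    intro c s
    have : detSegment (D c) s =
        Matrix.fromBlocks (u c s • (1 : Matrix κ κ ℂ)) 0 0 (detSegment W s) := by
      simp only [detSegment, D, ← Matrix.fromBlocks_one, Matrix.fromBlocks_smul,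
        Matrix.fromBlocks_add, smul_zero, add_zero, smul_smul, ← add_smul, u]
    rw [detPath, this, Matrix.det_fromBlocks_zero₂₁, Matrix.det_smul, Matrix.det_one, mul_one,
      detPath]
  have hu : ∀ c s, HasDerivAt (u c) (I + c) s := by
    intro c s
    have h1 : HasDerivAt (fun s : ℝ => ((1 - s : ℝ) : ℂ) * -I) (((-1 : ℝ) : ℂ) * -I) s :=
      ((hasDerivAt_id s).const_sub 1).ofReal_comp.mul_const _
    have h2 : HasDerivAt (fun s : ℝ => (s : ℂ) * (c : ℂ)) (((1 : ℝ) : ℂ) * c) s :=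
      (hasDerivAt_id s).ofReal_comp.mul_const _
    have h3 := h1.add h2
    have e : ((-1 : ℝ) : ℂ) * -I + ((1 : ℝ) : ℂ) * c = I + c := by push_cast; ring
    rw [e] at h3
    exact h3
  have hn : ∀ s : ℝ, 0 < (1 - s) ^ 2 + s ^ 2 := fun s => by nlinarith [sq_nonneg (1 - 2 * s)]
  have hn' : ∀ c : ℝ, c ^ 2 = 1 → ∀ s, normSq (u c s) = (1 - s) ^ 2 + s ^ 2 := by
    intro c hc s
    simp only [u, normSq_apply, add_re, add_im, mul_re, mul_im, ofReal_re, ofReal_im, neg_re,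
      neg_im, I_re, I_im]
    linear_combination (s ^ 2) * hc
  have hu0 : ∀ c : ℝ, c ^ 2 = 1 → ∀ s, u c s ≠ 0 := fun c hc s h => by
    have := hn' c hc s
    rw [h, map_zero] at this
    exact absurd this (hn s).ne
  have hW0 : ∀ s ∈ Icc (0 : ℝ) 1, detPath W s ≠ 0 := fun s hs =>
    hW.isDissipative.detPath_ne_zero hW.det_ne_zero hs
  let q : ℝ → ℂ := fun s => deriv (detPath W) s / detPath W s
  have hq : ContinuousOn q (Icc 0 1) :=
    ((contDiff_detPath_right W).continuous_deriv le_rfl).continuousOn.div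
      (contDiff_detPath_right W).continuous.continuousOn hW0
  have hqi : IntervalIntegrable (fun s => (q s).im) MeasureTheory.volume 0 1 :=
    ContinuousOn.intervalIntegrable (by
      rw [uIcc_of_le zero_le_one]; exact continuous_im.comp_continuousOn hq)
  -- For `c² = 1` the imaginary part of `(i + c) / u` is `c / ((1 - s)² + s²)`, so the two signs
  -- turn the scalar block at opposite rates, while `W` contributes the same integral to both.
  have hlog : ∀ c : ℝ, c ^ 2 = 1 → (logDet (D c)).im =
      ∫ s in (0 : ℝ)..1, (Fintype.card κ * (c / ((1 - s) ^ 2 + s ^ 2)) + (q s).im : ℝ) := by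
    intro c hc
    have h1 : ∀ s ∈ uIcc (0 : ℝ) 1, deriv (detPath (D c)) s / detPath (D c) s =
        Fintype.card κ * ((I + c) / u c s) + q s := by
      intro s hs
      rw [uIcc_of_le zero_le_one] at hs
      have hd : HasDerivAt (detPath (D c))
          (Fintype.card κ * u c s ^ (Fintype.card κ - 1) * (I + c) * detPath W s +
            u c s ^ Fintype.card κ * deriv (detPath W) s) s := by
        rw [funext (hD c)]
        exact ((hu c s).pow (Fintype.card κ)).mul
          ((contDiff_detPath_right W).differentiable (by norm_num) s).hasDerivAt
      have hpos : Fintype.card κ ≠ 0 := Fintype.card_ne_zero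
      obtain ⟨d, hd'⟩ := Nat.exists_eq_succ_of_ne_zero hpos
      rw [hd.deriv, hD]
      have e1 := hu0 c hc s
      have e2 := hW0 s hs
      simp only [q, hd', Nat.succ_sub_one, pow_succ, Nat.succ_eq_add_one]
      field_simp
    have hi : IntervalIntegrable (fun s => (Fintype.card κ * ((I + c) / u c s) + q s : ℂ))
        MeasureTheory.volume 0 1 := by
      apply ContinuousOn.intervalIntegrable
      rw [uIcc_of_le zero_le_one]
      refine (continuousOn_const.mul (continuousOn_const.div ?_ fun s _ => hu0 c hc s)).add hq
      exact (continuous_iff_continuousAt.2 fun s => (hu c s).continuousAt).continuousOn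
    rw [logDet, intervalIntegral.integral_congr h1]
    have := (imCLM.intervalIntegral_comp_comm hi).symm
    simp only [imCLM_apply] at this
    rw [this]
    refine intervalIntegral.integral_congr fun s _ => ?_
    have e : (((Fintype.card κ : ℕ) : ℂ) * ((I + c) / u c s)).im =
        Fintype.card κ * (c / ((1 - s) ^ 2 + s ^ 2)) := by
      have : ((Fintype.card κ : ℕ) : ℂ) = ((Fintype.card κ : ℝ) : ℂ) := by push_cast; rfl
      rw [this, im_ofReal_mul, div_im, hn' c hc s]
      congr 1
      simp only [u, add_re, add_im, mul_re, mul_im, ofReal_re, ofReal_im, neg_re,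
        neg_im, I_re, I_im]
      field_simp
      congr 1
      ring
    simp only [add_im, e]
  have hD1 : Matrix.fromBlocks (1 : Matrix κ κ ℂ) 0 0 W = D 1 := by simp [D]
  have hD2 : Matrix.fromBlocks (-1 : Matrix κ κ ℂ) 0 0 W = D (-1) := by simp [D]
  have hcont : ∀ c : ℝ, Continuous fun s : ℝ => (Fintype.card κ : ℝ) * (c / ((1 - s) ^ 2 + s ^ 2)) :=
    fun c => continuous_const.mul
      (continuous_const.div (by fun_prop) fun s => (hn s).ne')
  rw [hD1, hD2, hlog 1 (by norm_num), hlog (-1) (by norm_num),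
    intervalIntegral.integral_add ((hcont _).intervalIntegrable _ _) hqi,
    intervalIntegral.integral_add ((hcont _).intervalIntegrable _ _) hqi]
  have hκ : (0 : ℝ) < Fintype.card κ := by exact_mod_cast Fintype.card_pos
  refine add_lt_add_left ?_ _
  refine intervalIntegral.integral_lt_integral_of_continuousOn_of_le_of_exists_lt zero_lt_one
    (hcont _).continuousOn (hcont _).continuousOn (fun s _ => ?_) ⟨0, by simp, ?_⟩
  · have := (hn s).le
    gcongr
    norm_num
  · norm_num
    have : 0 < Fintype.card κ := Fintype.card_pos
    omega

end LogDet


/-! ### Compatible complex structures on the model space -/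

section ModelSpace

variable {n : ℕ}

@[simp]
theorem stdSymplectic_apply (u v : CotangentModel n) :
    stdSymplectic n u v = u.2 v.1 - v.2 u.1 := rfl

theorem stdSymplectic_swap (u v : CotangentModel n) :
    stdSymplectic n v u = -stdSymplectic n u v := by simp

theorem stdSymplectic_vertical {u v : CotangentModel n} (hu : u.1 = 0) (hv : v.1 = 0) :
    stdSymplectic n u v = 0 := by simp [hu, hv]

/-- A complex structure on the model space that is compatible with the symplectic form. -/
structure IsCompatible (J : CotangentModel n →L[ℝ] CotangentModel n) : Prop where
  sq : ∀ u, J (J u) = -u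
  symplectic : ∀ u v, stdSymplectic n (J u) (J v) = stdSymplectic n u v
  pos : ∀ u, u ≠ 0 → 0 < stdSymplectic n (J u) u

/-- The hermitian form `g + i ω` of a complex structure on the model space. -/
def stdHerm (J : CotangentModel n →L[ℝ] CotangentModel n) (u v : CotangentModel n) : ℂ :=
  (stdSymplectic n (J u) v : ℂ) + (stdSymplectic n u v : ℂ) * Complex.I

@[simp]
theorem stdHerm_re (J : CotangentModel n →L[ℝ] CotangentModel n) (u v : CotangentModel n) :
    (stdHerm J u v).re = stdSymplectic n (J u) v := by
  simp [stdHerm, -stdSymplectic_apply]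

@[simp]
theorem stdHerm_im (J : CotangentModel n →L[ℝ] CotangentModel n) (u v : CotangentModel n) :
    (stdHerm J u v).im = stdSymplectic n u v := by
  simp [stdHerm, -stdSymplectic_apply]

/-- The horizontal component of a complex structure on the vertical plane. -/
def verticalBlock (J : CotangentModel n →L[ℝ] CotangentModel n) :
    (EuclideanSpace ℝ (Fin n) →L[ℝ] ℝ) →L[ℝ] EuclideanSpace ℝ (Fin n) :=
  (ContinuousLinearMap.fst ℝ _ _).comp (J.comp (ContinuousLinearMap.inr ℝ _ _))

/-- The vertical vector `w` for which `J w + v` is vertical. -/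
def vertLift (J : CotangentModel n →L[ℝ] CotangentModel n) :
    CotangentModel n →L[ℝ] CotangentModel n :=
  -((ContinuousLinearMap.inr ℝ _ _).comp
    ((verticalBlock J).inverse.comp (ContinuousLinearMap.fst ℝ _ _)))

@[simp]
theorem vertLift_fst (J : CotangentModel n →L[ℝ] CotangentModel n) (v : CotangentModel n) :
    (vertLift J v).1 = 0 := by simp [vertLift]

theorem vertLift_eq_zero {J : CotangentModel n →L[ℝ] CotangentModel n} {v : CotangentModel n}
    (hv : v.1 = 0) : vertLift J v = 0 := by simp [vertLift, hv]

/-- The entries of the complex symmetric matrix that represents a lagrangian plane relative to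
the vertical plane. -/
def lagEntry (J : CotangentModel n →L[ℝ] CotangentModel n) (v v' : CotangentModel n) : ℂ :=
  stdHerm J v (vertLift J v')

namespace IsCompatible

variable {J : CotangentModel n →L[ℝ] CotangentModel n} (hJ : IsCompatible J)
include hJ

theorem symplectic_left (u v : CotangentModel n) :
    stdSymplectic n (J u) v = -stdSymplectic n u (J v) := by
  have := hJ.symplectic u (J v)
  rw [hJ.sq, map_neg] at this
  linarith

theorem metric_comm (u v : CotangentModel n) :
    stdSymplectic n (J u) v = stdSymplectic n (J v) u := by
  rw [hJ.symplectic_left, ← stdSymplectic_swap]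

/-- If `J` sent a nonzero vertical vector `w` to a vertical one, then `ω(J w, w)` would vanish
because the vertical plane is isotropic, against positivity. -/
theorem verticalBlock_injective : Function.Injective (verticalBlock J) := by
  rw [injective_iff_map_eq_zero]
  intro w hw
  by_contra hne
  have h1 := hJ.pos (0, w) (by simpa using hne)
  have h2 : (J (0, w)).1 = 0 := hw
  simp [h2] at h1

/-- Ensures that the `inverse` in `vertLift` is a genuine inverse rather than its default value `0`.
-/
theorem exists_verticalBlock_equiv :
    ∃ e : (EuclideanSpace ℝ (Fin n) →L[ℝ] ℝ) ≃L[ℝ] EuclideanSpace ℝ (Fin n),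
      (e : _ →L[ℝ] _) = verticalBlock J := by
  have hd : Module.finrank ℝ (EuclideanSpace ℝ (Fin n) →L[ℝ] ℝ) =
      Module.finrank ℝ (EuclideanSpace ℝ (Fin n)) := by
    rw [← (LinearMap.toContinuousLinearMap (𝕜 := ℝ) (E := EuclideanSpace ℝ (Fin n))
      (F' := ℝ)).finrank_eq]
    exact Subspace.dual_finrank_eq
  refine ⟨(LinearEquiv.ofInjectiveOfFinrankEq (verticalBlock J : _ →ₗ[ℝ] _)
    hJ.verticalBlock_injective hd).toContinuousLinearEquiv, ?_⟩
  ext w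
  rfl

theorem J_vertLift_fst (v : CotangentModel n) : (J (vertLift J v)).1 = -v.1 := by
  obtain ⟨e, he⟩ := hJ.exists_verticalBlock_equiv
  have h1 : ∀ w, (J (0, w)).1 = e w := fun w => by
    change verticalBlock J w = _
    rw [← he]; rfl
  have h2 : vertLift J v = (0, -(e.symm v.1)) := by
    simp only [vertLift, ← he, ContinuousLinearMap.inverse_equiv]
    ext <;> simp
  rw [h2, h1]
  simp

theorem eq_vertLift {v w : CotangentModel n} (hw : w.1 = 0) (h : (J w).1 = -v.1) :
    w = vertLift J v := by
  have h1 : w.2 = (vertLift J v).2 := by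
    apply hJ.verticalBlock_injective
    have e : ∀ u : CotangentModel n, u.1 = 0 → verticalBlock J u.2 = (J u).1 := by
      intro u hu
      have : u = (0, u.2) := by ext <;> simp [hu]
      conv_rhs => rw [this]
      rfl
    rw [e w hw, e _ (vertLift_fst J v), h, hJ.J_vertLift_fst]
  exact Prod.ext (by simp [hw]) h1

theorem vertLift_ne_zero {v : CotangentModel n} (hv : v.1 ≠ 0) : vertLift J v ≠ 0 := fun h => by
  have := hJ.J_vertLift_fst v
  rw [h, map_zero] at this
  simp at this
  exact hv this

/-- With `w = vertLift J v` and `w' = vertLift J v'`, the vectors `v + J w` and `v' + J w'` are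
vertical. Expanding their vanishing pairing leaves only the two mixed terms, since `ω(v, v') = 0`
and `ω(J w, J w') = ω(w, w') = 0`. -/
theorem lagEntry_re {v v' : CotangentModel n} (h : stdSymplectic n v v' = 0) :
    (lagEntry J v v').re = stdSymplectic n (J (vertLift J v)) v' := by
  have hv : (v + J (vertLift J v)).1 = 0 := by simp [hJ.J_vertLift_fst]
  have hv' : (v' + J (vertLift J v')).1 = 0 := by simp [hJ.J_vertLift_fst]
  have h1 := stdSymplectic_vertical hv hv'
  have h2 := hJ.symplectic (vertLift J v) (vertLift J v')
  rw [stdSymplectic_vertical (vertLift_fst _ _) (vertLift_fst _ _)] at h2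
  simp only [map_add, LinearMap.add_apply] at h1
  rw [lagEntry, stdHerm_re, hJ.symplectic_left v]
  linarith

/-- Pairing the vertical vectors `v + J w` and `w'` shows that the imaginary part is minus the
metric evaluated on the vertical lifts. This sign is the source of dissipativity. -/
theorem lagEntry_im (v v' : CotangentModel n) :
    (lagEntry J v v').im = -stdSymplectic n (J (vertLift J v)) (vertLift J v') := by
  have hv : (v + J (vertLift J v)).1 = 0 := by simp [hJ.J_vertLift_fst]
  have h1 := stdSymplectic_vertical hv (vertLift_fst J v')
  simp only [map_add, LinearMap.add_apply] at h1
  rw [lagEntry, stdHerm_im]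
  linarith

theorem lagEntry_comm {v v' : CotangentModel n} (h : stdSymplectic n v v' = 0) :
    lagEntry J v v' = lagEntry J v' v := by
  have h' : stdSymplectic n v' v = 0 := by rw [stdSymplectic_swap, h, neg_zero]
  have hv : (v + J (vertLift J v)).1 = 0 := by simp [hJ.J_vertLift_fst]
  have hv' : (v' + J (vertLift J v')).1 = 0 := by simp [hJ.J_vertLift_fst]
  apply Complex.ext
  · rw [hJ.lagEntry_re h', lagEntry, stdHerm_re, hJ.symplectic_left, ← stdSymplectic_swap]
  · rw [hJ.lagEntry_im, hJ.lagEntry_im, hJ.metric_comm]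

end IsCompatible

/-- The complex symmetric matrix that represents the plane spanned by a family of vectors,
relative to the vertical plane. -/
def lagMatrix {ι : Type*} (J : CotangentModel n →L[ℝ] CotangentModel n)
    (a : ι → CotangentModel n) : Matrix ι ι ℂ :=
  Matrix.of fun k l => lagEntry J (a k) (a l)

namespace IsCompatible

variable {J : CotangentModel n →L[ℝ] CotangentModel n} (hJ : IsCompatible J)
include hJ
variable {ι : Type*} [Fintype ι] [DecidableEq ι]

/-- By symmetry of the matrix, its real part contributes an antisymmetric double sum, which cancels;
its imaginary part is minus the Gram matrix of the vertical lifts, evaluated separately on the real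
and imaginary parts of `c`. -/
theorem im_quadratic_lagMatrix {a : ι → CotangentModel n}
    (ha : ∀ k l, stdSymplectic n (a k) (a l) = 0) (c : ι → ℂ) :
    (star c ⬝ᵥ (lagMatrix J a).mulVec c).im =
      -stdSymplectic n (J (vertLift J (∑ k, (c k).re • a k))) (vertLift J (∑ k, (c k).re • a k))
      -stdSymplectic n (J (vertLift J (∑ k, (c k).im • a k)))
        (vertLift J (∑ k, (c k).im • a k)) := by
  have hsum : ∀ x : ι → ℝ,
      stdSymplectic n (J (vertLift J (∑ k, x k • a k))) (vertLift J (∑ k, x k • a k)) =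
        -∑ k, ∑ l, x k * x l * (lagEntry J (a k) (a l)).im := by
    intro x
    simp only [map_sum, map_smul, LinearMap.sum_apply, LinearMap.smul_apply, smul_eq_mul,
      hJ.lagEntry_im, ← Finset.sum_neg_distrib, Finset.mul_sum]
    rw [Finset.sum_comm]
    exact Finset.sum_congr rfl fun k _ => Finset.sum_congr rfl fun l _ => by ring
  have hanti : ∑ k, ∑ l, ((c k).re * (c l).im - (c k).im * (c l).re) *
      (lagEntry J (a k) (a l)).re = 0 := by
    have : ∑ k, ∑ l, ((c k).re * (c l).im - (c k).im * (c l).re) * (lagEntry J (a k) (a l)).re =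
        -∑ k, ∑ l, ((c k).re * (c l).im - (c k).im * (c l).re) *
          (lagEntry J (a k) (a l)).re := by
      conv_lhs => rw [Finset.sum_comm]
      simp only [← Finset.sum_neg_distrib]
      refine Finset.sum_congr rfl fun k _ => Finset.sum_congr rfl fun l _ => ?_
      rw [hJ.lagEntry_comm (ha l k)]
      ring
    linarith
  rw [hsum, hsum, neg_neg, sub_neg_eq_add, ← add_zero (_ + _), ← hanti]
  simp only [dotProduct, Matrix.mulVec, Finset.mul_sum, Complex.im_sum, ← Finset.sum_add_distrib]
  refine Finset.sum_congr rfl fun k _ => Finset.sum_congr rfl fun l _ => ?_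
  simp only [lagMatrix, Matrix.of_apply, Pi.star_apply, RCLike.star_def, Complex.mul_im,
    Complex.mul_re, Complex.conj_re, Complex.conj_im]
  ring

theorem metric_nonneg (u : CotangentModel n) : 0 ≤ stdSymplectic n (J u) u := by
  rcases eq_or_ne u 0 with rfl | h
  · simp
  · exact (hJ.pos u h).le

theorem isDissipative_lagMatrix {a : ι → CotangentModel n}
    (ha : ∀ k l, stdSymplectic n (a k) (a l) = 0) : IsDissipative (lagMatrix J a) := fun c => by
  rw [hJ.im_quadratic_lagMatrix ha]
  linarith [hJ.metric_nonneg (vertLift J (∑ k, (c k).re • a k)),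
    hJ.metric_nonneg (vertLift J (∑ k, (c k).im • a k))]

/-- A real combination of the `a k` with vanishing lift is vertical, and independence of the
horizontal parts excludes this unless the coefficients vanish. -/
theorem isStrictlyDissipative_lagMatrix {a : ι → CotangentModel n}
    (ha : ∀ k l, stdSymplectic n (a k) (a l) = 0)
    (hli : LinearIndependent ℝ fun k => (a k).1) :
    IsStrictlyDissipative (lagMatrix J a) := fun c hc => by
  rw [hJ.im_quadratic_lagMatrix ha]
  have key : ∀ x : ι → ℝ, x ≠ 0 → 0 < stdSymplectic n (J (vertLift J (∑ k, x k • a k)))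
      (vertLift J (∑ k, x k • a k)) := by
    intro x hx
    refine hJ.pos _ (hJ.vertLift_ne_zero fun h0 => hx ?_)
    rw [Prod.fst_sum] at h0
    simp only [Prod.smul_fst] at h0
    exact funext (Fintype.linearIndependent_iff.1 hli x h0)
  have h1 := hJ.metric_nonneg (vertLift J (∑ k, (c k).re • a k))
  have h2 := hJ.metric_nonneg (vertLift J (∑ k, (c k).im • a k))
  by_cases hre : (fun k => (c k).re) = 0
  · have him : (fun k => (c k).im) ≠ 0 := fun h => hc (funext fun k =>
      Complex.ext (congrFun hre k) (congrFun h k))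
    linarith [key _ him]
  · linarith [key _ hre]

end IsCompatible

theorem lagMatrix_sum {ι κ : Type*} [Fintype ι] (J : CotangentModel n →L[ℝ] CotangentModel n)
    (a : ι → CotangentModel n) (G : Matrix ι κ ℝ) :
    lagMatrix J (fun k => ∑ m, G m k • a m) =
      (G.map Complex.ofReal).conjTranspose * lagMatrix J a * G.map Complex.ofReal := by
  ext k l
  have hsum : ∀ u v : ι → ℝ, lagEntry J (∑ m, u m • a m) (∑ p, v p • a p) =
      ∑ p, ∑ m, (u m : ℂ) * lagEntry J (a m) (a p) * (v p : ℂ) := by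
    intro u v
    apply Complex.ext
    · simp only [lagEntry, stdHerm_re, map_sum, map_smul, LinearMap.sum_apply,
        LinearMap.smul_apply, smul_eq_mul, Complex.re_sum, Complex.re_mul_ofReal,
        Complex.re_ofReal_mul, Finset.mul_sum]
      exact Finset.sum_congr rfl fun _ _ => Finset.sum_congr rfl fun _ _ => by ring
    · simp only [lagEntry, stdHerm_im, map_sum, map_smul, LinearMap.sum_apply,
        LinearMap.smul_apply, smul_eq_mul, Complex.im_sum, Complex.im_mul_ofReal,
        Complex.im_ofReal_mul, Finset.mul_sum]
      exact Finset.sum_congr rfl fun _ _ => Finset.sum_congr rfl fun _ _ => by ring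
  simp only [lagMatrix, Matrix.of_apply, hsum, Matrix.mul_apply, Matrix.conjTranspose_apply,
    Matrix.map_apply, RCLike.star_def, Complex.conj_ofReal, Finset.sum_mul]

/-- The continuous argument of `det (L) / det (V)`, for a lagrangian plane `L` that is the image of
the linear map `A`. -/
def lagArg (J : CotangentModel n →L[ℝ] CotangentModel n)
    (A : EuclideanSpace ℝ (Fin n) →L[ℝ] CotangentModel n) : ℝ :=
  (logDet (lagMatrix J fun k => A (EuclideanSpace.basisFun (Fin n) ℝ k))).im

/-- The linear map `A` into the model space parametrises an isotropic plane. -/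
def IsIsotropic (A : EuclideanSpace ℝ (Fin n) →L[ℝ] CotangentModel n) : Prop :=
  ∀ u v, stdSymplectic n (A u) (A v) = 0

/-- The horizontal part of a linear map into the model space. -/
def horizontalPart (A : EuclideanSpace ℝ (Fin n) →L[ℝ] CotangentModel n) :
    EuclideanSpace ℝ (Fin n) →L[ℝ] EuclideanSpace ℝ (Fin n) :=
  (ContinuousLinearMap.fst ℝ _ _).comp A

@[simp]
theorem horizontalPart_apply (A : EuclideanSpace ℝ (Fin n) →L[ℝ] CotangentModel n)
    (u : EuclideanSpace ℝ (Fin n)) : horizontalPart A u = (A u).1 := rfl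

theorem linearIndependent_horizontalPart {ι : Type*}
    {A : EuclideanSpace ℝ (Fin n) →L[ℝ] CotangentModel n}
    (hA : Function.Injective (horizontalPart A)) {b : ι → EuclideanSpace ℝ (Fin n)}
    (hb : LinearIndependent ℝ b) : LinearIndependent ℝ fun k => (A (b k)).1 :=
  LinearIndependent.map_injOn hb (horizontalPart A).toLinearMap hA.injOn

/-- A change of basis acts on the matrix by a real congruence (`lagMatrix_sum`), so
`im_logDet_congr` makes the argument a function of the plane alone. The freedom in the basis and in
its index type is used to adapt bases to the kernel at a crossing. -/
theorem IsCompatible.im_logDet_lagMatrix_basis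
    {J : CotangentModel n →L[ℝ] CotangentModel n} (hJ : IsCompatible J)
    {A : EuclideanSpace ℝ (Fin n) →L[ℝ] CotangentModel n} (hA : IsIsotropic A)
    (hX : Function.Injective (horizontalPart A)) {ι : Type*} [Fintype ι] [DecidableEq ι]
    (b : Module.Basis ι ℝ (EuclideanSpace ℝ (Fin n))) :
    (logDet (lagMatrix J fun k => A (b k))).im = lagArg J A := by
  let e : Fin n ≃ ι := (EuclideanSpace.basisFun (Fin n) ℝ).toBasis.indexEquiv b
  let b' := b.reindex e.symm
  have h1 : lagMatrix J (fun k => A (b' k)) =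
      (lagMatrix J fun k => A (b k)).submatrix e e := by
    ext k l
    simp [lagMatrix, b']
  rw [← logDet_submatrix e, ← h1]
  let c := (EuclideanSpace.basisFun (Fin n) ℝ).toBasis
  let G := c.toMatrix b'
  have h2 : (fun k => A (b' k)) = fun k => ∑ m, G m k • A (c m) := by
    funext k
    simp only [G, ← map_smul, ← map_sum]
    rw [c.sum_toMatrix_smul_self]
  have h3 : G.det ≠ 0 := by
    have : G * b'.toMatrix c = 1 := c.toMatrix_mul_toMatrix_flip b'
    intro h0
    have := congrArg Matrix.det this
    simp [Matrix.det_mul, h0] at this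
  rw [h2, lagMatrix_sum]
  have h4 : (fun k => A (EuclideanSpace.basisFun (Fin n) ℝ k)) = fun k => A (c k) := by
    simp [c]
  rw [lagArg, h4]
  refine im_logDet_congr (hJ.isStrictlyDissipative_lagMatrix (fun k l => hA _ _)
    (linearIndependent_horizontalPart hX c.linearIndependent)) ?_
  have h5 : (G.map Complex.ofReal).det = (G.det : ℂ) :=
    (RingHom.map_det Complex.ofRealHom G).symm
  rw [h5]
  exact_mod_cast h3

theorem lagArg_congr_right {J : CotangentModel n →L[ℝ] CotangentModel n} (hJ : IsCompatible J)
    {A : EuclideanSpace ℝ (Fin n) →L[ℝ] CotangentModel n} (hA : IsIsotropic A)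
    (hX : Function.Injective (horizontalPart A))
    (g : EuclideanSpace ℝ (Fin n) ≃L[ℝ] EuclideanSpace ℝ (Fin n)) :
    lagArg J (A.comp (g : _ →L[ℝ] _)) = lagArg J A := by
  rw [← hJ.im_logDet_lagMatrix_basis hA hX
    ((EuclideanSpace.basisFun (Fin n) ℝ).toBasis.map g.toLinearEquiv)]
  simp [lagArg]

/-- The matrix of a lagrangian plane is invariant under symplectic maps which preserve the
vertical plane. -/
theorem lagEntry_map {J J' : CotangentModel n →L[ℝ] CotangentModel n}
    (hJ : IsCompatible J) (hJ' : IsCompatible J')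
    {Φ : CotangentModel n →L[ℝ] CotangentModel n}
    (hΦ : ∀ u v, stdSymplectic n (Φ u) (Φ v) = stdSymplectic n u v)
    (hΦV : ∀ u, u.1 = 0 → (Φ u).1 = 0) (hΦJ : ∀ u, J' (Φ u) = Φ (J u))
    (v v' : CotangentModel n) : lagEntry J' (Φ v) (Φ v') = lagEntry J v v' := by
  have h1 : Φ (vertLift J v') = vertLift J' (Φ v') := by
    apply hJ'.eq_vertLift
    · exact hΦV _ (vertLift_fst _ _)
    · have h2 : (Φ (J (vertLift J v') + v')).1 = 0 :=
        hΦV _ (by simp [hJ.J_vertLift_fst])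
      rw [hΦJ]
      rw [map_add, Prod.fst_add] at h2
      exact eq_neg_of_add_eq_zero_left h2
  rw [lagEntry, ← h1, lagEntry, stdHerm, stdHerm, hΦJ, hΦ, hΦ]

theorem lagArg_map {J J' : CotangentModel n →L[ℝ] CotangentModel n}
    (hJ : IsCompatible J) (hJ' : IsCompatible J')
    {Φ : CotangentModel n →L[ℝ] CotangentModel n}
    (hΦ : ∀ u v, stdSymplectic n (Φ u) (Φ v) = stdSymplectic n u v)
    (hΦV : ∀ u, u.1 = 0 → (Φ u).1 = 0) (hΦJ : ∀ u, J' (Φ u) = Φ (J u))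
    (A : EuclideanSpace ℝ (Fin n) →L[ℝ] CotangentModel n) :
    lagArg J' (Φ.comp A) = lagArg J A := by
  simp only [lagArg, lagMatrix, ContinuousLinearMap.comp_apply, lagEntry_map hJ hJ' hΦ hΦV hΦJ]

/-- A positive definite symmetric form has an orthonormal basis. -/
theorem exists_orthonormal_basis_of_pos {K : Type*} [AddCommGroup K] [Module ℝ K]
    [FiniteDimensional ℝ K] (B : LinearMap.BilinForm ℝ K) (hs : ∀ u v, B u v = B v u)
    (hp : ∀ u, u ≠ 0 → 0 < B u u) :
    ∃ b : Module.Basis (Fin (Module.finrank ℝ K)) ℝ K,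
      ∀ k l, B (b k) (b l) = if k = l then 1 else 0 := by
  obtain ⟨v, hv⟩ := LinearMap.BilinForm.exists_orthogonal_basis (B := B) ⟨fun u v => by simp [hs u v]⟩
  have hpos : ∀ k, 0 < B (v k) (v k) := fun k => hp _ (v.ne_zero k)
  have hu : ∀ k, IsUnit (Real.sqrt (B (v k) (v k)))⁻¹ := fun k =>
    (inv_ne_zero (Real.sqrt_pos.2 (hpos k)).ne').isUnit
  refine ⟨v.isUnitSMul hu, fun k l => ?_⟩
  simp only [Module.Basis.isUnitSMul_apply, map_smul, LinearMap.smul_apply, smul_eq_mul]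
  split_ifs with h
  · subst h
    have h1 := Real.mul_self_sqrt (hpos k).le
    have h2 := (Real.sqrt_pos.2 (hpos k)).ne'
    field_simp
    rw [sq, h1]
  · have : B (v k) (v l) = 0 := hv h
    simp [this]

/-- The complex structure `(a, α) ↦ (-α, a)` of the model space. -/
def stdComplex (n : ℕ) : CotangentModel n →L[ℝ] CotangentModel n :=
  LinearMap.toContinuousLinearMap
    { toFun := fun u => (-(InnerProductSpace.toDual ℝ _).symm u.2, InnerProductSpace.toDual ℝ _ u.1)
      map_add' := fun u v => by ext <;> simp [add_comm]
      map_smul' := fun c u => by ext <;> simp }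

theorem isCompatible_stdComplex (n : ℕ) : IsCompatible (stdComplex n) := by
  have hfst : ∀ u, (stdComplex n u).1 = -(InnerProductSpace.toDual ℝ _).symm u.2 := fun _ => rfl
  have hsnd : ∀ u, (stdComplex n u).2 = InnerProductSpace.toDual ℝ _ u.1 := fun _ => rfl
  refine ⟨fun u => Prod.ext ?_ ?_, fun u v => ?_, fun u hu => ?_⟩
  · simp [hfst, hsnd]
  · simp [hfst, hsnd]
  · simp only [stdSymplectic_apply, hfst, hsnd, map_neg, InnerProductSpace.toDual_apply_apply]
    rw [real_inner_comm, InnerProductSpace.toDual_symm_apply, real_inner_comm,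
      InnerProductSpace.toDual_symm_apply]
    ring
  · simp only [stdSymplectic_apply, hfst, hsnd, map_neg, InnerProductSpace.toDual_apply_apply,
      sub_neg_eq_add]
    rw [← InnerProductSpace.toDual_symm_apply (𝕜 := ℝ) (y := u.2)]
    rcases Classical.em (u.1 = 0) with h | h
    · have h2 : u.2 ≠ 0 := fun h2 => hu (Prod.ext h h2)
      have h3 : (InnerProductSpace.toDual ℝ (EuclideanSpace ℝ (Fin n))).symm u.2 ≠ 0 := by
        simpa using h2
      have := real_inner_self_nonneg (x := u.1)
      have := real_inner_self_pos.2 h3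
      linarith
    · have := real_inner_self_pos.2 h
      have := real_inner_self_nonneg
        (x := (InnerProductSpace.toDual ℝ (EuclideanSpace ℝ (Fin n))).symm u.2)
      linarith

end ModelSpace


/-! ### The argument of a path of lagrangian planes that crosses the vertical plane -/

section Crossing

open Matrix

variable {n : ℕ}

/-- Only the horizontal part of the second argument matters. At a crossing this part vanishes to
first order on the kernel, which makes the rescaled matrices converge. -/
theorem lagEntry_fst (J : CotangentModel n →L[ℝ] CotangentModel n) (v v' : CotangentModel n) :
    lagEntry J v v' = lagEntry J v (v'.1, 0) := by
  simp [lagEntry, vertLift]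

theorem lagEntry_smul_right (J : CotangentModel n →L[ℝ] CotangentModel n) (r : ℝ)
    (v v' : CotangentModel n) : lagEntry J v (r • v') = r * lagEntry J v v' := by
  apply Complex.ext
  · simp [lagEntry, -stdSymplectic_apply]
  · simp [lagEntry, -stdSymplectic_apply]

theorem lagEntry_smul_left (J : CotangentModel n →L[ℝ] CotangentModel n) (r : ℝ)
    (v v' : CotangentModel n) : lagEntry J (r • v) v' = r * lagEntry J v v' := by
  apply Complex.ext
  · simp [lagEntry, -stdSymplectic_apply]
  · simp [lagEntry, -stdSymplectic_apply]

theorem lagEntry_sum_right {ι : Type*} (s : Finset ι)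
    (J : CotangentModel n →L[ℝ] CotangentModel n) (v : CotangentModel n)
    (a : ι → CotangentModel n) :
    lagEntry J v (∑ k ∈ s, a k) = ∑ k ∈ s, lagEntry J v (a k) := by
  apply Complex.ext
  · simp [lagEntry, -stdSymplectic_apply]
  · simp [lagEntry, -stdSymplectic_apply]

theorem continuousAt_vertLift {J : CotangentModel n →L[ℝ] CotangentModel n}
    (hJ : IsCompatible J) : ContinuousAt (vertLift (n := n)) J := by
  obtain ⟨e, he⟩ := hJ.exists_verticalBlock_equiv
  have h1 : Continuous (verticalBlock (n := n)) :=
    continuous_const.clm_comp (continuous_id.clm_comp continuous_const)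
  have h2 : ContinuousAt ContinuousLinearMap.inverse (verticalBlock J) := by
    rw [← he]
    exact (contDiffAt_map_inverse (n := 0) e).continuousAt
  have h3 : ContinuousAt (fun J => (verticalBlock J).inverse) J :=
    ContinuousAt.comp (f := verticalBlock (n := n)) h2 h1.continuousAt
  exact (continuousAt_const.clm_comp (h3.clm_comp continuousAt_const)).neg

theorem continuous_stdSymplectic :
    Continuous fun p : CotangentModel n × CotangentModel n => stdSymplectic n p.1 p.2 := by
  simp only [stdSymplectic_apply]
  exact ((continuous_snd.comp continuous_fst).clm_apply (continuous_fst.comp continuous_snd)).sub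
    ((continuous_snd.comp continuous_snd).clm_apply (continuous_fst.comp continuous_fst))

theorem tendsto_clm_apply {X E F : Type*} [NormedAddCommGroup E] [NormedSpace ℝ E]
    [NormedAddCommGroup F] [NormedSpace ℝ F] {l : Filter X} {T : X → E →L[ℝ] F} {T₀ : E →L[ℝ] F}
    {v : X → E} {v₀ : E} (hT : Tendsto T l (𝓝 T₀)) (hv : Tendsto v l (𝓝 v₀)) :
    Tendsto (fun x => T x (v x)) l (𝓝 (T₀ v₀)) :=
  ((isBoundedBilinearMap_apply (𝕜 := ℝ) (E := E) (F := F)).continuous.tendsto (T₀, v₀)).comp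
    (hT.prodMk_nhds hv)

theorem tendsto_lagEntry {X : Type*} {l : Filter X}
    {J : X → CotangentModel n →L[ℝ] CotangentModel n} {J₀ : CotangentModel n →L[ℝ] CotangentModel n}
    (hJ₀ : IsCompatible J₀) (hJ : Tendsto J l (𝓝 J₀)) {v v' : X → CotangentModel n}
    {v₀ v₀' : CotangentModel n} (hv : Tendsto v l (𝓝 v₀)) (hv' : Tendsto v' l (𝓝 v₀')) :
    Tendsto (fun x => lagEntry (J x) (v x) (v' x)) l (𝓝 (lagEntry J₀ v₀ v₀')) := by
  have h1 : Tendsto (fun x => vertLift (J x) (v' x)) l (𝓝 (vertLift J₀ v₀')) :=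
    tendsto_clm_apply ((continuousAt_vertLift hJ₀).tendsto.comp hJ) hv'
  have h2 : Tendsto (fun x => J x (v x)) l (𝓝 (J₀ v₀)) := tendsto_clm_apply hJ hv
  have h3 := (continuous_stdSymplectic.tendsto (J₀ v₀, vertLift J₀ v₀')).comp (h2.prodMk_nhds h1)
  have h4 := (continuous_stdSymplectic.tendsto (v₀, vertLift J₀ v₀')).comp (hv.prodMk_nhds h1)
  exact ((Complex.continuous_ofReal.tendsto _).comp h3).add
    (((Complex.continuous_ofReal.tendsto _).comp h4).mul_const _)

/-- For a vertical first argument the entry is real and independent of `J`; the limit on the kernel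
block is therefore the crossing form itself, up to sign. -/
theorem lagEntry_vertical_left {J : CotangentModel n →L[ℝ] CotangentModel n}
    (hJ : IsCompatible J) {v : CotangentModel n} (hv : v.1 = 0) (v' : CotangentModel n) :
    lagEntry J v v' = (v.2 v'.1 : ℝ) := by
  apply Complex.ext
  · rw [lagEntry, stdHerm_re, hJ.symplectic_left]
    simp [hv, hJ.J_vertLift_fst]
  · rw [lagEntry, stdHerm_im, stdSymplectic_vertical hv (vertLift_fst _ _), Complex.ofReal_im]

/-- A vertical vector in the image has zero lift, so its coordinates form a kernel vector of the
matrix. -/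
theorem injective_of_det_lagMatrix_ne_zero {ι : Type*} [Fintype ι] [DecidableEq ι]
    {J : CotangentModel n →L[ℝ] CotangentModel n}
    {A : EuclideanSpace ℝ (Fin n) →L[ℝ] CotangentModel n}
    (b : Module.Basis ι ℝ (EuclideanSpace ℝ (Fin n)))
    (hdet : (lagMatrix J fun k => A (b k)).det ≠ 0) : Function.Injective (horizontalPart A) := by
  rw [injective_iff_map_eq_zero]
  intro u hu
  by_contra hne
  apply hdet
  rw [← Matrix.exists_mulVec_eq_zero_iff]
  refine ⟨fun k => (b.repr u k : ℂ), fun h0 => hne ?_, ?_⟩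
  · rw [← b.repr.map_eq_zero_iff]
    ext k
    simpa using congrFun h0 k
  · funext k
    have h1 : lagEntry J (A (b k)) (A u) = 0 := by
      rw [lagEntry, vertLift_eq_zero (v := A u) hu]
      simp [stdHerm]
    rw [← b.sum_repr u, map_sum, lagEntry_sum_right] at h1
    simp only [map_smul, lagEntry_smul_right] at h1
    simp only [Matrix.mulVec, dotProduct, lagMatrix, Matrix.of_apply, Pi.zero_apply]
    rw [← h1]
    exact Finset.sum_congr rfl fun l _ => mul_comm _ _

/-- Transversality of the limit plane makes the limit matrix strictly dissipative, hence a point of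
the set on which `logDet` is continuous. -/
theorem tendsto_lagArg {X : Type*} {l : Filter X}
    {J : X → CotangentModel n →L[ℝ] CotangentModel n} {J₀ : CotangentModel n →L[ℝ] CotangentModel n}
    (hJ₀ : IsCompatible J₀) (hJ : Tendsto J l (𝓝 J₀)) (hJc : ∀ᶠ x in l, IsCompatible (J x))
    {A : X → EuclideanSpace ℝ (Fin n) →L[ℝ] CotangentModel n}
    {A₀ : EuclideanSpace ℝ (Fin n) →L[ℝ] CotangentModel n} (hA : Tendsto A l (𝓝 A₀))
    (hiso : ∀ᶠ x in l, IsIsotropic (A x)) (hiso₀ : IsIsotropic A₀)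
    (hX : Function.Injective (horizontalPart A₀)) :
    Tendsto (fun x => lagArg (J x) (A x)) l (𝓝 (lagArg J₀ A₀)) := by
  let Z : X → Matrix (Fin n) (Fin n) ℂ := fun x =>
    lagMatrix (J x) fun k => A x (EuclideanSpace.basisFun (Fin n) ℝ k)
  let Z₀ : Matrix (Fin n) (Fin n) ℂ :=
    lagMatrix J₀ fun k => A₀ (EuclideanSpace.basisFun (Fin n) ℝ k)
  have hZ : Tendsto Z l (𝓝 Z₀) := by
    refine tendsto_pi_nhds.2 fun k => tendsto_pi_nhds.2 fun m => ?_
    exact tendsto_lagEntry hJ₀ hJ (tendsto_clm_apply hA tendsto_const_nhds)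
      (tendsto_clm_apply hA tendsto_const_nhds)
  have hZ₀ : IsStrictlyDissipative Z₀ := hJ₀.isStrictlyDissipative_lagMatrix
    (fun k l => hiso₀ _ _) (by
      simpa using linearIndependent_horizontalPart hX
        (EuclideanSpace.basisFun (Fin n) ℝ).toBasis.linearIndependent)
  have hdet : Tendsto (fun x => (Z x).det) l (𝓝 Z₀.det) :=
    ((continuous_id.matrix_det).tendsto Z₀).comp hZ
  have hmem : ∀ᶠ x in l, Z x ∈ {Z | IsDissipative Z ∧ Z.det ≠ 0} := by
    filter_upwards [hJc, hiso, hdet.eventually_ne hZ₀.det_ne_zero] with x h1 h2 h3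
    exact ⟨h1.isDissipative_lagMatrix fun k l => h2 _ _, h3⟩
  have h1 := (continuousOn_logDet Z₀ ⟨hZ₀.isDissipative, hZ₀.det_ne_zero⟩).tendsto.comp
    (tendsto_nhdsWithin_iff.2 ⟨hZ, hmem⟩)
  exact (Complex.continuous_im.tendsto _).comp h1

/-- When a path of lagrangian planes crosses the vertical plane with a negative definite crossing
form, its continuous argument has a positive jump. -/
theorem lagArg_jump {A : ℝ → EuclideanSpace ℝ (Fin n) →L[ℝ] CotangentModel n}
    {A' : EuclideanSpace ℝ (Fin n) →L[ℝ] CotangentModel n} (hA : HasDerivAt A A' 0)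
    (hiso : ∀ᶠ t in 𝓝 (0 : ℝ), IsIsotropic (A t))
    {J : ℝ → CotangentModel n →L[ℝ] CotangentModel n} (hJ : ContinuousAt J 0)
    (hJc : ∀ᶠ t in 𝓝 (0 : ℝ), IsCompatible (J t))
    (hpos : ∀ u, (A 0 u).1 = 0 → u ≠ 0 → 0 < (A 0 u).2 (A' u).1)
    (hK : ∃ u, u ≠ 0 ∧ (A 0 u).1 = 0) :
    (∀ᶠ ε in 𝓝[>] (0 : ℝ), Function.Injective (horizontalPart (A ε)) ∧
      Function.Injective (horizontalPart (A (-ε)))) ∧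
    ∃ δ > 0, ∀ᶠ ε in 𝓝[>] (0 : ℝ),
      lagArg (J (-ε)) (A (-ε)) + δ < lagArg (J ε) (A ε) := by
  have hJ0 : IsCompatible (J 0) := hJc.self_of_nhds
  have hiso0 : IsIsotropic (A 0) := hiso.self_of_nhds
  have hAu : ∀ u, HasDerivAt (fun t => A t u) (A' u) 0 := fun u => by
    simpa using hA.clm_apply (hasDerivAt_const (0 : ℝ) u)
  have hAu₁ : ∀ u, HasDerivAt (fun t => (A t u).1) (A' u).1 0 := fun u => (hAu u).fst
  have hAu₂ : ∀ u, HasDerivAt (fun t => (A t u).2) (A' u).2 0 := fun u => (hAu u).snd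
  -- the crossing form on the kernel
  let K : Submodule ℝ (EuclideanSpace ℝ (Fin n)) := (horizontalPart (A 0)).ker
  have hKmem : ∀ u : K, (A 0 u).1 = 0 := fun u => u.2
  let B : LinearMap.BilinForm ℝ K := LinearMap.mk₂ ℝ (fun u v => (A 0 u).2 (A' v).1)
    (fun u v w => by simp) (fun c u v => by simp) (fun u v w => by simp) (fun c u v => by simp)
  -- Symmetry comes from differentiating the isotropy relation at `t = 0`; on the kernel the terms
  -- that contain horizontal parts of `A 0` drop out.
  have hBs : ∀ u v, B u v = B v u := by
    intro u v
    have h1 : HasDerivAt (fun t => stdSymplectic n (A t u) (A t v))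
        (stdSymplectic n (A' u) (A 0 v) + stdSymplectic n (A 0 u) (A' v)) 0 := by
      have h := ((hAu₂ u).clm_apply (hAu₁ v)).sub ((hAu₂ v).clm_apply (hAu₁ u))
      have e : stdSymplectic n (A' u) (A 0 v) + stdSymplectic n (A 0 u) (A' v) =
          (A' u).2 (A 0 v).1 + (A 0 u).2 (A' v).1 -
            ((A' v).2 (A 0 u).1 + (A 0 v).2 (A' u).1) := by
        simp only [stdSymplectic_apply]; ring
      rw [e]
      exact h
    have h2 : HasDerivAt (fun t => stdSymplectic n (A t u) (A t v)) 0 0 :=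
      (hasDerivAt_const (0 : ℝ) (0 : ℝ)).congr_of_eventuallyEq
        (hiso.mono fun t ht => ht _ _)
    have h3 := h1.unique h2
    simp only [stdSymplectic_apply, hKmem, map_zero] at h3
    change (A 0 u).2 (A' v).1 = (A 0 v).2 (A' u).1
    linarith
  obtain ⟨bK, hbK⟩ := exists_orthonormal_basis_of_pos B hBs fun u hu =>
    hpos u u.2 fun h => hu (Subtype.ext h)
  -- Any complement of the kernel serves: the horizontal part of `A 0` is injective on it, so its
  -- block `W₀` is strictly dissipative.
  obtain ⟨W, hW⟩ := K.exists_isCompl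
  let bW := Module.finBasis ℝ W
  let b := (bK.prod bW).map (Submodule.prodEquivOfIsCompl K W hW)
  have hbl : ∀ k, b (Sum.inl k) = bK k := fun k => by simp [b]
  have hbr : ∀ k, b (Sum.inr k) = bW k := fun k => by simp [b]
  have : Nonempty (Fin (Module.finrank ℝ K)) := by
    obtain ⟨u, hu, hu'⟩ := hK
    have : Nontrivial K := ⟨⟨u, hu'⟩, 0, fun h => hu (congrArg Subtype.val h)⟩
    exact Fin.pos_iff_nonempty.1 Module.finrank_pos
  let W₀ := lagMatrix (J 0) fun k => A 0 (bW k)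
  have hW₀ : IsStrictlyDissipative W₀ := by
    refine hJ0.isStrictlyDissipative_lagMatrix (fun k l => hiso0 _ _) ?_
    have h1 : LinearIndependent ℝ fun k => (bW k : EuclideanSpace ℝ (Fin n)) :=
      bW.linearIndependent.map' W.subtype W.ker_subtype
    refine LinearIndependent.map (f := (horizontalPart (A 0)).toLinearMap) h1 ?_
    refine Disjoint.mono_left ?_ hW.symm.disjoint
    rw [Submodule.span_le]
    rintro _ ⟨k, rfl⟩
    exact (bW k).2
  -- the rescaled matrices
  let r : ℝ → Fin (Module.finrank ℝ K) ⊕ Fin (Module.finrank ℝ W) → ℝ :=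
    fun ε => Sum.elim (fun _ => (Real.sqrt ε)⁻¹) fun _ => 1
  let Z : ℝ → ℝ → Matrix (Fin (Module.finrank ℝ K) ⊕ Fin (Module.finrank ℝ W))
      (Fin (Module.finrank ℝ K) ⊕ Fin (Module.finrank ℝ W)) ℂ := fun σ ε =>
    lagMatrix (J (σ * ε)) fun k => A (σ * ε) (r ε k • b k)
  -- Entries with a kernel column are `O(ε)`. Scaling kernel vectors by `ε ^ (-1/2)` gives a limit
  -- `σ` times the identity on the kernel block, because `bK` is orthonormal for the crossing form;
  -- mixed entries are `O(ε ^ (1/2))`, and the remaining block tends to `W₀`.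
  have hZlim : ∀ σ : ℝ, Tendsto (Z σ) (𝓝[>] 0)
      (𝓝 (Matrix.fromBlocks ((σ : ℂ) • 1) 0 0 W₀)) := by
    intro σ
    have htσ : Tendsto (fun ε : ℝ => σ * ε) (𝓝[>] 0) (𝓝 0) := by
      have : Tendsto (fun ε : ℝ => σ * ε) (𝓝 0) (𝓝 (σ * 0)) := tendsto_id.const_mul σ
      rw [mul_zero] at this
      exact this.mono_left nhdsWithin_le_nhds
    have hJσ : Tendsto (fun ε => J (σ * ε)) (𝓝[>] 0) (𝓝 (J 0)) := hJ.tendsto.comp htσ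
    have hAσ : ∀ u, Tendsto (fun ε => A (σ * ε) u) (𝓝[>] 0) (𝓝 (A 0 u)) := fun u =>
      (hAu u).continuousAt.tendsto.comp htσ
    have hcol : ∀ u v, (A 0 u).1 = 0 → Tendsto
        (fun ε : ℝ => ((ε⁻¹ : ℝ) : ℂ) * lagEntry (J (σ * ε)) (A (σ * ε) v) (A (σ * ε) u)) (𝓝[>] 0)
        (𝓝 (lagEntry (J 0) (A 0 v) (σ • (A' u).1, 0))) := by
      intro u v hu
      have h1 : HasDerivAt (fun ε : ℝ => (A (σ * ε) u).1) (σ • (A' u).1) 0 := by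
        have h2 : HasDerivAt (fun ε : ℝ => σ * ε) σ 0 := by
          simpa using (hasDerivAt_id (0 : ℝ)).const_mul σ
        have h3 : HasDerivAt (fun t => (A t u).1) (A' u).1 (σ * 0) := by
          rw [mul_zero]; exact hAu₁ u
        exact h3.scomp (0 : ℝ) h2
      have h4 := h1.tendsto_slope_zero_right
      simp only [zero_add, mul_zero, hu, sub_zero] at h4
      refine (tendsto_lagEntry hJ0 hJσ (hAσ v)
        (h4.prodMk_nhds (tendsto_const_nhds (x := (0 : EuclideanSpace ℝ (Fin n) →L[ℝ] ℝ))))).congr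
          fun ε => ?_
      rw [lagEntry_fst _ _ (A (σ * ε) u), ← lagEntry_smul_right]
      congr 1
      ext <;> simp
    have hZe : ∀ ε k l, Z σ ε k l = ((r ε k * r ε l : ℝ) : ℂ) *
        lagEntry (J (σ * ε)) (A (σ * ε) (b k)) (A (σ * ε) (b l)) := by
      intro ε k l
      simp only [Z, lagMatrix, Matrix.of_apply, map_smul, lagEntry_smul_left, lagEntry_smul_right]
      push_cast
      ring
    have hsq : ∀ ε : ℝ, 0 < ε → (Real.sqrt ε)⁻¹ * (Real.sqrt ε)⁻¹ = ε⁻¹ := fun ε hε => by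
      rw [← mul_inv, Real.mul_self_sqrt hε.le]
    have hmix : ∀ k l, Tendsto (fun ε => Z σ ε (Sum.inr k) (Sum.inl l)) (𝓝[>] 0) (𝓝 0) := by
      intro k l
      have h1 := hcol (bK l) (bW k) (hKmem _)
      have h2 : Tendsto (fun ε : ℝ => ((Real.sqrt ε : ℝ) : ℂ)) (𝓝[>] 0) (𝓝 0) := by
        have : Tendsto (fun ε : ℝ => ((Real.sqrt ε : ℝ) : ℂ)) (𝓝 0) (𝓝 ((Real.sqrt 0 : ℝ) : ℂ)) :=
          (Complex.continuous_ofReal.comp Real.continuous_sqrt).tendsto 0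
        rw [Real.sqrt_zero, Complex.ofReal_zero] at this
        exact this.mono_left nhdsWithin_le_nhds
      have h3 := h2.mul h1
      rw [zero_mul] at h3
      refine h3.congr' ?_
      filter_upwards [self_mem_nhdsWithin] with ε hε
      have hε' : Real.sqrt ε ≠ 0 := (Real.sqrt_pos.2 hε).ne'
      rw [hZe, hbl, hbr, ← mul_assoc, ← Complex.ofReal_mul]
      congr 2
      rw [← hsq ε hε]
      simp only [r, Sum.elim_inl, Sum.elim_inr]
      field_simp
    refine tendsto_pi_nhds.2 fun k => tendsto_pi_nhds.2 fun l => ?_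
    rcases k with k | k <;> rcases l with l | l
    · have h1 := hcol (bK l) (bK k) (hKmem _)
      have h2 : lagEntry (J 0) (A 0 (bK k)) (σ • (A' (bK l)).1, 0) =
          Matrix.fromBlocks ((σ : ℂ) • 1) 0 0 W₀ (Sum.inl k) (Sum.inl l) := by
        rw [lagEntry_vertical_left hJ0 (hKmem _)]
        have h3 : (A 0 (bK k)).2 (A' (bK l)).1 = if k = l then 1 else 0 := hbK k l
        simp only [map_smul, h3, Matrix.fromBlocks_apply₁₁, Matrix.smul_apply, Matrix.one_apply]
        split_ifs <;> simp
      rw [← h2]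
      refine h1.congr' ?_
      filter_upwards [self_mem_nhdsWithin] with ε hε
      rw [hZe, hbl, hbl]
      simp only [r, Sum.elim_inl]
      rw [hsq ε hε]
    -- The other mixed block follows from symmetry of the matrices, which holds for small `ε` by
    -- isotropy.
    · refine (hmix l k).congr' ?_
      filter_upwards [htσ.eventually hiso, htσ.eventually hJc] with ε h1 h2
      simp only [Z, lagMatrix, Matrix.of_apply]
      exact h2.lagEntry_comm (h1 _ _)
    · exact hmix k l
    · have h1 := tendsto_lagEntry hJ0 hJσ (hAσ (bW k)) (hAσ (bW l))
      refine h1.congr fun ε => ?_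
      rw [hZe, hbr, hbr]
      simp [r]
  have hdet : ∀ σ : ℝ, σ ^ 2 = 1 →
      (Matrix.fromBlocks ((σ : ℂ) • 1 : Matrix (Fin (Module.finrank ℝ K)) _ ℂ) 0 0 W₀).det ≠ 0 := by
    intro σ hσ
    rw [Matrix.det_fromBlocks_zero₂₁, Matrix.det_smul, Matrix.det_one, mul_one]
    refine mul_ne_zero (pow_ne_zero _ ?_) hW₀.det_ne_zero
    rintro h
    have : σ = 0 := by exact_mod_cast h
    norm_num [this] at hσ
  have hev : ∀ σ : ℝ, σ ^ 2 = 1 →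
      (∀ᶠ ε in 𝓝[>] (0 : ℝ), Function.Injective (horizontalPart (A (σ * ε)))) ∧
      Tendsto (fun ε => lagArg (J (σ * ε)) (A (σ * ε))) (𝓝[>] 0)
        (𝓝 (logDet (Matrix.fromBlocks
          ((σ : ℂ) • 1 : Matrix (Fin (Module.finrank ℝ K)) _ ℂ) 0 0 W₀)).im) := by
    intro σ hσ
    have htσ : Tendsto (fun ε : ℝ => σ * ε) (𝓝[>] 0) (𝓝 0) := by
      have : Tendsto (fun ε : ℝ => σ * ε) (𝓝 0) (𝓝 (σ * 0)) := tendsto_id.const_mul σ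
      rw [mul_zero] at this
      exact this.mono_left nhdsWithin_le_nhds
    have hr : ∀ ε : ℝ, 0 < ε → ∀ k, IsUnit (r ε k) := by
      rintro ε hε (k | k)
      · exact (inv_ne_zero (Real.sqrt_pos.2 hε).ne').isUnit
      · exact isUnit_one
    have hZdet : ∀ᶠ ε in 𝓝[>] (0 : ℝ), (Z σ ε).det ≠ 0 :=
      (((continuous_id.matrix_det).tendsto _).comp (hZlim σ)).eventually_ne (hdet σ hσ)
    have hinj : ∀ᶠ ε in 𝓝[>] (0 : ℝ), Function.Injective (horizontalPart (A (σ * ε))) := by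
      filter_upwards [hZdet, self_mem_nhdsWithin] with ε h1 hε
      refine injective_of_det_lagMatrix_ne_zero (J := J (σ * ε)) (b.isUnitSMul (hr ε hε)) ?_
      simpa only [Module.Basis.isUnitSMul_apply] using h1
    refine ⟨hinj, ?_⟩
    have hdis : ∀ᶠ ε in 𝓝[>] (0 : ℝ), IsDissipative (Z σ ε) := by
      filter_upwards [htσ.eventually hiso, htσ.eventually hJc] with ε h1 h2
      exact h2.isDissipative_lagMatrix fun _ _ => h1 _ _
    -- Dissipativity is a closed condition, so it passes to the limit; strictness does not survive,
    -- since the kernel block is real.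
    have hdis0 : IsDissipative (Matrix.fromBlocks
        ((σ : ℂ) • 1 : Matrix (Fin (Module.finrank ℝ K)) _ ℂ) 0 0 W₀) := by
      intro c
      have hq : Tendsto (fun ε => (star c ⬝ᵥ Z σ ε *ᵥ c).im) (𝓝[>] 0) (𝓝 _) :=
        ((Continuous.tendsto (f := fun Y : Matrix _ _ ℂ => (star c ⬝ᵥ Y *ᵥ c).im)
          (Complex.continuous_im.comp (continuous_const.dotProduct
            (continuous_id.matrix_mulVec continuous_const))) _).comp (hZlim σ))
      exact le_of_tendsto hq (hdis.mono fun ε h => h c)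
    have h1 := (continuousOn_logDet _ ⟨hdis0, hdet σ hσ⟩).tendsto.comp
      (tendsto_nhdsWithin_iff.2 ⟨hZlim σ, (hdis.and hZdet)⟩)
    refine ((Complex.continuous_im.tendsto _).comp h1).congr' ?_
    filter_upwards [hinj, self_mem_nhdsWithin, htσ.eventually hiso, htσ.eventually hJc]
      with ε h2 hε h3 h4
    have := h4.im_logDet_lagMatrix_basis h3 h2 (b.isUnitSMul (hr ε hε))
    simp only [Module.Basis.isUnitSMul_apply] at this
    exact this
  obtain ⟨hp, hplim⟩ := hev 1 (by norm_num)
  obtain ⟨hm, hmlim⟩ := hev (-1) (by norm_num)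
  simp only [one_mul, neg_one_mul, Complex.ofReal_one, one_smul, Complex.ofReal_neg, neg_smul]
    at hp hplim hm hmlim
  refine ⟨hp.and hm, ?_⟩
  have hlt := im_logDet_fromBlocks_lt (κ := Fin (Module.finrank ℝ K)) hW₀
  obtain ⟨δ, hδ, hδ'⟩ : ∃ δ > 0, (logDet (Matrix.fromBlocks
      (-1 : Matrix (Fin (Module.finrank ℝ K)) _ ℂ) 0 0 W₀)).im + δ <
      (logDet (Matrix.fromBlocks (1 : Matrix (Fin (Module.finrank ℝ K)) _ ℂ) 0 0 W₀)).im :=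
    ⟨_, half_pos (sub_pos.2 hlt), by linarith⟩
  exact ⟨δ, hδ, (hmlim.add_const δ).eventually_lt hplim hδ'⟩

end Crossing


/-! ### Unitary frames and the quotient of the squared determinants -/

section Frames

open Matrix ComplexConjugate

variable {n : ℕ} {J : CotangentModel n →L[ℝ] CotangentModel n}

/-- A unitary basis of the model space. -/
def IsStdFrame (J : CotangentModel n →L[ℝ] CotangentModel n) (b : Fin n → CotangentModel n) :
    Prop :=
  ∀ j l, stdHerm J (b j) (b l) = if j = l then 1 else 0

theorem stdHerm_add_left (u u' v : CotangentModel n) :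
    stdHerm J (u + u') v = stdHerm J u v + stdHerm J u' v := by
  apply Complex.ext <;> simp [-stdSymplectic_apply]

theorem stdHerm_smul_left (r : ℝ) (u v : CotangentModel n) :
    stdHerm J (r • u) v = r * stdHerm J u v := by
  apply Complex.ext <;> simp [-stdSymplectic_apply]

theorem finrank_cotangentModel (n : ℕ) : Module.finrank ℝ (CotangentModel n) = n + n := by
  have hd : Module.finrank ℝ (EuclideanSpace ℝ (Fin n) →L[ℝ] ℝ) = n := by
    rw [← (LinearMap.toContinuousLinearMap (𝕜 := ℝ) (E := EuclideanSpace ℝ (Fin n))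
      (F' := ℝ)).finrank_eq]
    exact Subspace.dual_finrank_eq.trans finrank_euclideanSpace_fin
  rw [Module.finrank_prod, hd, finrank_euclideanSpace_fin]

namespace IsCompatible

variable (hJ : IsCompatible J)
include hJ

theorem stdHerm_J_left (u v : CotangentModel n) : stdHerm J (J u) v = Complex.I * stdHerm J u v := by
  apply Complex.ext
  · simp only [stdHerm_re, hJ.sq, Complex.mul_re, Complex.I_re, Complex.I_im, stdHerm_im, map_neg,
      LinearMap.neg_apply]
    ring
  · simp only [stdHerm_im, Complex.mul_im, Complex.I_re, Complex.I_im, stdHerm_re]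
    ring

theorem stdHerm_conj (u v : CotangentModel n) : conj (stdHerm J u v) = stdHerm J v u := by
  apply Complex.ext
  · rw [Complex.conj_re, stdHerm_re, stdHerm_re, hJ.metric_comm]
  · rw [Complex.conj_im, stdHerm_im, stdHerm_im, stdSymplectic_swap u v]

theorem stdHerm_J_right (u v : CotangentModel n) :
    stdHerm J u (J v) = -Complex.I * stdHerm J u v := by
  rw [← hJ.stdHerm_conj, hJ.stdHerm_J_left, map_mul, hJ.stdHerm_conj, Complex.conj_I]

/-- The vectors `b l` and `J (b l)` are orthonormal for the metric and number `2n`, so they span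
over the reals. The identity is real linear in `u`, and it suffices to check it on them. -/
theorem parseval {b : Fin n → CotangentModel n} (hb : IsStdFrame J b) (u v : CotangentModel n) :
    stdHerm J u v = ∑ l, stdHerm J u (b l) * conj (stdHerm J v (b l)) := by
  let w : Fin n ⊕ Fin n → CotangentModel n := Sum.elim b fun l => J (b l)
  have hw : ∀ p q, stdSymplectic n (J (w p)) (w q) = if p = q then 1 else 0 := by
    have key : ∀ p q, (stdHerm J (w p) (w q)).re = if p = q then 1 else 0 := by
      rintro (p | p) (q | q)
      · simp only [w, Sum.elim_inl, hb p q, Sum.inl.injEq]; split_ifs <;> simp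
      · simp only [w, Sum.elim_inl, Sum.elim_inr, hJ.stdHerm_J_right, hb p q]; split_ifs <;> simp_all
      · simp only [w, Sum.elim_inl, Sum.elim_inr, hJ.stdHerm_J_left, hb p q]; split_ifs <;> simp_all
      · simp only [w, Sum.elim_inr, hJ.stdHerm_J_left, hJ.stdHerm_J_right, hb p q, Sum.inr.injEq]
        split_ifs <;> simp
    exact fun p q => by rw [← key p q, stdHerm_re]
  have hli : LinearIndependent ℝ w := by
    rw [Fintype.linearIndependent_iff]
    intro c hc q
    have := congrArg (fun x => stdSymplectic n (J x) (w q)) hc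
    simpa only [map_sum, map_smul, LinearMap.sum_apply, LinearMap.smul_apply, hw, smul_eq_mul,
      mul_ite, mul_one, mul_zero, Finset.sum_ite_eq', Finset.mem_univ, if_true, map_zero,
      LinearMap.zero_apply] using this
  have hspan : ⊤ ≤ Submodule.span ℝ (Set.range w) :=
    (hli.span_eq_top_of_card_eq_finrank' (by rw [finrank_cotangentModel]; simp)).ge
  induction (hspan (Submodule.mem_top (x := u))) using Submodule.span_induction with
  | mem x hx =>
    have h1 : ∀ l, stdHerm J (b l) v = ∑ m, stdHerm J (b l) (b m) * conj (stdHerm J v (b m)) := by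
      intro l
      simp [hb l _, hJ.stdHerm_conj]
    obtain ⟨p | p, rfl⟩ := hx
    · exact h1 p
    · simp only [w, Sum.elim_inr, hJ.stdHerm_J_left, mul_assoc, ← Finset.mul_sum]
      rw [h1 p]
  | zero => simp [stdHerm]
  | add x y _ _ hx hy => simp only [stdHerm_add_left, hx, hy, add_mul, Finset.sum_add_distrib]
  | smul r x _ hx => simp only [stdHerm_smul_left, hx, mul_assoc, Finset.mul_sum]

/-- The matrix of one family of vectors relative to another. -/
theorem frameMatrix_mul {b : Fin n → CotangentModel n} (hb : IsStdFrame J b)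
    (e e' : Fin n → CotangentModel n) :
    (Matrix.of fun j l => stdHerm J (e j) (b l)) * (Matrix.of fun j l => stdHerm J (e' j) (b l))ᴴ =
      Matrix.of fun j l => stdHerm J (e j) (e' l) := by
  ext j l
  simp [Matrix.mul_apply, hJ.parseval hb (e j) (e' l)]

theorem normSq_det_frameMatrix {b e : Fin n → CotangentModel n} (hb : IsStdFrame J b)
    (he : IsStdFrame J e) :
    (Matrix.of fun j l => stdHerm J (e j) (b l)).det *
      conj (Matrix.of fun j l => stdHerm J (e j) (b l)).det = 1 := by
  have h1 := hJ.frameMatrix_mul hb e e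
  have h2 : (Matrix.of fun j l => stdHerm J (e j) (e l)) = 1 := by
    ext j l
    simp [he j l, Matrix.one_apply]
  rw [h2] at h1
  have h3 := congrArg Matrix.det h1
  rwa [Matrix.det_mul, Matrix.det_conjTranspose, Matrix.det_one] at h3

/-- Change-of-frame matrices are unitary, so dividing by the determinant for `e'` is multiplying by
its conjugate, and the auxiliary frame `b` disappears by `frameMatrix_mul`. The value of the
quotient thus depends only on `e` and `e'`. -/
theorem frame_quotient {b e e' : Fin n → CotangentModel n} (hb : IsStdFrame J b)
    (he' : IsStdFrame J e') :
    (Matrix.of fun l j => stdHerm J (e j) (b l)).det ^ 2 /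
      (Matrix.of fun l j => stdHerm J (e' j) (b l)).det ^ 2 =
      (Matrix.of fun j l => stdHerm J (e j) (e' l)).det ^ 2 := by
  have ht : ∀ e : Fin n → CotangentModel n, (Matrix.of fun l j => stdHerm J (e j) (b l)).det =
      (Matrix.of fun j l => stdHerm J (e j) (b l)).det := fun e => by
    rw [← Matrix.det_transpose]; rfl
  rw [ht, ht, ← hJ.frameMatrix_mul hb e e', Matrix.det_mul, Matrix.det_conjTranspose]
  have h1 := hJ.normSq_det_frameMatrix hb he'
  have h2 := left_ne_zero_of_mul_eq_one h1
  rw [div_eq_iff (pow_ne_zero 2 h2)]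
  simp only [RCLike.star_def]
  linear_combination (-(Matrix.of fun j l => stdHerm J (e j) (b l)).det ^ 2 *
    ((Matrix.of fun j l => stdHerm J (e' j) (b l)).det *
      conj (Matrix.of fun j l => stdHerm J (e' j) (b l)).det + 1)) * h1

/-- The quotient of the squared determinants of a lagrangian plane and of the vertical plane. -/
theorem frame_quotient_eq_exp_lagArg {A : EuclideanSpace ℝ (Fin n) →L[ℝ] CotangentModel n}
    (hA : IsIsotropic A) (hX : Function.Injective (horizontalPart A))
    {e e' : Fin n → CotangentModel n} (he : IsStdFrame J e) (heA : ∀ j, ∃ u, A u = e j)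
    (he' : IsStdFrame J e') (heV : ∀ j, (e' j).1 = 0) :
    (Matrix.of fun j l => stdHerm J (e j) (e' l)).det ^ 2 =
      (-1) ^ n * Complex.exp (2 * lagArg J A * Complex.I) := by
  choose p hp using heA
  have hsurj : Function.Surjective (horizontalPart A) :=
    LinearMap.surjective_of_injective (f := (horizontalPart A).toLinearMap) hX
  -- Transversality lets every vertical frame vector be written as the vertical lift of a vector in
  -- the image of `A`. The matrix of `e` relative to `e'` then becomes `Pᵀ Z Q` with `P` and `Q`
  -- real.
  choose q hq using fun l => hsurj (-(J (e' l)).1)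
  have hq' : ∀ l, e' l = vertLift J (A (q l)) := fun l =>
    hJ.eq_vertLift (heV l) (by rw [← horizontalPart_apply, hq, neg_neg])
  let c := (EuclideanSpace.basisFun (Fin n) ℝ).toBasis
  let Z := lagMatrix J fun k => A (c k)
  let P : Matrix (Fin n) (Fin n) ℂ := Matrix.of fun k j => (c.repr (p j) k : ℂ)
  let Q : Matrix (Fin n) (Fin n) ℂ := Matrix.of fun k j => (c.repr (q j) k : ℂ)
  have hM : (Matrix.of fun j l => stdHerm J (e j) (e' l)) = Pᵀ * Z * Q := by
    ext j l
    rw [Matrix.of_apply, hq', ← hp]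
    change lagEntry J (A (p j)) (A (q l)) = _
    have e1 : A (q l) = ∑ m, c.repr (q l) m • A (c m) := by
      conv_lhs => rw [← c.sum_repr (q l)]
      rw [map_sum]
      simp only [map_smul]
    have e2 : lagEntry J (A (p j)) (A (q l)) =
        ∑ m, (c.repr (q l) m : ℂ) * ∑ k, (c.repr (p j) k : ℂ) * lagEntry J (A (c k)) (A (c m)) := by
      rw [e1, lagEntry_sum_right]
      refine Finset.sum_congr rfl fun m _ => ?_
      rw [lagEntry_smul_right]
      congr 1
      have e3 : A (p j) = ∑ k, c.repr (p j) k • A (c k) := by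
        conv_lhs => rw [← c.sum_repr (p j)]
        rw [map_sum]
        simp only [map_smul]
      rw [e3]
      apply Complex.ext
      · simp [lagEntry, -stdSymplectic_apply, LinearMap.sum_apply]
      · simp [lagEntry, -stdSymplectic_apply, LinearMap.sum_apply]
    rw [e2]
    simp only [Matrix.mul_apply, Matrix.transpose_apply, P, Q, Z, lagMatrix, Matrix.of_apply]
    exact Finset.sum_congr rfl fun m _ => mul_comm _ _
  have hPQ : ∀ r : Fin n → EuclideanSpace ℝ (Fin n), ∃ d : ℝ,
      (Matrix.of fun k j => (c.repr (r j) k : ℂ)).det = d := fun r =>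
    ⟨(Matrix.of fun k j => c.repr (r j) k).det,
      (RingHom.map_det Complex.ofRealHom (Matrix.of fun k j => c.repr (r j) k)).symm⟩
  obtain ⟨dP, hdP⟩ := hPQ p
  obtain ⟨dQ, hdQ⟩ := hPQ q
  have hdet : (Matrix.of fun j l => stdHerm J (e j) (e' l)).det = dP * Z.det * dQ := by
    rw [hM, Matrix.det_mul, Matrix.det_mul, Matrix.det_transpose]
    simp only [P, Q, hdP, hdQ]
  have hZ : IsStrictlyDissipative Z := hJ.isStrictlyDissipative_lagMatrix
    (fun k l => hA _ _) (linearIndependent_horizontalPart hX c.linearIndependent)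
  have h1 := hZ.isDissipative.exp_logDet hZ.det_ne_zero
  have hL : (logDet Z).im = lagArg J A := by simp [lagArg, Z, c]
  have h2 : Z.det = (-Complex.I) ^ n * (Real.exp (logDet Z).re : ℂ) *
      Complex.exp (lagArg J A * Complex.I) := by
    rw [← h1, Fintype.card_fin, ← hL, Complex.ofReal_exp, mul_assoc, ← Complex.exp_add,
      Complex.re_add_im, mul_comm]
  have hn := hJ.normSq_det_frameMatrix he' he
  have hI : (-Complex.I) ^ n * (-Complex.I) ^ n = (-1 : ℂ) ^ n := by
    rw [← mul_pow]; simp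
  set R : ℝ := Real.exp (logDet Z).re
  have hexp : Complex.exp (lagArg J A * Complex.I) * Complex.exp (lagArg J A * Complex.I) =
      Complex.exp (2 * lagArg J A * Complex.I) := by
    rw [← Complex.exp_add]; congr 1; ring
  -- The determinant has modulus one, so its real factors multiply to `±1` and disappear on
  -- squaring. What remains is the phase: `(-i) ^ (2n) = (-1) ^ n` times twice the argument.
  have hmod : (dP * R * dQ) ^ 2 = 1 := by
    rw [Complex.mul_conj, hdet, h2] at hn
    have h3 : Complex.normSq (↑dP * ((-Complex.I) ^ n * ↑R *
        Complex.exp (↑(lagArg J A) * Complex.I)) * ↑dQ) = (dP * R * dQ) ^ 2 := by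
      have e1 : Complex.normSq (Complex.exp (↑(lagArg J A) * Complex.I)) = 1 := by
        rw [Complex.normSq_eq_norm_sq, Complex.norm_exp_ofReal_mul_I, one_pow]
      simp only [map_mul, map_pow, Complex.normSq_neg, Complex.normSq_I, one_pow, e1,
        Complex.normSq_ofReal]
      ring
    rw [h3] at hn
    exact_mod_cast hn
  have hmod' : ((dP : ℂ) * R * dQ) ^ 2 = 1 := by exact_mod_cast hmod
  rw [hdet, h2, ← hI, ← hexp]
  linear_combination ((-Complex.I) ^ n * (-Complex.I) ^ n *
    (Complex.exp (↑(lagArg J A) * Complex.I) * Complex.exp (↑(lagArg J A) * Complex.I))) * hmod'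

-- A metric-orthonormal basis of an isotropic plane is unitary, because the imaginary part `ω` of
-- the hermitian form vanishes on the plane.
set_option synthInstance.maxHeartbeats 200000 in
theorem exists_frame {L : Submodule ℝ (CotangentModel n)} (hd : Module.finrank ℝ L = n)
    (hL : ∀ u ∈ L, ∀ v ∈ L, stdSymplectic n u v = 0) :
    ∃ e : Fin n → CotangentModel n, IsStdFrame J e ∧ ∀ j, e j ∈ L := by
  let B : LinearMap.BilinForm ℝ L := (stdSymplectic n).compl₁₂ (J.toLinearMap ∘ₗ L.subtype) L.subtype
  have hBp : ∀ u : L, u ≠ 0 → 0 < B u u := fun u hu => hJ.pos u (by simpa using hu)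
  obtain ⟨b, hb⟩ := exists_orthonormal_basis_of_pos (K := L) B
    (fun u v => hJ.metric_comm u v) hBp
  have hb' : ∀ k l, stdSymplectic n (J (b k)) (b l) = if k = l then 1 else 0 := hb
  refine ⟨fun j => b (Fin.cast hd.symm j), fun j l => ?_, fun j => (b _).2⟩
  apply Complex.ext
  · rw [stdHerm_re, hb']
    simp only [Fin.cast_inj]
    split_ifs <;> simp
  · rw [stdHerm_im, hL _ (b _).2 _ (b _).2]
    split_ifs <;> simp

end IsCompatible

end Frames

/-! ### The Maslov map at points transverse to the vertical plane -/

section MaslovMap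

variable {n : ℕ} {S : Type*} [TopologicalSpace S]
  [ChartedSpace (EuclideanSpace ℝ (Fin n)) S] [IsManifold (𝓡 n) ∞ S]

theorem IsCompatibleComplexStructure.isCompatible
    {J : ∀ θ : CotangentBundle n S,
      TangentSpace (cotangentI n) θ →L[ℝ] TangentSpace (cotangentI n) θ}
    (hJ : IsCompatibleComplexStructure J) (θ : CotangentBundle n S) :
    IsCompatible (n := n) (J θ) :=
  ⟨hJ.sq θ, hJ.symplectic θ, hJ.pos θ⟩

/-- The quotient of squared determinants, for a plane `L` that is transverse to the vertical
plane. -/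
theorem epsilon_isDetSqQuotient {θ : CotangentBundle n S}
    {Jθ : TangentSpace (cotangentI n) θ →L[ℝ] TangentSpace (cotangentI n) θ}
    (hJ : IsCompatible (n := n) Jθ)
    {L L' : Submodule ℝ (TangentSpace (cotangentI n) θ)} (hL : IsLagrangianPlane L)
    {A : EuclideanSpace ℝ (Fin n) →L[ℝ] CotangentModel n}
    (hAL : ∀ v : CotangentModel n, v ∈ L ↔ ∃ u, A u = v)
    (hX : Function.Injective (horizontalPart A))
    (hL' : ∀ v : CotangentModel n, v ∈ L' ↔ v.1 = 0) :
    Classical.epsilon (IsDetSqQuotient Jθ L L') =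
      (-1) ^ n * Complex.exp (2 * lagArg Jθ A * Complex.I) := by
  have hA : IsIsotropic A := fun u v => hL.2 _ ((hAL _).2 ⟨u, rfl⟩) _ ((hAL _).2 ⟨v, rfl⟩)
  have hd' : Module.finrank ℝ (L' : Submodule ℝ (CotangentModel n)) = n := by
    have h1 : (L' : Submodule ℝ (CotangentModel n)) = (LinearMap.fst ℝ (EuclideanSpace ℝ (Fin n))
        (EuclideanSpace ℝ (Fin n) →L[ℝ] ℝ)).ker := by
      ext v; exact (hL' v).trans Iff.rfl
    have h2 := LinearMap.finrank_range_add_finrank_ker (LinearMap.fst ℝ (EuclideanSpace ℝ (Fin n))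
        (EuclideanSpace ℝ (Fin n) →L[ℝ] ℝ))
    rw [finrank_cotangentModel, LinearMap.range_eq_top.2 LinearMap.fst_surjective, finrank_top, finrank_euclideanSpace_fin] at h2
    rw [h1]
    exact Nat.add_left_cancel h2
  have hex : ∃ z, IsDetSqQuotient Jθ L L' z := by
    obtain ⟨e, he, heL⟩ := hJ.exists_frame (L := L) hL.1 hL.2
    obtain ⟨e', he', heL'⟩ := hJ.exists_frame (L := L') hd' fun u hu v hv =>
      stdSymplectic_vertical ((hL' u).1 hu) ((hL' v).1 hv)
    exact ⟨_, e, e, e', he, ⟨he, heL⟩, ⟨he', heL'⟩, rfl⟩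
  -- Whichever frames realise the chosen value, the formula by `lagArg` is the same; existence of
  -- some frames is what gives the choice operator its meaning.
  obtain ⟨b, e, e', hb, ⟨he, heL⟩, ⟨he', heL'⟩, hz⟩ := Classical.epsilon_spec hex
  rw [hz]
  refine (hJ.frame_quotient (e := e) hb he').trans ?_
  exact hJ.frame_quotient_eq_exp_lagArg hA hX he (fun j => (hAL _).1 (heL j)) he'
    fun j => (hL' _).1 (heL' j)

end MaslovMap


/-! ### Charts of the cotangent bundle -/

/-- A map of the model space that covers `ψ` and preserves the Liouville form is symplectic. -/
theorem symplectic_of_liouville {n : ℕ} {T : CotangentModel n → CotangentModel n}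
    {T' : CotangentModel n →L[ℝ] CotangentModel n} {z : CotangentModel n}
    {ψ : EuclideanSpace ℝ (Fin n) → EuclideanSpace ℝ (Fin n)}
    (hT : HasFDerivAt T T' z) (hψ : ContDiffAt ℝ 2 ψ z.1)
    (h : ∀ᶠ u in 𝓝 z, (T u).1 = ψ u.1 ∧ (T u).2.comp (fderiv ℝ ψ u.1) = u.2) :
    (∀ u v, stdSymplectic n (T' u) (T' v) = stdSymplectic n u v) ∧
      ∀ u, (T' u).1 = fderiv ℝ ψ z.1 u.1 := by
  have hψd : HasFDerivAt ψ (fderiv ℝ ψ z.1) z.1 :=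
    (hψ.differentiableAt (by norm_num)).hasFDerivAt
  have h1 : ∀ u, (T' u).1 = fderiv ℝ ψ z.1 u.1 := by
    have ha : HasFDerivAt (fun u => (T u).1) ((ContinuousLinearMap.fst ℝ _ _).comp T') z := hT.fst
    have hb : HasFDerivAt (fun u : CotangentModel n => ψ u.1)
        ((fderiv ℝ ψ z.1).comp (ContinuousLinearMap.fst ℝ _ _)) z :=
      hψd.comp z hasFDerivAt_fst
    have := ha.unique (hb.congr_of_eventuallyEq (h.mono fun u hu => hu.1))
    intro u
    simpa using congrArg (fun L => L u) this
  refine ⟨?_, h1⟩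
  have hψ2 : HasFDerivAt (fderiv ℝ ψ) (fderiv ℝ (fderiv ℝ ψ) z.1) z.1 :=
    ((hψ.fderiv_right (m := 1) (by norm_num)).differentiableAt (by norm_num)).hasFDerivAt
  have hψ2' : HasFDerivAt (fun u : CotangentModel n => fderiv ℝ ψ u.1)
      ((fderiv ℝ (fderiv ℝ ψ) z.1).comp (ContinuousLinearMap.fst ℝ _ _)) z :=
    HasFDerivAt.comp z (f := fun u : CotangentModel n => u.1) (g := fderiv ℝ ψ) hψ2
      hasFDerivAt_fst
  -- The derivative of the Liouville relation. Its extra term contains the second derivative of `ψ`,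
  -- which is symmetric and cancels in the antisymmetrisation below.
  have h2 : ∀ u a, (T' u).2 (fderiv ℝ ψ z.1 a) + (T z).2 (fderiv ℝ (fderiv ℝ ψ) z.1 u.1 a) =
      u.2 a := by
    intro u a
    have ha := (hT.snd.clm_comp hψ2')
    have hb : HasFDerivAt (fun u : CotangentModel n => u.2) (ContinuousLinearMap.snd ℝ _ _) z :=
      hasFDerivAt_snd
    have := ha.unique (hb.congr_of_eventuallyEq (h.mono fun u hu => hu.2))
    have := congrArg (fun L => L u a) this
    simp at this
    linarith
  have hsymm : ∀ a b, fderiv ℝ (fderiv ℝ ψ) z.1 a b = fderiv ℝ (fderiv ℝ ψ) z.1 b a :=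
    fun a b => (hψ.isSymmSndFDerivAt (by simp)).eq a b
  intro u v
  have e1 := h2 u v.1
  have e2 := h2 v u.1
  rw [hsymm] at e2
  simp only [stdSymplectic_apply, h1]
  linarith

section Charts

variable {n : ℕ} {S : Type*} [TopologicalSpace S]
  [ChartedSpace (EuclideanSpace ℝ (Fin n)) S] [IsManifold (𝓡 n) ∞ S]

theorem mem_extChartAt_source_iff {θ₀ θ : CotangentBundle n S} :
    θ ∈ (extChartAt (cotangentI n) θ₀).source ↔ θ.proj ∈ (extChartAt (𝓡 n) θ₀.proj).source := by
  rw [FiberBundle.extChartAt]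
  simp only [PartialEquiv.trans_source, PartialEquiv.prod_source, PartialEquiv.refl_source,
    mem_inter_iff, mem_preimage, mem_prod, mem_univ, and_true]
  constructor
  · rintro ⟨h1, h2⟩
    have := (Trivialization.mem_source _).1 h1
    simpa using! this.1
  · intro h
    have h' : θ.proj ∈ (trivializationAt (EuclideanSpace ℝ (Fin n) →L[ℝ] ℝ)
        (fun q : S => TangentSpace (𝓡 n) q →L[ℝ] ℝ) θ₀.proj).baseSet := by
      simpa [hom_trivializationAt_baseSet] using! h
    exact ⟨(Trivialization.mem_source _).2 h', by simpa using! h⟩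

theorem extChartAt_fst (θ₀ θ : CotangentBundle n S) :
    (extChartAt (cotangentI n) θ₀ θ).1 = extChartAt (𝓡 n) θ₀.proj θ.proj := by
  rw [FiberBundle.extChartAt]
  rfl

theorem extChartAt_snd (θ₀ θ : CotangentBundle n S) (h : θ ∈ (extChartAt (cotangentI n) θ₀).source) :
    (extChartAt (cotangentI n) θ₀ θ).2 =
      ContinuousLinearMap.comp (θ.2 : EuclideanSpace ℝ (Fin n) →L[ℝ] ℝ) (tangentCoordChange (𝓡 n) θ₀.proj θ.proj θ.proj) := by
  have h' := mem_extChartAt_source_iff.1 h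
  rw [extChartAt_source] at h'
  rw [FiberBundle.extChartAt]
  ext a
  have := congrArg (fun L => L a) (TangentBundle.symmL_trivializationAt_eq_core (I := 𝓡 n) h')
  refine Eq.trans ?_ (congrArg (θ.snd : EuclideanSpace ℝ (Fin n) →L[ℝ] ℝ) this)
  simp [hom_trivializationAt_apply, ContinuousLinearMap.inCoordinates]

/-- The derivative at `θ` of the canonical chart at `θ₀`. -/
def chartDeriv (θ₀ θ : CotangentBundle n S) : CotangentModel n →L[ℝ] CotangentModel n :=
  tangentCoordChange (cotangentI n) θ θ₀ θ

/-- Fibre coordinates transform by the transposed Jacobian of the base change: this is the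
invariance of the Liouville form `y dx`. -/
theorem extChartAt_snd_comp (θ₀ θ₁ θ : CotangentBundle n S)
    (h₀ : θ ∈ (extChartAt (cotangentI n) θ₀).source)
    (h₁ : θ ∈ (extChartAt (cotangentI n) θ₁).source) :
    (extChartAt (cotangentI n) θ₀ θ).2.comp (tangentCoordChange (𝓡 n) θ₁.proj θ₀.proj θ.proj) =
      (extChartAt (cotangentI n) θ₁ θ).2 := by
  rw [extChartAt_snd _ _ h₀, extChartAt_snd _ _ h₁]
  have : (tangentCoordChange (𝓡 n) θ₀.proj θ.proj θ.proj).comp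
      (tangentCoordChange (𝓡 n) θ₁.proj θ₀.proj θ.proj) =
      tangentCoordChange (𝓡 n) θ₁.proj θ.proj θ.proj := by
    ext1 a
    exact tangentCoordChange_comp
      ⟨⟨mem_extChartAt_source_iff.1 h₁, mem_extChartAt_source_iff.1 h₀⟩, mem_extChartAt_source _⟩
  rw [← this]
  rfl

theorem hasFDerivAt_chart_change (θ₀ θ : CotangentBundle n S)
    (h : θ ∈ (extChartAt (cotangentI n) θ₀).source) :
    HasFDerivAt (extChartAt (cotangentI n) θ₀ ∘ (extChartAt (cotangentI n) θ).symm)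
      (chartDeriv θ₀ θ) (extChartAt (cotangentI n) θ θ) := by
  have := hasFDerivWithinAt_tangentCoordChange (I := cotangentI n) (x := θ) (y := θ₀) (z := θ)
    ⟨mem_extChartAt_source _, h⟩
  rwa [ModelWithCorners.range_eq_univ, hasFDerivWithinAt_univ] at this

/-- Lets tangent planes at nearby points, each read by Mathlib in its own preferred chart, be
compared in one chart without disturbing the symplectic form or the vertical planes. -/
theorem chartDeriv_symplectic_and_fst (θ₀ θ : CotangentBundle n S)
    (h : θ ∈ (extChartAt (cotangentI n) θ₀).source) :
    (∀ u v, stdSymplectic n (chartDeriv θ₀ θ u) (chartDeriv θ₀ θ v) = stdSymplectic n u v) ∧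
      ∀ u, (chartDeriv θ₀ θ u).1 = tangentCoordChange (𝓡 n) θ.proj θ₀.proj θ.proj u.1 := by
  have hq := mem_extChartAt_source_iff.1 h
  have hz : (extChartAt (cotangentI n) θ θ).1 = extChartAt (𝓡 n) θ.proj θ.proj := extChartAt_fst _ _
  have hcc : ∀ q : S, tangentCoordChange (𝓡 n) θ.proj θ₀.proj q =
      fderiv ℝ (extChartAt (𝓡 n) θ₀.proj ∘ (extChartAt (𝓡 n) θ.proj).symm)
        (extChartAt (𝓡 n) θ.proj q) := by
    intro q
    rw [tangentCoordChange_def, ModelWithCorners.range_eq_univ, fderivWithin_univ]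
  have := symplectic_of_liouville (hasFDerivAt_chart_change θ₀ θ h)
    (ψ := extChartAt (𝓡 n) θ₀.proj ∘ (extChartAt (𝓡 n) θ.proj).symm) ?_ ?_
  · refine ⟨this.1, fun u => ?_⟩
    rw [this.2, hz, hcc]
  · rw [hz]
    have := contDiffWithinAt_ext_coord_change (I := 𝓡 n) (n := ∞) θ₀.proj θ.proj
      (y := extChartAt (𝓡 n) θ.proj θ.proj) (by
        rw [PartialEquiv.trans_source, PartialEquiv.symm_source]
        exact ⟨mem_extChartAt_target _, by simpa using! hq⟩)
    rw [ModelWithCorners.range_eq_univ, contDiffWithinAt_univ] at this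
    exact this.of_le (WithTop.coe_le_coe.2 (le_top : (2 : ℕ∞) ≤ ⊤))
  · have h1 : ∀ᶠ u in 𝓝 (extChartAt (cotangentI n) θ θ), u ∈ (extChartAt (cotangentI n) θ).target :=
      extChartAt_target_mem_nhds _
    have h2 : ∀ᶠ u in 𝓝 (extChartAt (cotangentI n) θ θ),
        (extChartAt (cotangentI n) θ).symm u ∈ (extChartAt (cotangentI n) θ₀).source :=
      (continuousAt_extChartAt_symm θ).eventually
        (by rw [extChartAt_to_inv]; exact (isOpen_extChartAt_source θ₀).mem_nhds h)
    filter_upwards [h1, h2] with u hu1 hu2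
    set θ' := (extChartAt (cotangentI n) θ).symm u with hθ'
    have hu : u = extChartAt (cotangentI n) θ θ' := ((extChartAt (cotangentI n) θ).right_inv hu1).symm
    have hs : θ' ∈ (extChartAt (cotangentI n) θ).source :=
      (extChartAt (cotangentI n) θ).map_target hu1
    have hu1 : u.1 = extChartAt (𝓡 n) θ.proj θ'.proj := by rw [hu, extChartAt_fst]
    simp only [Function.comp_apply, ← hθ']
    rw [hu1, ← hcc, extChartAt_snd_comp θ₀ θ θ' hu2 hs, ← hu]
    refine ⟨?_, rfl⟩
    rw [(extChartAt (𝓡 n) θ.proj).left_inv (mem_extChartAt_source_iff.1 hs), extChartAt_fst]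

end Charts


/-! ### Derivatives of maps read in charts -/

section WrittenInCharts

variable {E H M E' H' M' : Type*} [NormedAddCommGroup E] [NormedSpace ℝ E] [TopologicalSpace H]
  [TopologicalSpace M] [ChartedSpace H M] [NormedAddCommGroup E'] [NormedSpace ℝ E']
  [TopologicalSpace H'] [TopologicalSpace M'] [ChartedSpace H' M']
  {I : ModelWithCorners ℝ E H} {I' : ModelWithCorners ℝ E' H'} [I.Boundaryless] [I'.Boundaryless]
  [IsManifold I 1 M] [IsManifold I' 1 M']

theorem hasMFDerivAt_iff_writtenInExtChartAt {f : M → M'} {x : M} {f' : E →L[ℝ] E'} :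
    HasMFDerivAt I I' f x f' ↔
      ContinuousAt f x ∧ HasFDerivAt (writtenInExtChartAt I I' x f) f' (extChartAt I x x) := by
  rw [← hasFDerivWithinAt_univ, ← ModelWithCorners.range_eq_univ I]
  exact Iff.rfl

/-- Both `mfderiv` and the coordinate changes refer to preferred charts; the chain rule converts
between these and charts based at other points. -/
theorem hasFDerivAt_chart_comp {f : M → M'} {x₀ x : M} {y₀ : M'} (hf : MDifferentiableAt I I' f x)
    (hx : x ∈ (extChartAt I x₀).source) (hy : f x ∈ (extChartAt I' y₀).source) :
    HasFDerivAt (extChartAt I' y₀ ∘ f ∘ (extChartAt I x₀).symm)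
      ((tangentCoordChange I' (f x) y₀ (f x)).comp
        (ContinuousLinearMap.comp (mfderiv I I' f x : E →L[ℝ] E') (tangentCoordChange I x₀ x x)))
      (extChartAt I x₀ x) := by
  have h1 : HasFDerivAt (extChartAt I x ∘ (extChartAt I x₀).symm) (tangentCoordChange I x₀ x x)
      (extChartAt I x₀ x) := by
    have := hasFDerivWithinAt_tangentCoordChange (I := I) (x := x₀) (y := x) (z := x)
      ⟨hx, mem_extChartAt_source _⟩
    rwa [ModelWithCorners.range_eq_univ, hasFDerivWithinAt_univ] at this
  have h2 : HasFDerivAt (writtenInExtChartAt I I' x f) (mfderiv I I' f x : E →L[ℝ] E')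
      (extChartAt I x x) := (hasMFDerivAt_iff_writtenInExtChartAt.1 hf.hasMFDerivAt).2
  have h3 : HasFDerivAt (extChartAt I' y₀ ∘ (extChartAt I' (f x)).symm)
      (tangentCoordChange I' (f x) y₀ (f x)) (extChartAt I' (f x) (f x)) := by
    have := hasFDerivWithinAt_tangentCoordChange (I := I') (x := f x) (y := y₀) (z := f x)
      ⟨mem_extChartAt_source _, hy⟩
    rwa [ModelWithCorners.range_eq_univ, hasFDerivWithinAt_univ] at this
  have hxx : (extChartAt I x₀).symm (extChartAt I x₀ x) = x := (extChartAt I x₀).left_inv hx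
  have hz : (extChartAt I x ∘ (extChartAt I x₀).symm) (extChartAt I x₀ x) = extChartAt I x x := by
    simp only [Function.comp_apply, hxx]
  have hw : writtenInExtChartAt I I' x f (extChartAt I x x) = extChartAt I' (f x) (f x) := by
    simp only [writtenInExtChartAt, Function.comp_apply, extChartAt_to_inv]
  have h12 := HasFDerivAt.comp (extChartAt I x₀ x) (g := writtenInExtChartAt I I' x f)
    (by rw [hz]; exact h2) h1
  have h123 := HasFDerivAt.comp (extChartAt I x₀ x)
    (g := extChartAt I' y₀ ∘ (extChartAt I' (f x)).symm) (by
      rw [Function.comp_apply, hz, hw]; exact h3) h12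
  refine h123.congr_of_eventuallyEq ?_
  have hc : ContinuousAt (extChartAt I x₀).symm (extChartAt I x₀ x) :=
    continuousAt_extChartAt_symm' hx
  have e1 : ∀ᶠ z in 𝓝 (extChartAt I x₀ x), (extChartAt I x₀).symm z ∈ (extChartAt I x).source :=
    hc.eventually (by rw [hxx]; exact extChartAt_source_mem_nhds x)
  have e2 : ∀ᶠ z in 𝓝 (extChartAt I x₀ x),
      f ((extChartAt I x₀).symm z) ∈ (extChartAt I' (f x)).source := by
    have : ContinuousAt (f ∘ (extChartAt I x₀).symm) (extChartAt I x₀ x) :=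
      ContinuousAt.comp (by rw [hxx]; exact hf.continuousAt) hc
    exact this.eventually (by
      rw [Function.comp_apply, hxx]; exact extChartAt_source_mem_nhds _)
  filter_upwards [e1, e2] with z hz1 hz2
  simp only [writtenInExtChartAt, Function.comp_apply]
  rw [(extChartAt I x).left_inv hz1, (extChartAt I' (f x)).left_inv hz2]

theorem tangentCoordChange_inverse {x₀ x : M} (hx : x ∈ (extChartAt I x₀).source) :
    (∀ v, tangentCoordChange I x₀ x x (tangentCoordChange I x x₀ x v) = v) ∧
      ∀ v, tangentCoordChange I x x₀ x (tangentCoordChange I x₀ x x v) = v := by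
  have h := mem_extChartAt_source (I := I) x
  constructor <;> intro v <;> rw [tangentCoordChange_comp, tangentCoordChange_self]
  exacts [h, ⟨⟨h, hx⟩, h⟩, hx, ⟨⟨hx, h⟩, hx⟩]

/-- The change of coordinates of tangent vectors as an equivalence. -/
def tangentCoordEquiv {x₀ x : M} (hx : x ∈ (extChartAt I x₀).source) : E ≃L[ℝ] E :=
  ContinuousLinearEquiv.equivOfInverse (tangentCoordChange I x₀ x x) (tangentCoordChange I x x₀ x)
    (tangentCoordChange_inverse hx).2 (tangentCoordChange_inverse hx).1

end WrittenInCharts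

/-! ### The vertical plane and the crossing kernel in coordinates -/

section Vertical

variable {n : ℕ} {S : Type*} [TopologicalSpace S]
  [ChartedSpace (EuclideanSpace ℝ (Fin n)) S] [IsManifold (𝓡 n) ∞ S]

theorem hasFDerivAt_footPoint (θ : CotangentBundle n S) :
    HasMFDerivAt (cotangentI n) (𝓡 n) footPoint θ
      (ContinuousLinearMap.fst ℝ (EuclideanSpace ℝ (Fin n)) (EuclideanSpace ℝ (Fin n) →L[ℝ] ℝ)) := by
  refine hasMFDerivAt_iff_writtenInExtChartAt.2 ⟨(FiberBundle.continuous_proj _ _).continuousAt, ?_⟩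
  refine HasFDerivAt.congr_of_eventuallyEq hasFDerivAt_fst ?_
  filter_upwards [extChartAt_target_mem_nhds (I := cotangentI n) θ] with u hu
  have := extChartAt_fst θ ((extChartAt (cotangentI n) θ).symm u)
  rw [(extChartAt (cotangentI n) θ).right_inv hu] at this
  exact this.symm

theorem mem_verticalPlane {θ : CotangentBundle n S} (v : CotangentModel n) :
    v ∈ verticalPlane θ ↔ v.1 = 0 := by
  rw [verticalPlane, (hasFDerivAt_footPoint θ).mfderiv]
  exact Iff.rfl

variable {F : Type*} [TopologicalSpace F] [ChartedSpace (EuclideanSpace ℝ (Fin n)) F]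

/-- The differential of a map into `T^*S`, read in the preferred charts. -/
def planeMap (ι : F → CotangentBundle n S) (x : F) :
    EuclideanSpace ℝ (Fin n) →L[ℝ] CotangentModel n :=
  mfderiv (𝓡 n) (cotangentI n) ι x

theorem mfderiv_footPoint_comp {ι : F → CotangentBundle n S} {x : F}
    (hι : MDifferentiableAt (𝓡 n) (cotangentI n) ι x) :
    mfderiv (𝓡 n) (𝓡 n) (footPoint ∘ ι) x = horizontalPart (planeMap ι x) :=
  ((hasFDerivAt_footPoint (ι x)).comp x hι.hasMFDerivAt).mfderiv

theorem mem_crossingKernel {ι : F → CotangentBundle n S} {x : F}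
    (hι : MDifferentiableAt (𝓡 n) (cotangentI n) ι x) (u : EuclideanSpace ℝ (Fin n)) :
    u ∈ crossingKernel ι x ↔ (planeMap ι x u).1 = 0 := by
  have := mfderiv_footPoint_comp hι
  exact (congrArg (fun L : EuclideanSpace ℝ (Fin n) →L[ℝ] EuclideanSpace ℝ (Fin n) => L u = 0)
    this).to_iff

end Vertical


/-! ### Compatible complex structures read in one canonical chart -/

section ChartComplex

variable {n : ℕ} {S : Type*} [TopologicalSpace S]
  [ChartedSpace (EuclideanSpace ℝ (Fin n)) S] [IsManifold (𝓡 n) ∞ S]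

/-- An endomorphism of the tangent bundle of `T^*S`, read in the canonical chart at `θ₀`. -/
def chartComplex (J : CotangentBundle n S → CotangentModel n →L[ℝ] CotangentModel n)
    (θ₀ θ : CotangentBundle n S) : CotangentModel n →L[ℝ] CotangentModel n :=
  (chartDeriv θ₀ θ).comp ((J θ).comp
    (tangentCoordChange (cotangentI n) θ₀ θ θ))

theorem chartComplex_apply {J : CotangentBundle n S → CotangentModel n →L[ℝ] CotangentModel n}
    {θ₀ θ : CotangentBundle n S} (h : θ ∈ (extChartAt (cotangentI n) θ₀).source)
    (u : CotangentModel n) :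
    chartComplex J θ₀ θ (chartDeriv θ₀ θ u) = chartDeriv θ₀ θ (J θ u) := by
  have := (tangentCoordChange_inverse (I := cotangentI n) h).1 u
  exact congrArg (fun v : CotangentModel n => chartDeriv θ₀ θ (J θ v)) this

theorem chartComplex_self {J : CotangentBundle n S → CotangentModel n →L[ℝ] CotangentModel n}
    (θ : CotangentBundle n S) : chartComplex J θ θ = J θ := by
  have h : ∀ v, tangentCoordChange (cotangentI n) θ θ θ v = v :=
    fun v => tangentCoordChange_self (mem_extChartAt_source θ)
  refine ContinuousLinearMap.ext fun v => ?_
  change tangentCoordChange (cotangentI n) θ θ θ (J θ (tangentCoordChange (cotangentI n) θ θ θ v)) =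
    J θ v
  rw [h]
  exact congrArg (J θ) (h v)

theorem chartDeriv_surjective {θ₀ θ : CotangentBundle n S}
    (h : θ ∈ (extChartAt (cotangentI n) θ₀).source) : Function.Surjective (chartDeriv θ₀ θ) :=
  (tangentCoordEquiv (I := cotangentI n) h).symm.surjective

theorem chartDeriv_vertical {θ₀ θ : CotangentBundle n S}
    (h : θ ∈ (extChartAt (cotangentI n) θ₀).source) (u : CotangentModel n) :
    (chartDeriv θ₀ θ u).1 = 0 ↔ u.1 = 0 := by
  rw [(chartDeriv_symplectic_and_fst θ₀ θ h).2]
  have hq := mem_extChartAt_source_iff.1 h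
  exact map_eq_zero_iff _ (tangentCoordEquiv (I := 𝓡 n) hq).symm.injective

theorem isCompatible_chartComplex {J : CotangentBundle n S → CotangentModel n →L[ℝ] CotangentModel n}
    {θ₀ θ : CotangentBundle n S} (hJ : IsCompatible (J θ))
    (h : θ ∈ (extChartAt (cotangentI n) θ₀).source) : IsCompatible (chartComplex J θ₀ θ) := by
  have hs := (chartDeriv_symplectic_and_fst θ₀ θ h).1
  constructor
  · intro u
    obtain ⟨u, rfl⟩ := chartDeriv_surjective h u
    rw [chartComplex_apply h, chartComplex_apply h]
    rw [hJ.sq, map_neg]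
  · intro u v
    obtain ⟨u, rfl⟩ := chartDeriv_surjective h u
    obtain ⟨v, rfl⟩ := chartDeriv_surjective h v
    rw [chartComplex_apply h, chartComplex_apply h, hs, hs]
    exact hJ.symplectic u v
  · intro u hu
    obtain ⟨u, rfl⟩ := chartDeriv_surjective h u
    rw [chartComplex_apply h, hs]
    exact hJ.pos u fun h0 => hu (by rw [h0]; exact map_zero _)

theorem IsCompatibleComplexStructure.continuousAt_chartComplex
    {J : CotangentBundle n S → CotangentModel n →L[ℝ] CotangentModel n}
    (hJ : IsCompatibleComplexStructure J) (θ₀ : CotangentBundle n S) :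
    ContinuousAt (chartComplex J θ₀) θ₀ := by
  have h := ((contMDiffAt_hom_bundle _).1 (hJ.smooth θ₀)).2.continuousAt
  refine h.congr ?_
  filter_upwards [extChartAt_source_mem_nhds (I := cotangentI n) θ₀] with θ hθ
  rw [extChartAt_source] at hθ
  exact inTangentCoordinates_eq (I := cotangentI n) (I' := cotangentI n) (M := CotangentBundle n S)
    (M' := CotangentBundle n S) id id J hθ hθ

end ChartComplex

/-! ### Lagrangian immersions -/

section Immersion

variable {n : ℕ} {S : Type*} [TopologicalSpace S]
  [ChartedSpace (EuclideanSpace ℝ (Fin n)) S] [IsManifold (𝓡 n) ∞ S]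
  {F : Type*} [TopologicalSpace F] [ChartedSpace (EuclideanSpace ℝ (Fin n)) F]
  [IsManifold (𝓡 n) ∞ F]

/-- A smooth lagrangian immersion into `T^*S`. -/
structure IsLagrangianImmersion (ι : F → CotangentBundle n S) : Prop where
  contMDiff : ContMDiff (𝓡 n) (cotangentI n) ∞ ι
  injective : ∀ x, Function.Injective (planeMap ι x)
  isotropic : ∀ x, IsIsotropic (planeMap ι x)

/-- The differential at `x` of a map into `T^*S`, read in the charts at `x₀` and `ι x₀`. -/
def chartPlane (ι : F → CotangentBundle n S) (x₀ x : F) :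
    EuclideanSpace ℝ (Fin n) →L[ℝ] CotangentModel n :=
  fderiv ℝ (writtenInExtChartAt (𝓡 n) (cotangentI n) x₀ ι) (extChartAt (𝓡 n) x₀ x)

/-- The points at which the differential of a map into `T^*S` can be read in the charts at `x₀`. -/
def chartDomain (ι : F → CotangentBundle n S) (x₀ : F) : Set F :=
  (extChartAt (𝓡 n) x₀).source ∩ ι ⁻¹' (extChartAt (cotangentI n) (ι x₀)).source

/-- The continuous argument of the tangent planes of a lagrangian immersion. -/
def maslovArg (J : CotangentBundle n S → CotangentModel n →L[ℝ] CotangentModel n)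
    (ι : F → CotangentBundle n S) (x : F) : ℝ :=
  lagArg (J (ι x)) (planeMap ι x)

namespace IsLagrangianImmersion

variable {ι : F → CotangentBundle n S} (hι : IsLagrangianImmersion ι)
include hι

theorem mdifferentiableAt (x : F) : MDifferentiableAt (𝓡 n) (cotangentI n) ι x :=
  (hι.contMDiff x).mdifferentiableAt (by simp)

theorem isOpen_chartDomain (x₀ : F) : IsOpen (chartDomain ι x₀) :=
  (isOpen_extChartAt_source x₀).inter
    ((isOpen_extChartAt_source (I := cotangentI n) (ι x₀)).preimage hι.contMDiff.continuous)

theorem chartDomain_mem_nhds (x₀ : F) : chartDomain ι x₀ ∈ 𝓝 x₀ :=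
  (hι.isOpen_chartDomain x₀).mem_nhds ⟨mem_extChartAt_source _, mem_extChartAt_source _⟩

theorem chartPlane_eq {x₀ x : F} (h : x ∈ chartDomain ι x₀) :
    chartPlane ι x₀ x = ((chartDeriv (ι x₀) (ι x)).comp (planeMap ι x)).comp
      (tangentCoordEquiv (I := 𝓡 n) h.1 : EuclideanSpace ℝ (Fin n) →L[ℝ] EuclideanSpace ℝ (Fin n)) :=
  (hasFDerivAt_chart_comp (hι.mdifferentiableAt x) h.1 h.2).fderiv

theorem chartPlane_self (x : F) : chartPlane ι x x = planeMap ι x :=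
  (hasMFDerivAt_iff_writtenInExtChartAt.1 (hι.mdifferentiableAt x).hasMFDerivAt).2.fderiv

theorem isIsotropic_chartPlane {x₀ x : F} (h : x ∈ chartDomain ι x₀) :
    IsIsotropic (chartPlane ι x₀ x) := by
  intro u v
  rw [hι.chartPlane_eq h]
  exact ((chartDeriv_symplectic_and_fst _ _ h.2).1 _ _).trans (hι.isotropic x _ _)

theorem injective_horizontalPart_chartPlane {x₀ x : F} (h : x ∈ chartDomain ι x₀) :
    Function.Injective (horizontalPart (chartPlane ι x₀ x)) ↔
      Function.Injective (horizontalPart (planeMap ι x)) := by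
  have key : ∀ u, horizontalPart (chartPlane ι x₀ x) u = 0 ↔
      horizontalPart (planeMap ι x) (tangentCoordEquiv h.1 u) = 0 := by
    intro u
    rw [hι.chartPlane_eq h]
    exact chartDeriv_vertical h.2 _
  rw [injective_iff_map_eq_zero, injective_iff_map_eq_zero]
  constructor
  · intro H u hu
    obtain ⟨w, rfl⟩ := (tangentCoordEquiv (I := 𝓡 n) h.1).surjective u
    rw [H w ((key w).2 hu), map_zero]
  · intro H u hu
    exact (map_eq_zero_iff _ (tangentCoordEquiv (I := 𝓡 n) h.1).injective).1 (H _ ((key u).1 hu))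

theorem maslovArg_eq_chart {J : CotangentBundle n S → CotangentModel n →L[ℝ] CotangentModel n}
    (hJ : ∀ θ, IsCompatible (J θ)) {x₀ x : F} (h : x ∈ chartDomain ι x₀)
    (hX : Function.Injective (horizontalPart (planeMap ι x))) :
    maslovArg J ι x = lagArg (chartComplex J (ι x₀) (ι x)) (chartPlane ι x₀ x) := by
  have hJ' := isCompatible_chartComplex (hJ (ι x)) h.2
  have hs := (chartDeriv_symplectic_and_fst _ _ h.2).1
  rw [hι.chartPlane_eq h, lagArg_congr_right hJ']
  · exact (lagArg_map (hJ (ι x)) hJ' hs (fun u => (chartDeriv_vertical h.2 u).2)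
      (fun u => chartComplex_apply h.2 u) _).symm
  · exact fun u v => (hs _ _).trans (hι.isotropic x u v)
  · rw [injective_iff_map_eq_zero] at hX ⊢
    exact fun u hu => hX u ((chartDeriv_vertical h.2 _).1 hu)

theorem contDiffAt_chart {x₀ x : F} (h : x ∈ chartDomain ι x₀) :
    ContDiffAt ℝ ∞ (writtenInExtChartAt (𝓡 n) (cotangentI n) x₀ ι) (extChartAt (𝓡 n) x₀ x) := by
  have := (contMDiffAt_iff_of_mem_source (I := 𝓡 n) (I' := cotangentI n) (x := x₀) (y := ι x₀)
    (by simpa only [extChartAt_source] using h.1)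
    (by simpa only [extChartAt_source] using! h.2)).1 (hι.contMDiff x)
  have := this.2
  rwa [ModelWithCorners.range_eq_univ, contDiffWithinAt_univ] at this

theorem continuousAt_chartPlane (x₀ : F) : ContinuousAt (chartPlane ι x₀) x₀ :=
  ContinuousAt.comp (g := fderiv ℝ (writtenInExtChartAt (𝓡 n) (cotangentI n) x₀ ι))
    ((hι.contDiffAt_chart (mem_of_mem_nhds (hι.chartDomain_mem_nhds x₀))).fderiv_right
      (m := 0) (by simp)).continuousAt (continuousAt_extChartAt x₀)

/-- Transversality is the non-vanishing of the determinant of the horizontal part, read in a fixed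
chart, and that determinant is continuous. -/
theorem eventually_injective_horizontalPart {x₀ : F}
    (hX : Function.Injective (horizontalPart (planeMap ι x₀))) :
    ∀ᶠ x in 𝓝 x₀, Function.Injective (horizontalPart (planeMap ι x)) := by
  have hdet : ∀ A : EuclideanSpace ℝ (Fin n) →L[ℝ] EuclideanSpace ℝ (Fin n),
      Function.Injective A ↔ A.det ≠ 0 := by
    intro A
    have := LinearMap.isUnit_iff_isUnit_det (A : EuclideanSpace ℝ (Fin n) →ₗ[ℝ] _)
    rw [LinearMap.isUnit_iff_ker_eq_bot, LinearMap.ker_eq_bot, isUnit_iff_ne_zero] at this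
    exact this
  have h1 : Tendsto (fun x => (horizontalPart (chartPlane ι x₀ x)).det) (𝓝 x₀)
      (𝓝 (horizontalPart (planeMap ι x₀)).det) := by
    have hc : Continuous fun A : EuclideanSpace ℝ (Fin n) →L[ℝ] CotangentModel n =>
        (horizontalPart A).det :=
      ContinuousLinearMap.continuous_det.comp (continuous_const.clm_comp continuous_id)
    have := (hc.tendsto _).comp (hι.continuousAt_chartPlane x₀)
    rwa [hι.chartPlane_self] at this
  filter_upwards [h1.eventually_ne ((hdet _).1 hX), hι.chartDomain_mem_nhds x₀] with x h h'
  rw [← hι.injective_horizontalPart_chartPlane h', hdet]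
  exact h

/-- The definition reads each point in its own chart, so continuity is invisible there;
`maslovArg_eq_chart` moves everything to the chart at `x₀`, where `tendsto_lagArg` applies. -/
theorem continuousAt_maslovArg {J : CotangentBundle n S → CotangentModel n →L[ℝ] CotangentModel n}
    (hJ : IsCompatibleComplexStructure (n := n) (S := S) J) {x₀ : F}
    (hX : Function.Injective (horizontalPart (planeMap ι x₀))) :
    ContinuousAt (maslovArg J ι) x₀ := by
  have hJc := hJ.isCompatible
  have h0 : maslovArg J ι x₀ = lagArg (J (ι x₀)) (planeMap ι x₀) := rfl
  have hA := hι.continuousAt_chartPlane x₀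
  rw [ContinuousAt, hι.chartPlane_self] at hA
  have hJt := (hJ.continuousAt_chartComplex (ι x₀)).comp (hι.mdifferentiableAt x₀).continuousAt
  rw [ContinuousAt, Function.comp_apply, chartComplex_self] at hJt
  rw [ContinuousAt, h0]
  refine (tendsto_lagArg (hJc _) hJt ?_ hA ?_ (hι.isotropic x₀) hX).congr' ?_
  · filter_upwards [hι.chartDomain_mem_nhds x₀] with x hx
    exact isCompatible_chartComplex (hJc _) hx.2
  · filter_upwards [hι.chartDomain_mem_nhds x₀] with x hx
    exact hι.isIsotropic_chartPlane hx
  · filter_upwards [hι.chartDomain_mem_nhds x₀, hι.eventually_injective_horizontalPart hX]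
      with x hx hxX
    exact (hι.maslovArg_eq_chart hJc hx hxX).symm

set_option synthInstance.maxHeartbeats 200000 in
theorem hasDerivAt_chartPlane {γ : ℝ → F} {t₀ : ℝ} (hγ : MDifferentiableAt 𝓘(ℝ, ℝ) (𝓡 n) γ t₀) :
    HasDerivAt (fun t => chartPlane ι (γ t₀) (γ t))
      (fderiv ℝ (fun z => fderiv ℝ (writtenInExtChartAt (𝓡 n) (cotangentI n) (γ t₀) ι) z)
        (extChartAt (𝓡 n) (γ t₀) (γ t₀)) (mfderiv 𝓘(ℝ, ℝ) (𝓡 n) γ t₀ (1 : ℝ))) t₀ := by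
  have h1 : HasFDerivAt (writtenInExtChartAt 𝓘(ℝ, ℝ) (𝓡 n) t₀ γ)
      (mfderiv 𝓘(ℝ, ℝ) (𝓡 n) γ t₀ : ℝ →L[ℝ] EuclideanSpace ℝ (Fin n)) t₀ := by
    simpa using! (hasMFDerivAt_iff_writtenInExtChartAt.1 hγ.hasMFDerivAt).2
  have h2 : HasDerivAt (fun t => extChartAt (𝓡 n) (γ t₀) (γ t))
      ((mfderiv 𝓘(ℝ, ℝ) (𝓡 n) γ t₀ : ℝ →L[ℝ] EuclideanSpace ℝ (Fin n)) 1) t₀ :=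
    HasFDerivAt.hasDerivAt h1
  -- The derivative obtained here is the second derivative `D₂` that enters `crossingForm`.
  have h3 := ((hι.contDiffAt_chart (mem_of_mem_nhds (hι.chartDomain_mem_nhds (γ t₀)))).fderiv_right
    (m := 1) (by exact WithTop.coe_le_coe.2 le_top)).differentiableAt (by norm_num)
  exact HasFDerivAt.comp_hasDerivAt (l := fderiv ℝ (writtenInExtChartAt (𝓡 n) (cotangentI n) (γ t₀) ι))
    (f := fun t => extChartAt (𝓡 n) (γ t₀) (γ t)) t₀ h3.hasFDerivAt h2

end IsLagrangianImmersion

end Immersion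


/-! ### Fibres of a lagrangian fibration -/

section LeftInverse

variable {E H M E' H' M' : Type*} [NormedAddCommGroup E] [NormedSpace ℝ E] [TopologicalSpace H]
  [TopologicalSpace M] [ChartedSpace H M] [NormedAddCommGroup E'] [NormedSpace ℝ E']
  [TopologicalSpace H'] [TopologicalSpace M'] [ChartedSpace H' M']
  {I : ModelWithCorners ℝ E H} {I' : ModelWithCorners ℝ E' H'} [I.Boundaryless]
  [IsManifold I ∞ M] [IsManifold I' ∞ M']

/-- In the normal form of an immersion one projects off the complementary factor. The smooth left
inverse gives injectivity of the differential and, later, differentiability of orbits as curves in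
`F`. -/
theorem exists_local_left_inverse {f : M → M'} {x : M} (hf : IsImmersionAt I I' ∞ f x) :
    ∃ ρ : M' → M, ContMDiffAt I' I ∞ ρ (f x) ∧ ∀ᶠ y in 𝓝 x, ρ (f y) = y := by
  have h1 := OpenPartialHomeomorph.contMDiffAt_extend (I := I') hf.codChart_mem_maximalAtlas hf.mem_codChart_source
  have hsym : ∀ y ∈ hf.domChart.source,
      (hf.equiv.symm (hf.codChart.extend I' (f y))).1 = hf.domChart.extend I y := by
    intro y hy
    have := hf.writtenInCharts ((hf.domChart.extend I).map_source
      (by rwa [OpenPartialHomeomorph.extend_source]))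
    simp only [Function.comp_apply] at this
    rw [hf.domChart.extend_left_inv hy] at this
    rw [this, ContinuousLinearEquiv.symm_apply_apply]
  refine ⟨fun p => (hf.domChart.extend I).symm (hf.equiv.symm (hf.codChart.extend I' p)).1,
    ?_, ?_⟩
  · have h2 : ContMDiffAt 𝓘(ℝ, E') 𝓘(ℝ, E) ∞ (fun v => (hf.equiv.symm v).1)
        (hf.codChart.extend I' (f x)) := by
      refine ContDiffAt.contMDiffAt ?_
      exact (hf.equiv.symm.contDiff.fst).contDiffAt
    have h3 := (contMDiffOn_extend_symm (I := I) hf.domChart_mem_maximalAtlas).contMDiffAt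
      (x := (hf.equiv.symm (hf.codChart.extend I' (f x))).1) (by
        rw [hsym x hf.mem_domChart_source]
        have := hf.domChart.extend_target_mem_nhdsWithin (I := I) hf.mem_domChart_source
        rwa [ModelWithCorners.range_eq_univ, nhdsWithin_univ,
          OpenPartialHomeomorph.extend_target'] at this)
    exact h3.comp (f x) (h2.comp (f x) h1)
  · filter_upwards [hf.domChart.open_source.mem_nhds hf.mem_domChart_source] with y hy
    rw [hsym y hy, hf.domChart.extend_left_inv hy]

theorem mfderiv_injective_of_left_inverse {f : M → M'} {ρ : M' → M} {x : M}
    (hf : MDifferentiableAt I I' f x) (hρ : MDifferentiableAt I' I ρ (f x))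
    (h : ∀ᶠ y in 𝓝 x, ρ (f y) = y) : Function.Injective (mfderiv I I' f x) := by
  have h1 := hρ.hasMFDerivAt.comp x hf.hasMFDerivAt
  have h2 := h1.congr_of_eventuallyEq (f₁ := id) (h.mono fun y hy => hy.symm)
  have h3 := hasMFDerivAt_unique h2 (hasMFDerivAt_id x)
  exact Function.LeftInverse.injective (g := mfderiv I' I ρ (f x)) fun v =>
    congrArg (fun L : E →L[ℝ] E => L v) h3

end LeftInverse

/-! ### The fibre as a lagrangian immersion -/

section Fibre

variable {n m k : ℕ} {S : Type*} [TopologicalSpace S]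
  [ChartedSpace (EuclideanSpace ℝ (Fin n)) S] [IsManifold (𝓡 n) ∞ S]
  {M : Type*} [TopologicalSpace M]
  [ChartedSpace (EuclideanSpace ℝ (Fin m)) M] [IsManifold (𝓡 m) ∞ M]
  {B : Type*} [TopologicalSpace B]
  [ChartedSpace (EuclideanSpace ℝ (Fin k)) B] [IsManifold (𝓡 k) ∞ B]
  {F : Type*} [TopologicalSpace F]
  [ChartedSpace (EuclideanSpace ℝ (Fin n)) F] [IsManifold (𝓡 n) ∞ F]
  {i : M → CotangentBundle n S} {f : M → B} (hf : IsLagrangianFibration (m := m) (k := k) i f)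
  {b : B} {j : F → M} (hj : IsSmoothEmbedding (𝓡 n) (𝓡 m) ∞ j) (hjb : range j = f ⁻¹' {b})
include hf hj

theorem exists_local_left_inverse_comp (x : F) :
    ∃ ρ : CotangentBundle n S → F, ContMDiffAt (cotangentI n) (𝓡 n) ∞ ρ ((i ∘ j) x) ∧
      ∀ᶠ y in 𝓝 x, ρ ((i ∘ j) y) = y := by
  obtain ⟨ρ, hρ, hρi⟩ := exists_local_left_inverse (hf.embedding.isImmersion.isImmersionAt (j x))
  obtain ⟨σ, hσ, hσj⟩ := exists_local_left_inverse (hj.isImmersion.isImmersionAt x)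
  refine ⟨σ ∘ ρ, ?_, ?_⟩
  · refine ContMDiffAt.comp (i (j x)) ?_ hρ
    rwa [hρi.self_of_nhds]
  · filter_upwards [hσj, (hj.contMDiff.continuous.tendsto x).eventually hρi] with y h1 h2
    simp only [Function.comp_apply]
    rw [h2, h1]

include hjb

theorem planeMap_mem_fibrePlane (x : F) (u : EuclideanSpace ℝ (Fin n)) :
    planeMap (i ∘ j) x u ∈ fibrePlane (m := m) (k := k) i f (j x) := by
  have hi := (hf.embedding.contMDiff (j x)).mdifferentiableAt (by simp)
  have hjd := (hj.contMDiff x).mdifferentiableAt (by simp)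
  have hfd := (hf.smooth (j x)).mdifferentiableAt (by simp)
  refine ⟨mfderiv (𝓡 n) (𝓡 m) j x u, ?_, ?_⟩
  · have h1 := hfd.hasMFDerivAt.comp x hjd.hasMFDerivAt
    have hc : f ∘ j = fun _ => b := by
      funext y
      have : j y ∈ f ⁻¹' {b} := hjb ▸ mem_range_self y
      exact this
    rw [hc] at h1
    have := hasMFDerivAt_unique h1 (hasMFDerivAt_const b x)
    exact congrArg (fun L : EuclideanSpace ℝ (Fin n) →L[ℝ] EuclideanSpace ℝ (Fin k) => L u) this
  · have h1 := (hi.hasMFDerivAt.comp x hjd.hasMFDerivAt).mfderiv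
    exact (congrArg (fun L : EuclideanSpace ℝ (Fin n) →L[ℝ] CotangentModel n => L u) h1).symm

theorem isLagrangianImmersion_fibre : IsLagrangianImmersion (n := n) (S := S) (i ∘ j) := by
  refine ⟨hf.embedding.contMDiff.comp hj.contMDiff, fun x => ?_, fun x u v => ?_⟩
  · obtain ⟨ρ, hρ, h⟩ := exists_local_left_inverse_comp hf hj x
    exact mfderiv_injective_of_left_inverse
      (((hf.embedding.contMDiff.comp hj.contMDiff) x).mdifferentiableAt (by simp))
      (hρ.mdifferentiableAt (by simp)) h
  · exact (hf.lagrangian (j x)).2 _ (planeMap_mem_fibrePlane hf hj hjb x u) _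
      (planeMap_mem_fibrePlane hf hj hjb x v)

/-- The image of `TF` lies in the fibre plane because `f ∘ j` is constant, and both have dimension
`n`. -/
theorem mem_fibrePlane (x : F) (v : CotangentModel n) :
    v ∈ fibrePlane (m := m) (k := k) i f (j x) ↔ ∃ u, planeMap (i ∘ j) x u = v := by
  let L : Submodule ℝ (CotangentModel n) := fibrePlane (m := m) (k := k) i f (j x)
  have h1 : LinearMap.range (planeMap (i ∘ j) x).toLinearMap = L := by
    refine Submodule.eq_of_le_of_finrank_eq ?_ ?_
    · rintro _ ⟨u, rfl⟩
      exact planeMap_mem_fibrePlane hf hj hjb x u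
    · rw [LinearMap.finrank_range_of_inj ((isLagrangianImmersion_fibre hf hj hjb).injective x)]
      exact finrank_euclideanSpace_fin.trans (hf.lagrangian (j x)).1.symm
  change v ∈ L ↔ _
  rw [← h1]
  exact Iff.rfl

theorem mem_maslovSet (x : F) :
    x ∈ j ⁻¹' maslovSet (m := m) (k := k) i f ↔
      ∃ u, u ≠ 0 ∧ (planeMap (i ∘ j) x u).1 = 0 := by
  change fibrePlane (m := m) (k := k) i f (j x) ⊓ verticalPlane (i (j x)) ≠ ⊥ ↔ _
  rw [Submodule.ne_bot_iff]
  have hinj := (isLagrangianImmersion_fibre hf hj hjb).injective x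
  constructor
  · rintro ⟨v, ⟨h1, h2⟩, h3⟩
    obtain ⟨u, rfl⟩ := (mem_fibrePlane hf hj hjb x v).1 h1
    refine ⟨u, ?_, (mem_verticalPlane _).1 h2⟩
    rintro rfl
    exact h3 (map_zero _)
  · rintro ⟨u, hu, h⟩
    exact ⟨planeMap (i ∘ j) x u, ⟨planeMap_mem_fibrePlane hf hj hjb x u,
      (mem_verticalPlane _).2 h⟩, fun h0 => hu (hinj (h0.trans (map_zero _).symm))⟩

theorem notMem_maslovSet (x : F) :
    x ∉ j ⁻¹' maslovSet (m := m) (k := k) i f ↔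
      Function.Injective (horizontalPart (planeMap (i ∘ j) x)) := by
  rw [mem_maslovSet hf hj hjb, injective_iff_map_eq_zero]
  push Not
  exact ⟨fun h u hu => by_contra fun h0 => h u h0 hu, fun h u hu h0 => hu (h u h0)⟩

theorem maslovMap_eq {J : CotangentBundle n S → CotangentModel n →L[ℝ] CotangentModel n}
    (hJ : IsCompatibleComplexStructure (n := n) (S := S) J) {x : F}
    (hx : x ∉ j ⁻¹' maslovSet (m := m) (k := k) i f) :
    maslovMap (m := m) (k := k) J i f (j x) =
      (-1) ^ n * Complex.exp (2 * maslovArg J (i ∘ j) x * Complex.I) :=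
  epsilon_isDetSqQuotient (hJ.isCompatible _) (hf.lagrangian (j x))
    (mem_fibrePlane hf hj hjb x) ((notMem_maslovSet hf hj hjb x).1 hx) fun v => mem_verticalPlane v

end Fibre


/-! ### The inverse function theorem on manifolds -/

section InverseFunction

variable {E M N : Type*} [NormedAddCommGroup E] [NormedSpace ℝ E] [FiniteDimensional ℝ E]
  [TopologicalSpace M] [ChartedSpace E M] [IsManifold 𝓘(ℝ, E) ∞ M]
  [TopologicalSpace N] [ChartedSpace E N] [IsManifold 𝓘(ℝ, E) ∞ N]

/-- A smooth map with invertible derivatives on an open set of a vector space is a local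
diffeomorphism. -/
theorem exists_openPartialHomeomorph {f : E → E} {U : Set E} (hU : IsOpen U)
    (hf : ContDiffOn ℝ ∞ f U) (hf' : ∀ z ∈ U, Function.Injective (fderiv ℝ f z)) {z : E}
    (hz : z ∈ U) : ∃ e : OpenPartialHomeomorph E E, z ∈ e.source ∧ e.source ⊆ U ∧ (e : E → E) = f ∧
      ContDiffOn ℝ ∞ e.symm e.target := by
  have : CompleteSpace E := FiniteDimensional.complete ℝ E
  have hat : ∀ w ∈ U, ContDiffAt ℝ ∞ f w := fun w hw => hf.contDiffAt (hU.mem_nhds hw)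
  have heq : ∀ w ∈ U, ∃ A : E ≃L[ℝ] E, HasFDerivAt f (A : E →L[ℝ] E) w := by
    intro w hw
    refine ⟨(LinearEquiv.ofInjectiveEndo (fderiv ℝ f w).toLinearMap
      (hf' w hw)).toContinuousLinearEquiv, ?_⟩
    convert ((hat w hw).differentiableAt (by simp)).hasFDerivAt using 1
    ext v
    rfl
  obtain ⟨A, hA⟩ := heq z hz
  -- Restriction to `U` keeps the derivative invertible on the entire source, so the inverse is
  -- smooth on the entire target and not only at the image of `z`.
  let e := ((hat z hz).toOpenPartialHomeomorph f hA (by simp)).restr U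
  have he : (e : E → E) = f := rfl
  have hsrc : e.source ⊆ U := by
    rw [OpenPartialHomeomorph.restr_source, hU.interior_eq]
    exact inter_subset_right
  refine ⟨e, ?_, hsrc, he, ?_⟩
  · rw [OpenPartialHomeomorph.restr_source, hU.interior_eq]
    exact ⟨(hat z hz).mem_toOpenPartialHomeomorph_source hA (by simp), hz⟩
  · intro y hy
    have hw := hsrc (e.map_target hy)
    obtain ⟨A', hA'⟩ := heq _ hw
    exact (e.contDiffAt_symm hy hA' (hat _ hw)).contDiffWithinAt

theorem isLocalDiffeomorph_of_injective_mfderiv {f : M → N} (hf : ContMDiff 𝓘(ℝ, E) 𝓘(ℝ, E) ∞ f)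
    (hf' : ∀ x, Function.Injective (mfderiv 𝓘(ℝ, E) 𝓘(ℝ, E) f x)) :
    IsLocalDiffeomorph 𝓘(ℝ, E) 𝓘(ℝ, E) ∞ f := by
  intro x
  let a := chartAt E x
  let c := chartAt E (f x)
  let V : Set M := a.source ∩ f ⁻¹' c.source
  have hV : IsOpen V := a.open_source.inter (c.open_source.preimage hf.continuous)
  let U : Set E := a.target ∩ a.symm ⁻¹' V
  have hU : IsOpen U := a.isOpen_inter_preimage_symm hV
  have hUV : ∀ z ∈ U, a.symm z ∈ V := fun z hz => hz.2
  have hxU : a x ∈ U := ⟨a.map_source (mem_chart_source E x), by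
    rw [mem_preimage, a.left_inv (mem_chart_source E x)]
    exact ⟨mem_chart_source E x, mem_chart_source E (f x)⟩⟩
  have hsm : ContDiffOn ℝ ∞ (c ∘ f ∘ a.symm) U := by
    rw [← contMDiffOn_iff_contDiffOn]
    refine (contMDiffOn_chart (x := f x)).comp ((hf.contMDiffOn (s := univ)).comp
      (contMDiffOn_chart_symm.mono inter_subset_left) (subset_univ _)) ?_
    exact fun z hz => (hUV z hz).2
  obtain ⟨e, h1, h2, h3, h4⟩ := exists_openPartialHomeomorph hU hsm (fun z hz => by
    have hd := hasFDerivAt_chart_comp (I := 𝓘(ℝ, E)) (I' := 𝓘(ℝ, E)) (x₀ := x) (y₀ := f x)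
      (x := a.symm z) (hf.mdifferentiable (by simp) _)
      (by simpa using! (hUV z hz).1) (by simpa using! (hUV z hz).2)
    have hz' : extChartAt 𝓘(ℝ, E) x (a.symm z) = z := by simpa using! a.right_inv hz.1
    rw [hz'] at hd
    have hd' : fderiv ℝ (c ∘ f ∘ a.symm) z = _ := hd.fderiv
    rw [hd']
    have k1 : Function.Injective (tangentCoordChange 𝓘(ℝ, E) (f (a.symm z)) (f x) (f (a.symm z))) :=
      (tangentCoordEquiv (I := 𝓘(ℝ, E)) (by simpa using! (hUV z hz).2)).symm.injective
    have k2 : Function.Injective (tangentCoordChange 𝓘(ℝ, E) x (a.symm z) (a.symm z)) :=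
      (tangentCoordEquiv (I := 𝓘(ℝ, E)) (by simpa using! (hUV z hz).1)).injective
    exact (k1.comp (hf' _)).comp k2) hxU
  let Φ := (a.trans e).trans c.symm
  have hsrc : ∀ p ∈ Φ.source, p ∈ a.source ∧ a p ∈ e.source ∧ Φ p = f p := by
    intro p hp
    simp only [Φ, OpenPartialHomeomorph.trans_source, mem_inter_iff, mem_preimage] at hp
    refine ⟨hp.1.1, hp.1.2, ?_⟩
    have := (hUV _ (h2 hp.1.2)).2
    simp only [Φ, OpenPartialHomeomorph.coe_trans, Function.comp_apply, h3]
    rw [a.left_inv hp.1.1] at this ⊢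
    exact c.left_inv this
  refine ⟨⟨Φ.toPartialEquiv, Φ.open_source, Φ.open_target, ?_, ?_⟩, ?_, ?_⟩
  · exact hf.contMDiffOn.congr fun p hp => (hsrc p hp).2.2
  · have hh : ContMDiffOn 𝓘(ℝ, E) 𝓘(ℝ, E) ∞ (a.symm ∘ e.symm ∘ c) Φ.target := by
      have ht : ∀ q ∈ Φ.target, q ∈ c.source ∧ c q ∈ e.target ∧ e.symm (c q) ∈ a.target := by
        intro q hq
        simp only [Φ, OpenPartialHomeomorph.trans_target, mem_inter_iff, mem_preimage,
          OpenPartialHomeomorph.symm_target, OpenPartialHomeomorph.symm_symm] at hq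
        exact ⟨hq.1, hq.2.1, hq.2.2⟩
      refine (contMDiffOn_chart_symm (x := x)).comp ((contMDiffOn_iff_contDiffOn.2 h4).comp
        ((contMDiffOn_chart (x := f x)).mono fun q hq => (ht q hq).1) fun q hq => (ht q hq).2.1)
        fun q hq => (ht q hq).2.2
    exact hh
  · simp only [Φ, OpenPartialHomeomorph.trans_source, mem_inter_iff, mem_preimage]
    refine ⟨⟨mem_chart_source E x, h1⟩, ?_⟩
    simp only [OpenPartialHomeomorph.coe_trans, Function.comp_apply, h3,
      OpenPartialHomeomorph.symm_source]
    rw [show a.symm (a x) = x from a.left_inv (mem_chart_source E x)]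
    exact c.map_source (mem_chart_source E (f x))
  · exact fun p hp => (hsrc p hp).2.2.symm

theorem IsLocalDiffeomorph.injective_mfderiv {f : M → N}
    (hf : IsLocalDiffeomorph 𝓘(ℝ, E) 𝓘(ℝ, E) ∞ f) (x : M) :
    Function.Injective (mfderiv 𝓘(ℝ, E) 𝓘(ℝ, E) f x) := by
  rw [← (hf x).mfderivToContinuousLinearEquiv_coe (by simp)]
  exact ((hf x).mfderivToContinuousLinearEquiv (by simp)).injective

end InverseFunction


/-! ### Continuity of the local flow of a vector field -/

section LocalFlow

variable {E H M : Type*} [NormedAddCommGroup E] [NormedSpace ℝ E] [CompleteSpace E]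
  [TopologicalSpace H] {I : ModelWithCorners ℝ E H} [I.Boundaryless]
  [TopologicalSpace M] [ChartedSpace H M] [IsManifold I 1 M] [T2Space M]

/-- A vector field read in the chart at `p`. -/
def chartField (I : ModelWithCorners ℝ E H) {M : Type*} [TopologicalSpace M] [ChartedSpace H M]
    [IsManifold I 1 M] (v : M → E) (p : M) (z : E) : E :=
  tangentCoordChange I ((extChartAt I p).symm z) p ((extChartAt I p).symm z)
    (v ((extChartAt I p).symm z))

theorem hasMFDerivAt_chart_symm_comp {v : M → E} {p : M} {c : ℝ → E} {t : ℝ}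
    (hc : HasDerivAt c (chartField I v p (c t)) t) (ht : c t ∈ (extChartAt I p).target) :
    HasMFDerivAt 𝓘(ℝ, ℝ) I (fun s => (extChartAt I p).symm (c s)) t
      ((1 : ℝ →L[ℝ] ℝ).smulRight (v ((extChartAt I p).symm (c t)))) := by
  set x := (extChartAt I p).symm (c t) with hx
  have hxs : x ∈ (extChartAt I p).source := (extChartAt I p).map_target ht
  have hpx : extChartAt I p x = c t := (extChartAt I p).right_inv ht
  have h1 := hasFDerivWithinAt_tangentCoordChange (I := I) (x := p) (y := x) (z := x)
    ⟨hxs, mem_extChartAt_source _⟩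
  rw [ModelWithCorners.range_eq_univ, hasFDerivWithinAt_univ, hpx] at h1
  have h2 := h1.comp_hasDerivAt t hc
  have h3 : tangentCoordChange I p x x (chartField I v p (c t)) = v x :=
    (tangentCoordChange_inverse hxs).1 _
  rw [h3] at h2
  refine hasMFDerivAt_iff_writtenInExtChartAt.2
    ⟨(continuousAt_extChartAt_symm'' ht).comp hc.continuousAt, ?_⟩
  exact h2.hasFDerivAt

/-- The flow is given only orbit by orbit, so continuity in the initial point must be derived:
Picard–Lindelöf in a chart supplies a local flow continuous in the initial point, and uniqueness of
integral curves identifies every given orbit with it. -/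
theorem exists_continuousAt_local_flow {v : M → E}
    (hv : ContMDiff I I.tangent 1 (fun x => (⟨x, v x⟩ : TangentBundle I M))) (p : M) :
    ∃ ε > (0 : ℝ), ∃ Ψ : M → ℝ → M, (∀ t, |t| < ε → ContinuousAt (fun q => Ψ q t) p) ∧
      ∀ᶠ q in 𝓝 p, ∀ c : ℝ → M, IsMIntegralCurve (I := I) c v → c 0 = q →
        ∀ t, |t| < ε → c t = Ψ q t := by
  have hg : ContDiffAt ℝ 1 (chartField I v p) (extChartAt I p p) := by
    have h := (contMDiffAt_iff.1 (hv p)).2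
    rw [ModelWithCorners.range_eq_univ, contDiffWithinAt_univ] at h
    exact h.snd
  obtain ⟨ε₁, hε₁, a, r, L, K, hr, hpl⟩ := IsPicardLindelof.of_contDiffAt_one hg
  obtain ⟨α, hα, hαc⟩ := (hpl 0).exists_forall_mem_closedBall_eq_hasDerivWithinAt_continuousOn
  set z := extChartAt I p p with hz
  have hnhds : Metric.closedBall z r ×ˢ Icc (0 - ε₁) (0 + ε₁) ∈ 𝓝 (z, (0 : ℝ)) :=
    prod_mem_nhds (Metric.closedBall_mem_nhds _ hr) (Icc_mem_nhds (by linarith) (by linarith))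
  have hα0 : α (z, 0) = z := (hα z (Metric.mem_closedBall_self hr.le)).1
  -- For short times and nearby initial points the solution stays in the chart, so it can be carried
  -- back to the manifold.
  have htar : ∀ᶠ w in 𝓝 (z, (0 : ℝ)), α w ∈ (extChartAt I p).target :=
    (hαc.continuousAt hnhds).eventually (by rw [hα0]; exact extChartAt_target_mem_nhds p)
  obtain ⟨V, hV, W, hW, hVW⟩ := mem_nhds_prod_iff.1 htar
  obtain ⟨δ, hδ, hδW⟩ := Metric.mem_nhds_iff.1 hW
  have hsub : ∀ t : ℝ, |t| < min δ ε₁ → t ∈ W ∧ t ∈ Ioo (0 - ε₁) (0 + ε₁) := by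
    intro t ht
    have h1 := lt_of_lt_of_le ht (min_le_left _ _)
    have h2 := abs_lt.1 (lt_of_lt_of_le ht (min_le_right _ _))
    exact ⟨hδW (by simpa using h1), by linarith [h2.1], by linarith [h2.2]⟩
  refine ⟨min δ ε₁, lt_min hδ hε₁, fun q t => (extChartAt I p).symm (α (extChartAt I p q, t)),
    ?_, ?_⟩
  · intro t ht
    obtain ⟨h1, h2⟩ := hsub t ht
    have hmem : α (z, t) ∈ (extChartAt I p).target := hVW ⟨mem_of_mem_nhds hV, h1⟩
    refine ContinuousAt.comp (f := fun q => α (extChartAt I p q, t)) (x := p)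
      (continuousAt_extChartAt_symm'' hmem) ?_
    have hc : ContinuousAt α (z, t) := hαc.continuousAt
      (prod_mem_nhds (Metric.closedBall_mem_nhds _ hr) (Icc_mem_nhds h2.1 h2.2))
    exact ContinuousAt.comp (f := fun q => (extChartAt I p q, t)) (x := p) hc
      ((continuousAt_extChartAt p).prodMk continuousAt_const)
  · have hq : ∀ᶠ q in 𝓝 p, extChartAt I p q ∈ V ∩ Metric.closedBall z r :=
      (continuousAt_extChartAt p).eventually (inter_mem hV (Metric.closedBall_mem_nhds _ hr))
    filter_upwards [hq, extChartAt_source_mem_nhds (I := I) p] with q hq hqs c hc hc0 t ht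
    have hcurve : IsMIntegralCurveOn (I := I) (fun s => (extChartAt I p).symm
        (α (extChartAt I p q, s))) v (Ioo (-min δ ε₁) (min δ ε₁)) := by
      intro s hs
      obtain ⟨h1, h2⟩ := hsub s (abs_lt.2 hs)
      exact (hasMFDerivAt_chart_symm_comp (((hα _ hq.2).2 s ⟨h2.1.le, h2.2.le⟩).hasDerivAt
        (Icc_mem_nhds h2.1 h2.2)) (hVW ⟨hq.1, h1⟩)).hasMFDerivWithinAt
    have h0 : (0 : ℝ) ∈ Ioo (-min δ ε₁) (min δ ε₁) := by
      have := lt_min hδ hε₁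
      exact ⟨by linarith, this⟩
    refine isMIntegralCurveOn_Ioo_eqOn_of_contMDiff_boundaryless h0 hv
      (hc.isMIntegralCurveOn _) hcurve ?_ (abs_lt.1 ht)
    rw [(hα _ hq.2).1, (extChartAt I p).left_inv hqs, hc0]

end LocalFlow


/-! ### The hamiltonian vector field -/

section HamiltonianField

variable {n : ℕ}

/-- The vector `X` with `ω(X, ·) = -ℓ`. -/
def sympGrad (ℓ : CotangentModel n →L[ℝ] ℝ) : CotangentModel n :=
  (∑ k, ℓ (0, EuclideanSpace.proj k) • EuclideanSpace.single k (1 : ℝ),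
    -ℓ.comp (ContinuousLinearMap.inl ℝ _ _))

theorem stdSymplectic_sympGrad (ℓ : CotangentModel n →L[ℝ] ℝ) (v : CotangentModel n) :
    stdSymplectic n (sympGrad ℓ) v = -ℓ v := by
  have h1 : v.2 = ∑ k, v.2 (EuclideanSpace.single k (1 : ℝ)) • EuclideanSpace.proj (𝕜 := ℝ) k := by
    ext u
    nth_rewrite 1 [← (EuclideanSpace.basisFun (Fin n) ℝ).sum_repr u]
    simp [mul_comm]
  have h2 : ℓ v = ℓ (v.1, 0) + ∑ k, v.2 (EuclideanSpace.single k (1 : ℝ)) *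
      ℓ (0, EuclideanSpace.proj k) := by
    have h3 : ℓ (0, v.2) = ∑ k, v.2 (EuclideanSpace.single k (1 : ℝ)) *
        ℓ (0, EuclideanSpace.proj k) := by
      have := congrArg (fun α => ℓ.comp (ContinuousLinearMap.inr ℝ _ _) α) h1
      simpa [map_sum] using this
    rw [← h3, ← map_add]
    simp
  rw [h2]
  simp [sympGrad, map_sum, mul_comm]
  ring

theorem stdSymplectic_left_cancel {u u' : CotangentModel n}
    (h : ∀ v, stdSymplectic n u v = stdSymplectic n u' v) : u = u' := by
  refine Prod.ext ?_ ?_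
  · ext k
    simpa using h (0, EuclideanSpace.proj k)
  · ext a
    simpa using h (a, 0)

theorem contDiff_sympGrad : ContDiff ℝ ∞ (sympGrad (n := n)) := by
  refine ContDiff.prodMk (ContDiff.sum fun k _ => ?_) ?_
  · exact (contDiff_id.clm_apply contDiff_const).smul (contDiff_const (c := EuclideanSpace.single k 1))
  · exact (contDiff_id.clm_comp contDiff_const).neg

variable {S : Type*} [TopologicalSpace S]
  [ChartedSpace (EuclideanSpace ℝ (Fin n)) S] [IsManifold (𝓡 n) ∞ S]

/-- Needed for uniqueness of integral curves. Points over different base points are separated in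
`S`, points over the same one in a trivialization. -/
theorem t2Space_cotangentBundle [T2Space S] : T2Space (CotangentBundle n S) := by
  refine ⟨fun x y hxy => ?_⟩
  by_cases h : x.proj = y.proj
  · let e := trivializationAt (EuclideanSpace ℝ (Fin n) →L[ℝ] ℝ)
      (fun q : S => TangentSpace (𝓡 n) q →L[ℝ] ℝ) x.proj
    have hx : x ∈ e.source := FiberBundle.mem_trivializationAt_proj_source
    have hy : y ∈ e.source := by
      rw [e.mem_source, ← h]
      exact FiberBundle.mem_baseSet_trivializationAt' _
    have hne : e.toOpenPartialHomeomorph x ≠ e.toOpenPartialHomeomorph y :=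
      fun h0 => hxy (e.toOpenPartialHomeomorph.injOn hx hy h0)
    obtain ⟨u, v, hu, hv, hxu, hyv, huv⟩ := t2_separation hne
    exact ⟨_, _, e.toOpenPartialHomeomorph.isOpen_inter_preimage hu,
      e.toOpenPartialHomeomorph.isOpen_inter_preimage hv, ⟨hx, hxu⟩, ⟨hy, hyv⟩,
      (huv.preimage _).mono inter_subset_right inter_subset_right⟩
  · obtain ⟨u, v, hu, hv, hxu, hyv, huv⟩ := t2_separation h
    have hc := FiberBundle.continuous_proj (EuclideanSpace ℝ (Fin n) →L[ℝ] ℝ)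
      (fun q : S => TangentSpace (𝓡 n) q →L[ℝ] ℝ)
    exact ⟨_, _, hu.preimage hc, hv.preimage hc, hxu, hyv, huv.preimage _⟩

/-- The differential of a function on `T^*S`. -/
def differential (H : CotangentBundle n S → ℝ) (θ : CotangentBundle n S) :
    CotangentModel n →L[ℝ] ℝ :=
  mfderiv (cotangentI n) 𝓘(ℝ, ℝ) H θ

/-- The velocity of a curve in a manifold. -/
def velocity {E H M : Type*} [NormedAddCommGroup E] [NormedSpace ℝ E] [TopologicalSpace H]
    (I : ModelWithCorners ℝ E H) [TopologicalSpace M] [ChartedSpace H M] (c : ℝ → M) (t : ℝ) : E :=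
  mfderiv 𝓘(ℝ, ℝ) I c t (1 : ℝ)

/-- The hamiltonian vector field. -/
def hamField (H : CotangentBundle n S → ℝ) (θ : CotangentBundle n S) : CotangentModel n :=
  sympGrad (differential H θ)

theorem IsHamiltonianCurve.velocity_eq {H : CotangentBundle n S → ℝ}
    {c : ℝ → CotangentBundle n S} (hc : IsHamiltonianCurve H c) (t : ℝ) :
    velocity (cotangentI n) c t = hamField H (c t) := by
  refine stdSymplectic_left_cancel fun v => ?_
  rw [hamField, stdSymplectic_sympGrad]
  exact hc.2 t v

theorem IsHamiltonianCurve.isMIntegralCurve {H : CotangentBundle n S → ℝ}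
    {c : ℝ → CotangentBundle n S} (hc : IsHamiltonianCurve H c) :
    IsMIntegralCurve (I := cotangentI n) c (hamField H) := by
  intro t
  have h : (1 : ℝ →L[ℝ] ℝ).smulRight (hamField H (c t)) =
      (mfderiv 𝓘(ℝ, ℝ) (cotangentI n) c t : ℝ →L[ℝ] CotangentModel n) := by
    refine ContinuousLinearMap.ext_ring ?_
    rw [← hc.velocity_eq]
    exact one_smul ℝ (velocity (cotangentI n) c t)
  exact h ▸ (hc.1 t).hasMFDerivAt

/-- The derivative of a function on `T^*S`, read in the canonical chart at `θ₀`. -/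
theorem hasFDerivAt_chart_function {H : CotangentBundle n S → ℝ}
    (hH : ContMDiff (cotangentI n) 𝓘(ℝ, ℝ) ∞ H) {θ₀ θ : CotangentBundle n S}
    (h : θ ∈ (extChartAt (cotangentI n) θ₀).source) :
    HasFDerivAt (H ∘ (extChartAt (cotangentI n) θ₀).symm)
      ((differential H θ).comp
        (tangentCoordChange (cotangentI n) θ₀ θ θ)) (extChartAt (cotangentI n) θ₀ θ) := by
  have := hasFDerivAt_chart_comp (I' := 𝓘(ℝ, ℝ)) (y₀ := (0 : ℝ))
    (hH.mdifferentiableAt (by simp)) h (by rw [extChartAt_source, chartAt_self_eq]; exact mem_univ _)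
  have h1 : tangentCoordChange 𝓘(ℝ, ℝ) (H θ) (0 : ℝ) (H θ) = 1 :=
    TangentBundle.coordChange_model_space _ _ _
  rw [h1] at this
  exact this

theorem contDiffAt_chart_function {H : CotangentBundle n S → ℝ}
    (hH : ContMDiff (cotangentI n) 𝓘(ℝ, ℝ) ∞ H) {θ₀ θ : CotangentBundle n S}
    (h : θ ∈ (extChartAt (cotangentI n) θ₀).source) :
    ContDiffAt ℝ ∞ (H ∘ (extChartAt (cotangentI n) θ₀).symm) (extChartAt (cotangentI n) θ₀ θ) := by
  have h1 := (contMDiffAt_iff_source_of_mem_source (I := cotangentI n) (I' := 𝓘(ℝ, ℝ)) (x := θ₀)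
    (by simpa only [extChartAt_source] using h)).1 (hH θ)
  rw [ModelWithCorners.range_eq_univ, contMDiffWithinAt_univ] at h1
  exact h1.contDiffAt

/-- Canonical charts are symplectic, so they carry the hamiltonian field to the symplectic gradient
of `H` in coordinates. This expression shows that the field is smooth. -/
theorem chartDeriv_hamField {H : CotangentBundle n S → ℝ}
    (hH : ContMDiff (cotangentI n) 𝓘(ℝ, ℝ) ∞ H) {θ₀ θ : CotangentBundle n S}
    (h : θ ∈ (extChartAt (cotangentI n) θ₀).source) :
    chartDeriv θ₀ θ (hamField H θ) = sympGrad (fderiv ℝ (H ∘ (extChartAt (cotangentI n) θ₀).symm)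
      (extChartAt (cotangentI n) θ₀ θ)) := by
  refine stdSymplectic_left_cancel fun w => ?_
  obtain ⟨u, rfl⟩ := chartDeriv_surjective h w
  rw [(chartDeriv_symplectic_and_fst _ _ h).1, stdSymplectic_sympGrad, hamField,
    stdSymplectic_sympGrad, (hasFDerivAt_chart_function hH h).fderiv]
  have := (tangentCoordChange_inverse (I := cotangentI n) h).1 u
  exact congrArg (fun v : CotangentModel n => -differential H θ v) this.symm

theorem contMDiff_hamField {H : CotangentBundle n S → ℝ}
    (hH : ContMDiff (cotangentI n) 𝓘(ℝ, ℝ) ∞ H) :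
    ContMDiff (cotangentI n) (cotangentI n).tangent 1
      (fun θ => (⟨θ, hamField H θ⟩ : TangentBundle (cotangentI n) (CotangentBundle n S))) := by
  intro θ₀
  refine (contMDiffAt_section (IB := cotangentI n) (F := CotangentModel n)
    (E := TangentSpace (cotangentI n)) (s := hamField H) θ₀).2 ?_
  have h1 : ContMDiffAt (cotangentI n) 𝓘(ℝ, CotangentModel n) 1 (fun θ => sympGrad (fderiv ℝ
      (H ∘ (extChartAt (cotangentI n) θ₀).symm) (extChartAt (cotangentI n) θ₀ θ))) θ₀ := by
    have h2 : ContDiffAt ℝ 1 (fun z => sympGrad (fderiv ℝ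
        (H ∘ (extChartAt (cotangentI n) θ₀).symm) z)) (extChartAt (cotangentI n) θ₀ θ₀) :=
      (contDiff_sympGrad.of_le (WithTop.coe_le_coe.2 le_top)).contDiffAt.comp _
        ((contDiffAt_chart_function hH (mem_extChartAt_source θ₀)).fderiv_right
          (WithTop.coe_le_coe.2 le_top))
    exact h2.contMDiffAt.comp θ₀ contMDiffAt_extChartAt
  refine h1.congr_of_eventuallyEq ?_
  filter_upwards [extChartAt_source_mem_nhds (I := cotangentI n) θ₀] with θ hθ
  exact chartDeriv_hamField hH hθ

end HamiltonianField


/-! ### The sign of the crossings along the hamiltonian flow -/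

section SecondDerivatives

variable {X Y : Type*} [NormedAddCommGroup X] [NormedSpace ℝ X] [NormedAddCommGroup Y]
  [NormedSpace ℝ Y]

theorem hasFDerivAt_fderiv {f : X → Y} {z : X} (hf : ContDiffAt ℝ 2 f z) :
    HasFDerivAt (fderiv ℝ f) (fderiv ℝ (fderiv ℝ f) z) z :=
  ((hf.fderiv_right (m := 1) (by norm_num)).differentiableAt (by norm_num)).hasFDerivAt

theorem iteratedDeriv_two_line {f : X → ℝ} {z : X} (hf : ContDiffAt ℝ 2 f z) (ξ : X) :
    iteratedDeriv 2 (fun t : ℝ => f (z + t • ξ)) 0 = fderiv ℝ (fderiv ℝ f) z ξ ξ := by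
  have hline : ∀ t : ℝ, HasDerivAt (fun t : ℝ => z + t • ξ) ξ t := fun t => by
    simpa using ((hasDerivAt_id t).smul_const ξ).const_add z
  have hcont : Tendsto (fun t : ℝ => z + t • ξ) (𝓝 0) (𝓝 z) := by
    simpa using (hline 0).continuousAt.tendsto
  have hd : ∀ᶠ w in 𝓝 z, DifferentiableAt ℝ f w :=
    (hf.eventually (by simp)).mono fun w hw => hw.differentiableAt (by simp)
  have h1 : deriv (fun t : ℝ => f (z + t • ξ)) =ᶠ[𝓝 0] fun t => fderiv ℝ f (z + t • ξ) ξ := by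
    filter_upwards [hcont.eventually hd] with t ht
    exact (ht.hasFDerivAt.comp_hasDerivAt t (hline t)).deriv
  have h2 : HasFDerivAt (fderiv ℝ f) (fderiv ℝ (fderiv ℝ f) z) (z + (0 : ℝ) • ξ) := by
    rw [zero_smul, add_zero]
    exact hasFDerivAt_fderiv hf
  have h3 : HasDerivAt (fun t : ℝ => fderiv ℝ f (z + t • ξ)) (fderiv ℝ (fderiv ℝ f) z ξ) 0 :=
    HasFDerivAt.comp_hasDerivAt (l := fderiv ℝ f) (0 : ℝ) h2 (hline 0)
  have h4 : HasDerivAt (fun t : ℝ => fderiv ℝ f (z + t • ξ) ξ) (fderiv ℝ (fderiv ℝ f) z ξ ξ) 0 := by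
    simpa using h3.clm_apply (hasDerivAt_const (0 : ℝ) ξ)
  rw [iteratedDeriv_succ, iteratedDeriv_one, h1.deriv_eq, h4.deriv]

theorem second_fderiv_of_constant_along {f : X → Y} {K : Y → ℝ} {z u : X}
    (hf : ContDiffAt ℝ 2 f z) (hK : ContDiffAt ℝ 2 K (f z))
    (h : ∀ᶠ z' in 𝓝 z, fderiv ℝ K (f z') (fderiv ℝ f z' u) = 0) :
    fderiv ℝ (fderiv ℝ K) (f z) (fderiv ℝ f z u) (fderiv ℝ f z u) +
      fderiv ℝ K (f z) (fderiv ℝ (fderiv ℝ f) z u u) = 0 := by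
  have hfd : HasFDerivAt f (fderiv ℝ f z) z := (hf.differentiableAt (by simp)).hasFDerivAt
  have d1 := (HasFDerivAt.comp z (g := fderiv ℝ K) (hasFDerivAt_fderiv hK) hfd).clm_apply
    ((hasFDerivAt_fderiv hf).clm_apply (hasFDerivAt_const u z))
  have d2 := d1.unique ((hasFDerivAt_const (0 : ℝ) z).congr_of_eventuallyEq h)
  have d3 := congrArg (fun L => L u) d2
  simp at d3
  linarith

theorem second_fderiv_of_isotropic {f : X → Y} {z u w : X} (B : Y →L[ℝ] Y →L[ℝ] ℝ)
    (hf : ContDiffAt ℝ 2 f z) (h : ∀ᶠ z' in 𝓝 z, B (fderiv ℝ f z' w) (fderiv ℝ f z' u) = 0) :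
    B (fderiv ℝ (fderiv ℝ f) z u w) (fderiv ℝ f z u) +
      B (fderiv ℝ f z w) (fderiv ℝ (fderiv ℝ f) z u u) = 0 := by
  have dw := (hasFDerivAt_fderiv hf).clm_apply (hasFDerivAt_const w z)
  have du := (hasFDerivAt_fderiv hf).clm_apply (hasFDerivAt_const u z)
  have d1 := (B.hasFDerivAt.comp z dw).clm_apply du
  have d2 := d1.unique ((hasFDerivAt_const (0 : ℝ) z).congr_of_eventuallyEq h)
  have d3 := congrArg (fun L => L u) d2
  simp at d3
  linarith

end SecondDerivatives

/-! ### Convexity determines the sign of the crossing form -/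

section Crossing

variable {n : ℕ} {S : Type*} [TopologicalSpace S]
  [ChartedSpace (EuclideanSpace ℝ (Fin n)) S] [IsManifold (𝓡 n) ∞ S]
  {F : Type*} [TopologicalSpace F] [ChartedSpace (EuclideanSpace ℝ (Fin n)) F]
  [IsManifold (𝓡 n) ∞ F]

/-- The chart is the identity on covectors over its base point, so the Hessian of `H` in the chart
along vertical directions is the one in the definition of convexity. -/
theorem extChartAt_fibre (q : S) (p p' : EuclideanSpace ℝ (Fin n) →L[ℝ] ℝ) :
    extChartAt (cotangentI n) (⟨q, p⟩ : CotangentBundle n S) ⟨q, p'⟩ =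
      (extChartAt (𝓡 n) q q, p') := by
  have hs : (⟨q, p'⟩ : CotangentBundle n S) ∈
      (extChartAt (cotangentI n) (⟨q, p⟩ : CotangentBundle n S)).source :=
    mem_extChartAt_source_iff.2 (mem_extChartAt_source q)
  refine Prod.ext (extChartAt_fst _ _) ((extChartAt_snd _ _ hs).trans ?_)
  exact ContinuousLinearMap.ext fun v =>
    congrArg p' (tangentCoordChange_self (mem_extChartAt_source q))

theorem extChartAt_symm_fibre (q : S) (p p' : EuclideanSpace ℝ (Fin n) →L[ℝ] ℝ) :
    (extChartAt (cotangentI n) (⟨q, p⟩ : CotangentBundle n S)).symm (extChartAt (𝓡 n) q q, p') =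
      ⟨q, p'⟩ := by
  rw [← extChartAt_fibre q p p']
  exact PartialEquiv.left_inv _ (mem_extChartAt_source_iff.2 (mem_extChartAt_source q))

theorem IsConvexHamiltonian.second_fderiv_pos_fibre {H : CotangentBundle n S → ℝ}
    (hconv : IsConvexHamiltonian H) (hH : ContMDiff (cotangentI n) 𝓘(ℝ, ℝ) ∞ H) (q : S)
    (p η : EuclideanSpace ℝ (Fin n) →L[ℝ] ℝ) (hη : η ≠ 0) :
    0 < fderiv ℝ (fderiv ℝ (H ∘ (extChartAt (cotangentI n) (⟨q, p⟩ : CotangentBundle n S)).symm))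
      (extChartAt (cotangentI n) (⟨q, p⟩ : CotangentBundle n S) ⟨q, p⟩) (0, η) (0, η) := by
  have h2 := (contDiffAt_chart_function hH
    (mem_extChartAt_source (⟨q, p⟩ : CotangentBundle n S))).of_le
    (WithTop.coe_le_coe.2 (le_top : (2 : ℕ∞) ≤ ⊤))
  rw [← iteratedDeriv_two_line h2]
  have h3 : ∀ t : ℝ, (H ∘ (extChartAt (cotangentI n) (⟨q, p⟩ : CotangentBundle n S)).symm)
      (extChartAt (cotangentI n) (⟨q, p⟩ : CotangentBundle n S) ⟨q, p⟩ + t • (0, η)) =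
      H ⟨q, (p + t • η : EuclideanSpace ℝ (Fin n) →L[ℝ] ℝ)⟩ := by
    intro t
    have h4 : extChartAt (cotangentI n) (⟨q, p⟩ : CotangentBundle n S) ⟨q, p⟩ + t • (0, η) =
        (extChartAt (𝓡 n) q q, p + t • η) := by
      rw [extChartAt_fibre q p p]
      simp
    rw [h4, Function.comp_apply, extChartAt_symm_fibre]
  simp_rw [h3]
  exact hconv q p η hη

theorem IsConvexHamiltonian.second_fderiv_pos {H : CotangentBundle n S → ℝ}
    (hconv : IsConvexHamiltonian H) (hH : ContMDiff (cotangentI n) 𝓘(ℝ, ℝ) ∞ H)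
    (θ : CotangentBundle n S) {ξ : CotangentModel n} (hξ1 : ξ.1 = 0) (hξ : ξ ≠ 0) :
    0 < fderiv ℝ (fderiv ℝ (H ∘ (extChartAt (cotangentI n) θ).symm))
      (extChartAt (cotangentI n) θ θ) ξ ξ := by
  obtain ⟨a, η⟩ := ξ
  obtain rfl : a = 0 := hξ1
  refine hconv.second_fderiv_pos_fibre hH θ.proj θ.2 η ?_
  rintro rfl
  exact hξ rfl

/-- The symplectic form of the model space as a continuous bilinear map. -/
def stdSymplecticCLM (n : ℕ) : CotangentModel n →L[ℝ] CotangentModel n →L[ℝ] ℝ :=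
  LinearMap.toContinuousBilinearMap (stdSymplectic n)

-- Let `f` be the inclusion in a chart, `K` the hamiltonian there, and `Df w` the hamiltonian
-- vector. Differentiating isotropy along `u` gives `ω(D²f(u, w), Df u) = -ω(Df w, D²f(u, u)) =
-- DK(D²f(u, u))`. Differentiating `DK(Df u) = 0` along `u` turns this into `-D²K(Df u, Df u)`,
-- which is negative by convexity since `Df u` is vertical and nonzero.
set_option synthInstance.maxHeartbeats 200000 in
theorem IsLagrangianImmersion.crossing_neg {ι : F → CotangentBundle n S}
    (hι : IsLagrangianImmersion ι) {H : CotangentBundle n S → ℝ}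
    (hH : ContMDiff (cotangentI n) 𝓘(ℝ, ℝ) ∞ H) (hconv : IsConvexHamiltonian H)
    (htan : ∀ y, ∃ w, planeMap ι y w = hamField H (ι y)) {x : F} {w u : EuclideanSpace ℝ (Fin n)}
    (hw : planeMap ι x w = hamField H (ι x)) (hu : u ≠ 0) (hux : (planeMap ι x u).1 = 0) :
    stdSymplectic n (fderiv ℝ (fun z => fderiv ℝ (writtenInExtChartAt (𝓡 n) (cotangentI n) x ι) z)
      (extChartAt (𝓡 n) x x) w u) (planeMap ι x u) < 0 := by
  set f := writtenInExtChartAt (𝓡 n) (cotangentI n) x ι with hf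
  set z := extChartAt (𝓡 n) x x with hz
  set θ := ι x with hθ
  set K := H ∘ (extChartAt (cotangentI n) θ).symm with hK
  have hxd := mem_of_mem_nhds (hι.chartDomain_mem_nhds x)
  have hfc : ContDiffAt ℝ 2 f z := (hι.contDiffAt_chart hxd).of_le
    (WithTop.coe_le_coe.2 (le_top : (2 : ℕ∞) ≤ ⊤))
  have hsymm : fderiv ℝ (fderiv ℝ f) z w u = fderiv ℝ (fderiv ℝ f) z u w :=
    (hfc.isSymmSndFDerivAt (by simp)).eq w u
  have hfz : f z = extChartAt (cotangentI n) θ θ := by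
    simp only [hf, hz, writtenInExtChartAt, Function.comp_apply, extChartAt_to_inv, hθ]
  have hDz : fderiv ℝ f z = planeMap ι x := hι.chartPlane_self x
  have hKc : ContDiffAt ℝ 2 K (f z) := by
    rw [hfz]
    exact (contDiffAt_chart_function hH (mem_extChartAt_source θ)).of_le
      (WithTop.coe_le_coe.2 (le_top : (2 : ℕ∞) ≤ ⊤))
  have hnear : ∀ᶠ z' in 𝓝 z, ∃ y ∈ chartDomain ι x, extChartAt (𝓡 n) x y = z' := by
    filter_upwards [extChartAt_target_mem_nhds (I := 𝓡 n) x,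
      (continuousAt_extChartAt_symm (I := 𝓡 n) x).eventually (by
        rw [extChartAt_to_inv]; exact hι.chartDomain_mem_nhds x)] with z' h1 h2
    exact ⟨_, h2, (extChartAt (𝓡 n) x).right_inv h1⟩
  -- The differential of `H` vanishes on `TF`: it equals `-ω(X_H, ·)`, and `X_H` is tangent to the
  -- isotropic submanifold.
  have hb : ∀ᶠ z' in 𝓝 z, fderiv ℝ K (f z') (fderiv ℝ f z' u) = 0 := by
    filter_upwards [hnear] with z' hz'
    obtain ⟨y, hy, rfl⟩ := hz'
    have e1 : f (extChartAt (𝓡 n) x y) = extChartAt (cotangentI n) θ (ι y) := by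
      simp only [hf, writtenInExtChartAt, Function.comp_apply]
      rw [(extChartAt (𝓡 n) x).left_inv hy.1]
    have e2 := hι.chartPlane_eq hy
    rw [chartPlane, ← hf] at e2
    obtain ⟨w', hw'⟩ := htan y
    rw [e1, e2]
    have e3 : ∀ v, fderiv ℝ K (extChartAt (cotangentI n) θ (ι y)) (chartDeriv θ (ι y) v) =
        -stdSymplectic n (hamField H (ι y)) v := by
      intro v
      have := stdSymplectic_sympGrad (fderiv ℝ K (extChartAt (cotangentI n) θ (ι y)))
        (chartDeriv θ (ι y) v)
      rw [← chartDeriv_hamField hH hy.2, (chartDeriv_symplectic_and_fst _ _ hy.2).1] at this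
      linarith
    refine (e3 _).trans ?_
    rw [← hw']
    exact neg_eq_zero.2 (hι.isotropic y _ _)
  have hb' := second_fderiv_of_constant_along hfc hKc hb
  have ha : stdSymplectic n (fderiv ℝ (fderiv ℝ f) z u w) (fderiv ℝ f z u) +
      stdSymplectic n (fderiv ℝ f z w) (fderiv ℝ (fderiv ℝ f) z u u) = 0 := by
    refine second_fderiv_of_isotropic (stdSymplecticCLM n) hfc ?_
    filter_upwards [hnear] with z' hz'
    obtain ⟨y, hy, rfl⟩ := hz'
    exact hι.isIsotropic_chartPlane hy w u
  have hXw : stdSymplectic n (fderiv ℝ f z w) (fderiv ℝ (fderiv ℝ f) z u u) =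
      -fderiv ℝ K (f z) (fderiv ℝ (fderiv ℝ f) z u u) := by
    rw [← stdSymplectic_sympGrad, hfz, ← chartDeriv_hamField hH (mem_extChartAt_source θ), hDz, hw]
    congr 2
    exact (tangentCoordChange_self (I := cotangentI n) (mem_extChartAt_source θ)).symm
  have hpos := hconv.second_fderiv_pos hH θ hux (fun h0 => hu (hι.injective x
    (h0.trans (map_zero _).symm)))
  rw [← hDz, ← hfz] at hpos
  change stdSymplectic n (fderiv ℝ (fderiv ℝ f) z w u) _ < 0
  rw [hsymm, ← hDz]
  linarith

end Crossing


/-! ### Functions that decrease across a set along a non-wandering flow -/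

section Dynamics

variable {X α : Type*} [TopologicalSpace X] [LinearOrder α] {φ : ℝ → X → X} {Z : Set X} {c : X → α}

/-- Continuous induction along the orbit: off `Z` the value is locally constant in time, and at a
point of `Z` the values just after are below those just before, so the inequality persists beyond
every time. -/
theorem le_of_decreasing_across (hadd : ∀ s t x, φ (s + t) x = φ s (φ t x))
    (horb : ∀ x, Continuous fun t => φ t x)
    (hloc : ∀ x ∉ Z, ∀ᶠ y in 𝓝 x, y ∉ Z ∧ c y = c x)
    (hjump : ∀ x ∈ Z, ∀ᶠ ε : ℝ in 𝓝[>] 0, φ ε x ∉ Z ∧ φ (-ε) x ∉ Z ∧ c (φ ε x) < c (φ (-ε) x))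
    {y : X} {a b : ℝ} (hab : a ≤ b) (ha : φ a y ∉ Z) (hb : φ b y ∉ Z) :
    c (φ b y) ≤ c (φ a y) := by
  let A : Set ℝ := {t | ∀ r ∈ Icc a t, φ r y ∉ Z → c (φ r y) ≤ c (φ a y)}
  have hnear : ∀ t, φ t y ∉ Z → ∀ᶠ r in 𝓝 t, φ r y ∉ Z ∧ c (φ r y) = c (φ t y) := fun t ht =>
    ((horb y).tendsto t).eventually (hloc _ ht)
  have hA : Icc a b ⊆ A := by
    refine IsClosed.Icc_subset_of_forall_exists_gt ?_ ?_ ?_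
    · refine isClosed_of_closure_subset fun t ht => ?_
      have htI : t ∈ Icc a b := closure_minimal inter_subset_right isClosed_Icc ht
      refine ⟨fun r hr hrZ => ?_, htI⟩
      by_cases hlt : r < t
      · obtain ⟨s, hs, hsA⟩ := mem_closure_iff.1 ht (Ioi r) isOpen_Ioi hlt
        exact hsA.1 r ⟨hr.1, le_of_lt hs⟩ hrZ
      · obtain rfl : r = t := le_antisymm hr.2 (not_lt.1 hlt)
        obtain ⟨s, hs, hsA⟩ := mem_closure_iff_nhds.1 ht _ (hnear r hrZ)
        rw [← hs.2]
        exact hsA.1 s ⟨hsA.2.1, le_rfl⟩ hs.1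
    · intro r hr _
      rw [le_antisymm hr.2 hr.1]
    · rintro x ⟨hxA, hx⟩ z hz
      have hev : ∀ᶠ r in 𝓝[>] x, φ r y ∉ Z → c (φ r y) ≤ c (φ a y) := by
        by_cases hxZ : φ x y ∈ Z
        · have hne : a ≠ x := by
            rintro rfl
            exact ha hxZ
          have hax : 0 < x - a := sub_pos.2 (lt_of_le_of_ne hx.1 hne)
          have h1 : ∀ᶠ ε : ℝ in 𝓝[>] 0, c (φ (x + ε) y) ≤ c (φ a y) := by
            filter_upwards [hjump _ hxZ, Ioo_mem_nhdsGT hax] with ε hε hε'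
            rw [← hadd, ← hadd] at hε
            rw [add_comm x ε]
            refine hε.2.2.le.trans (hxA _ ⟨?_, ?_⟩ hε.2.1) <;> linarith [hε'.1, hε'.2]
          have h2 : Tendsto (fun r => r - x) (𝓝[>] x) (𝓝[>] 0) := by
            refine tendsto_nhdsWithin_iff.2 ⟨?_, ?_⟩
            · have : Tendsto (fun r => r - x) (𝓝 x) (𝓝 (x - x)) :=
                (continuous_id.sub continuous_const).tendsto x
              rw [sub_self] at this
              exact this.mono_left nhdsWithin_le_nhds
            · filter_upwards [self_mem_nhdsWithin] with r hr
              exact mem_Ioi.2 (sub_pos.2 (mem_Ioi.1 hr))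
          filter_upwards [h2.eventually h1] with r hr _
          rwa [add_sub_cancel] at hr
        · filter_upwards [nhdsWithin_le_nhds (hnear x hxZ)] with r hr _
          rw [hr.2]
          exact hxA x ⟨hx.1, le_rfl⟩ hxZ
      obtain ⟨w, hw, hwI⟩ := (mem_nhdsGT_iff_exists_Ioo_subset' (lt_add_one x)).1 hev
      have hmin : x < min z ((x + w) / 2) := lt_min hz (by linarith [mem_Ioi.1 hw])
      refine ⟨min z ((x + w) / 2), fun r hr hrZ => ?_, hmin, min_le_left _ _⟩
      by_cases hrx : r ≤ x
      · exact hxA r ⟨hr.1, hrx⟩ hrZ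
      · refine hwI ⟨not_le.1 hrx, ?_⟩ hrZ
        have := hr.2.trans (min_le_right _ _)
        linarith [mem_Ioi.1 hw]
  exact hA ⟨hab, le_rfl⟩ b ⟨hab, le_rfl⟩ hb

/-- A locally constant function that decreases across `Z` along a non-wandering flow forces `Z` to
be empty. -/
theorem eq_empty_of_decreasing_across (hadd : ∀ s t x, φ (s + t) x = φ s (φ t x))
    (horb : ∀ x, Continuous fun t => φ t x)
    (hcont : ∀ x, ∃ ε > (0 : ℝ), ∀ t, |t| < ε → ContinuousAt (φ t) x)
    (hloc : ∀ x ∉ Z, ∀ᶠ y in 𝓝 x, y ∉ Z ∧ c y = c x)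
    (hjump : ∀ x ∈ Z, ∀ᶠ ε : ℝ in 𝓝[>] 0, φ ε x ∉ Z ∧ φ (-ε) x ∉ Z ∧ c (φ ε x) < c (φ (-ε) x))
    (hnw : nonWanderingSet φ = univ) : Z = ∅ := by
  refine eq_empty_iff_forall_notMem.2 fun x hx => ?_
  obtain ⟨ε₀, hε₀, hφ⟩ := hcont x
  have hmin : (0 : ℝ) < min ε₀ (1 / 2) := lt_min hε₀ (by norm_num)
  -- Taking `ε < 1/2` makes `ε ≤ t - ε` for any return time `t > 1`, so the comparison below runs
  -- forward in time.
  obtain ⟨ε, ⟨h1, h2, h3⟩, hε⟩ := ((hjump x hx).and (Ioo_mem_nhdsGT hmin)).exists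
  have hε1 := lt_of_lt_of_le hε.2 (min_le_left _ _)
  have hε2 := lt_of_lt_of_le hε.2 (min_le_right _ _)
  -- For `y` in this neighbourhood of `x`, the values at `φ ε y` and `φ (-ε) y` are those for `x`
  -- itself. If `y` and `φ t y` both lie in it, the orbit passes from the value after the drop to
  -- the larger value before it.
  have hU := ((hφ ε (by rwa [abs_of_pos hε.1])).eventually (hloc _ h1)).and
    ((hφ (-ε) (by rwa [abs_neg, abs_of_pos hε.1])).eventually (hloc _ h2))
  have hxn : x ∈ nonWanderingSet φ := hnw ▸ mem_univ x
  obtain ⟨t, ht, _, ⟨y, hy, rfl⟩, hyU⟩ := hxn _ hU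
  have h4 := le_of_decreasing_across hadd horb hloc hjump (y := y) (a := ε) (b := -ε + t)
    (by linarith) hy.1.1 (by rw [hadd]; exact hyU.2.1)
  rw [hadd, hyU.2.2, hy.1.2] at h4
  exact absurd h3 (not_lt.2 h4)

end Dynamics


/-! ### Lagrangian submanifolds invariant under a hamiltonian flow -/

section Invariant

variable {n : ℕ} {S : Type*} [TopologicalSpace S]
  [ChartedSpace (EuclideanSpace ℝ (Fin n)) S] [IsManifold (𝓡 n) ∞ S]
  {F : Type*} [TopologicalSpace F] [ChartedSpace (EuclideanSpace ℝ (Fin n)) F]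
  [IsManifold (𝓡 n) ∞ F]

/-- The points at which a map into `T^*S` is tangent to the fibres. -/
def crossingSet (ι : F → CotangentBundle n S) : Set F :=
  {x | ∃ u, u ≠ 0 ∧ (planeMap ι x u).1 = 0}

theorem notMem_crossingSet {ι : F → CotangentBundle n S} {x : F} :
    x ∉ crossingSet ι ↔ Function.Injective (horizontalPart (planeMap ι x)) := by
  rw [injective_iff_map_eq_zero]
  refine ⟨fun hx u hu => ?_, fun hx ⟨u, hu, hux⟩ => hu (hx u hux)⟩
  by_contra hne
  exact hx ⟨u, hne, hu⟩

theorem IsLagrangianImmersion.eventually_notMem_crossingSet {ι : F → CotangentBundle n S}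
    (hι : IsLagrangianImmersion ι) {x : F} (hx : x ∉ crossingSet ι) :
    ∀ᶠ y in 𝓝 x, y ∉ crossingSet ι := by
  simp only [notMem_crossingSet] at hx ⊢
  exact hι.eventually_injective_horizontalPart hx

/-- `ι` embeds `F` as a lagrangian submanifold on which the hamiltonian flow of `H` restricts
to `φ`. -/
structure IsInvariantLagrangian (H : CotangentBundle n S → ℝ) (ι : F → CotangentBundle n S)
    (φ : ℝ → F → F) : Prop where
  immersion : IsLagrangianImmersion ι
  embedding : IsEmbedding ι
  left_inverse : ∀ x, ∃ ρ : CotangentBundle n S → F, ContMDiffAt (cotangentI n) (𝓡 n) ∞ ρ (ι x) ∧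
    ∀ᶠ y in 𝓝 x, ρ (ι y) = y
  smooth : ContMDiff (cotangentI n) 𝓘(ℝ, ℝ) ∞ H
  flow : IsRestrictedHamiltonianFlow H ι φ

namespace IsInvariantLagrangian

variable {H : CotangentBundle n S → ℝ} {ι : F → CotangentBundle n S} {φ : ℝ → F → F}
  (h : IsInvariantLagrangian H ι φ)
include h

theorem continuous_orbit (x : F) : Continuous fun t => φ t x :=
  h.embedding.isInducing.continuous_iff.2 (h.flow x).2.1.continuous

/-- Differentiability is given for the curve in `T^*S` only; a local smooth left inverse of the
inclusion brings it back to `F`. -/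
theorem mdifferentiable_orbit (x : F) : MDifferentiable 𝓘(ℝ, ℝ) (𝓡 n) fun t => φ t x := by
  intro t
  obtain ⟨ρ, hρ, hρι⟩ := h.left_inverse (φ t x)
  have h1 : MDifferentiableAt 𝓘(ℝ, ℝ) (𝓡 n) (ρ ∘ fun s => ι (φ s x)) t :=
    MDifferentiableAt.comp t (hρ.mdifferentiableAt (by simp)) ((h.flow x).2.1 t)
  refine h1.congr_of_eventuallyEq ?_
  filter_upwards [((h.continuous_orbit x).tendsto t).eventually hρι] with s hs
  exact hs.symm

theorem planeMap_velocity (x : F) (t : ℝ) :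
    planeMap ι (φ t x) (velocity (𝓡 n) (fun s => φ s x) t) = hamField H (ι (φ t x)) := by
  rw [← (h.flow x).2.velocity_eq t]
  exact (mfderiv_comp_apply t (h.immersion.mdifferentiableAt (φ t x))
    (h.mdifferentiable_orbit x t) (1 : ℝ)).symm

theorem exists_planeMap_eq (x : F) : ∃ w, planeMap ι x w = hamField H (ι x) := by
  have := h.planeMap_velocity x 0
  rw [(h.flow x).1] at this
  exact ⟨_, this⟩

theorem flow_add [T2Space S] (s t : ℝ) (x : F) : φ (s + t) x = φ s (φ t x) := by
  have := t2Space_cotangentBundle (n := n) (S := S)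
  have hv := contMDiff_hamField h.smooth
  have h1 := (h.flow x).2.isMIntegralCurve.comp_add t
  have h2 := (h.flow (φ t x)).2.isMIntegralCurve
  have h3 := isMIntegralCurve_Ioo_eq_of_contMDiff_boundaryless (t₀ := 0) hv h1 h2 (by
    simp [(h.flow (φ t x)).1])
  exact h.embedding.injective (congrFun h3 s)

theorem exists_continuousAt_flow [T2Space S] (x : F) :
    ∃ ε > (0 : ℝ), ∀ t, |t| < ε → ContinuousAt (φ t) x := by
  have := t2Space_cotangentBundle (n := n) (S := S)
  obtain ⟨ε, hε, Ψ, hΨ, hΨc⟩ := exists_continuousAt_local_flow (contMDiff_hamField h.smooth) (ι x)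
  refine ⟨ε, hε, fun t ht => ?_⟩
  have hιc := h.immersion.contMDiff.continuous.continuousAt (x := x)
  rw [h.embedding.isInducing.continuousAt_iff]
  refine ((hΨ t ht).comp hιc).congr ?_
  filter_upwards [hιc.eventually hΨc] with y hy
  exact (hy _ (h.flow y).2.isMIntegralCurve (congrArg ι (h.flow y).1) t ht).symm

/-- The second derivative of the inclusion in the direction of the flow. -/
theorem crossing_neg (hconv : IsConvexHamiltonian H) (x : F) {u : EuclideanSpace ℝ (Fin n)}
    (hu : u ≠ 0) (hux : (planeMap ι (φ 0 x) u).1 = 0) :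
    stdSymplectic n (fderiv ℝ (fun z => fderiv ℝ (writtenInExtChartAt (𝓡 n) (cotangentI n)
      (φ 0 x) ι) z) (extChartAt (𝓡 n) (φ 0 x) (φ 0 x)) (velocity (𝓡 n) (fun s => φ s x) 0) u)
      (planeMap ι (φ 0 x) u) < 0 :=
  h.immersion.crossing_neg h.smooth hconv h.exists_planeMap_eq (h.planeMap_velocity x 0) hu hux

theorem eventually_mem_chartDomain (x : F) : ∀ᶠ ε : ℝ in 𝓝[>] 0,
    φ ε x ∈ chartDomain ι x ∧ φ (-ε) x ∈ chartDomain ι x := by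
  have h0 : Tendsto (fun t => φ t x) (𝓝 0) (𝓝 x) := by
    simpa only [(h.flow x).1] using (h.continuous_orbit x).tendsto 0
  have h1 : Tendsto (fun t : ℝ => -t) (𝓝 0) (𝓝 0) := by
    simpa using (continuous_neg (G := ℝ)).tendsto 0
  exact nhdsWithin_le_nhds ((h0.eventually (h.immersion.chartDomain_mem_nhds x)).and
    ((h0.comp h1).eventually (h.immersion.chartDomain_mem_nhds x)))

theorem lagArg_jump (hconv : IsConvexHamiltonian H) {x : F} {u₀ : EuclideanSpace ℝ (Fin n)}
    (hu₀ : u₀ ≠ 0) (hux : (planeMap ι x u₀).1 = 0) {J : ℝ → CotangentModel n →L[ℝ] CotangentModel n}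
    (hJ : ContinuousAt J 0) (hJc : ∀ᶠ t in 𝓝 0, IsCompatible (J t)) :
    (∀ᶠ ε : ℝ in 𝓝[>] 0, Function.Injective (horizontalPart (chartPlane ι x (φ ε x))) ∧
      Function.Injective (horizontalPart (chartPlane ι x (φ (-ε) x)))) ∧
    ∃ δ > 0, ∀ᶠ ε : ℝ in 𝓝[>] 0, lagArg (J (-ε)) (chartPlane ι x (φ (-ε) x)) + δ <
      lagArg (J ε) (chartPlane ι x (φ ε x)) := by
  have h0 : φ 0 x = x := (h.flow x).1
  have hd := h.immersion.hasDerivAt_chartPlane (h.mdifferentiable_orbit x 0)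
  have hneg := fun u (hu : u ≠ 0) => h.crossing_neg hconv x (u := u) hu
  have hself := h.immersion.chartPlane_self (φ 0 x)
  have hdom : ∀ᶠ t in 𝓝 (0 : ℝ), φ t x ∈ chartDomain ι (φ 0 x) :=
    ((h.continuous_orbit x).tendsto 0).eventually (h.immersion.chartDomain_mem_nhds _)
  have key := _root_.lagArg_jump hd (hdom.mono fun t ht => h.immersion.isIsotropic_chartPlane ht)
    hJ hJc (fun u hu1 hu => by
      rw [hself] at hu1 ⊢
      have := hneg u hu hu1
      rw [stdSymplectic_apply, hu1, map_zero, zero_sub] at this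
      exact neg_neg_iff_pos.1 this)
    ⟨u₀, hu₀, by rw [hself, h0]; exact hux⟩
  simpa only [h0] using key

/-- Transversality does not involve a complex structure, so the constant standard structure may be
used to invoke the jump lemma. -/
theorem eventually_notMem_crossingSet_flow (hconv : IsConvexHamiltonian H) {x : F}
    (hx : x ∈ crossingSet ι) :
    ∀ᶠ ε : ℝ in 𝓝[>] 0, φ ε x ∉ crossingSet ι ∧ φ (-ε) x ∉ crossingSet ι := by
  obtain ⟨u₀, hu₀, hux⟩ := hx
  filter_upwards [(h.lagArg_jump hconv hu₀ hux continuousAt_const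
    (Eventually.of_forall fun _ => isCompatible_stdComplex n)).1,
    h.eventually_mem_chartDomain x] with ε hε hd
  simp only [notMem_crossingSet]
  exact ⟨(h.immersion.injective_horizontalPart_chartPlane hd.1).1 hε.1,
    (h.immersion.injective_horizontalPart_chartPlane hd.2).1 hε.2⟩

theorem maslovArg_jump (hconv : IsConvexHamiltonian H)
    {J : CotangentBundle n S → CotangentModel n →L[ℝ] CotangentModel n}
    (hJ : IsCompatibleComplexStructure (n := n) (S := S) J) {x : F} (hx : x ∈ crossingSet ι) :
    ∃ δ > 0, ∀ᶠ ε : ℝ in 𝓝[>] 0,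
      maslovArg J ι (φ (-ε) x) + δ < maslovArg J ι (φ ε x) := by
  obtain ⟨u₀, hu₀, hux⟩ := id hx
  have h0 : φ 0 x = x := (h.flow x).1
  have hc : Tendsto (fun t => φ t x) (𝓝 0) (𝓝 x) := by
    simpa only [h0] using (h.continuous_orbit x).tendsto 0
  have hJc : ContinuousAt (fun t => chartComplex J (ι x) (ι (φ t x))) 0 := by
    have h1 := hJ.continuousAt_chartComplex (ι x)
    refine ContinuousAt.comp (g := chartComplex J (ι x)) (f := fun t => ι (φ t x)) ?_
      (h.flow x).2.1.continuous.continuousAt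
    simpa only [h0] using h1
  obtain ⟨δ, hδ, hj⟩ := (h.lagArg_jump hconv hu₀ hux hJc
    ((hc.eventually (h.immersion.chartDomain_mem_nhds x)).mono fun t ht =>
      isCompatible_chartComplex (hJ.isCompatible _) ht.2)).2
  refine ⟨δ, hδ, ?_⟩
  filter_upwards [hj, h.eventually_mem_chartDomain x,
    h.eventually_notMem_crossingSet_flow hconv hx] with ε h1 h2 h3
  rw [notMem_crossingSet, notMem_crossingSet] at h3
  rwa [h.immersion.maslovArg_eq_chart hJ.isCompatible h2.1 h3.1,
    h.immersion.maslovArg_eq_chart hJ.isCompatible h2.2 h3.2]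

theorem crossingSet_eq_empty_of_decreasing [T2Space S] {α : Type*} [LinearOrder α] {c : F → α}
    (hconv : IsConvexHamiltonian H)
    (hloc : ∀ x ∉ crossingSet ι, ∀ᶠ y in 𝓝 x, c y = c x)
    (hjump : ∀ x ∈ crossingSet ι, ∀ᶠ ε : ℝ in 𝓝[>] 0, c (φ ε x) < c (φ (-ε) x))
    (hnw : nonWanderingSet φ = univ) : crossingSet ι = ∅ := by
  refine eq_empty_of_decreasing_across (c := c) h.flow_add h.continuous_orbit h.exists_continuousAt_flow
    (fun x hx => ?_) (fun x hx => ?_) hnw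
  · exact (h.immersion.eventually_notMem_crossingSet hx).and (hloc x hx)
  · filter_upwards [h.eventually_notMem_crossingSet_flow hconv hx, hjump x hx] with ε h1 h2
    exact ⟨h1.1, h1.2, h2⟩

end IsInvariantLagrangian

end Invariant


/-! ### Triviality of the Maslov cycle and of the Maslov cocycle -/

section NegDef

variable {V : Type*} [AddCommGroup V] [Module ℝ V] {Q : QuadraticForm ℝ V}

theorem separatingLeft_of_neg (hQ : ∀ x, x ≠ 0 → Q x < 0) : Q.polarBilin.SeparatingLeft := by
  intro x hx
  by_contra hne
  have h1 : QuadraticMap.polar Q x x = 0 := hx x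
  rw [QuadraticMap.polar_self] at h1
  have := hQ x hne
  simp at h1
  linarith

theorem sigPos_eq_zero_of_neg [FiniteDimensional ℝ V] (hQ : ∀ x, x ≠ 0 → Q x < 0) :
    sigPos Q = 0 := by
  have := QuadraticForm.sigPos_add_finrank_le_of_nonpos (Q := Q) (V := ⊤) fun x _ => by
    rcases eq_or_ne x 0 with rfl | hx
    · simp
    · exact (hQ x hx).le
  rw [finrank_top] at this
  omega

theorem sigNeg_pos_of_neg [FiniteDimensional ℝ V] [Nontrivial V] (hQ : ∀ x, x ≠ 0 → Q x < 0) :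
    0 < sigNeg Q := by
  have h1 := le_sigNeg_of_negDef Q (V := ⊤) fun x hx => by
    have := hQ x (by simpa using hx)
    simpa using this
  rw [finrank_top] at h1
  exact Module.finrank_pos.trans_le h1

end NegDef

/-! ### Comparison of the three conditions with the absence of crossings -/

section Triviality

variable {n : ℕ} {S : Type*} [TopologicalSpace S]
  [ChartedSpace (EuclideanSpace ℝ (Fin n)) S] [IsManifold (𝓡 n) ∞ S]
  {F : Type*} [TopologicalSpace F] [ChartedSpace (EuclideanSpace ℝ (Fin n)) F]
  [IsManifold (𝓡 n) ∞ F]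
  {H : CotangentBundle n S → ℝ} {ι : F → CotangentBundle n S} {φ : ℝ → F → F}

theorem IsInvariantLagrangian.crossingForm_neg (h : IsInvariantLagrangian H ι φ)
    (hconv : IsConvexHamiltonian H) (x : F) (u : crossingKernel ι (φ 0 x)) (hu : u ≠ 0) :
    crossingForm ι (φ 0 x) (mfderiv 𝓘(ℝ, ℝ) (𝓡 n) (fun s => φ s x) 0 (1 : ℝ)) u < 0 := by
  have h1 := h.crossing_neg hconv x (u := u.1) (fun h0 => hu (Subtype.ext h0))
    ((mem_crossingKernel (h.immersion.mdifferentiableAt _) _).1 u.2)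
  rw [← h.immersion.chartPlane_self] at h1
  exact h1

/-- Along an orbit the crossing form is negative definite on a nonzero kernel, hence non-degenerate
of negative signature, so the bounding chain drops strictly at each crossing. -/
theorem IsInvariantLagrangian.crossingSet_eq_empty_of_isTrivialMaslovCycle [T2Space S]
    (h : IsInvariantLagrangian H ι φ) (hconv : IsConvexHamiltonian H)
    (hnw : nonWanderingSet φ = univ) (hc : IsTrivialMaslovCycle ι (crossingSet ι)) :
    crossingSet ι = ∅ := by
  obtain ⟨c, hloc, hjump⟩ := hc
  refine h.crossingSet_eq_empty_of_decreasing hconv hloc (fun x hx => ?_) hnw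
  have hx0 : φ 0 x ∈ crossingSet ι := by rwa [(h.flow x).1]
  have hQ := h.crossingForm_neg hconv x
  obtain ⟨u, hu, hux⟩ := hx0
  have hfin : FiniteDimensional ℝ (crossingKernel ι (φ 0 x)) :=
    have : FiniteDimensional ℝ (TangentSpace (𝓡 n) (φ 0 x)) :=
      inferInstanceAs (FiniteDimensional ℝ (EuclideanSpace ℝ (Fin n)))
    inferInstance
  have hnt : Nontrivial (crossingKernel ι (φ 0 x)) :=
    ⟨⟨⟨u, (mem_crossingKernel (h.immersion.mdifferentiableAt _) u).2 hux⟩, 0,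
      fun h0 => hu (congrArg Subtype.val h0)⟩⟩
  filter_upwards [hjump _ (h.mdifferentiable_orbit x) ⟨u, hu, hux⟩ _ rfl
    (separatingLeft_of_neg hQ)] with ε hε
  have h1 := sigPos_eq_zero_of_neg hQ
  have h2 := sigNeg_pos_of_neg hQ
  omega

theorem isTrivialMaslovCycle_empty (ι : F → CotangentBundle n S) : IsTrivialMaslovCycle ι ∅ :=
  ⟨0, fun _ _ => Eventually.of_forall fun _ => rfl, fun _ _ hx => absurd hx (notMem_empty _)⟩

/-- A continuous real function with constant exponential is locally constant. -/
theorem eventually_eq_of_exp_eq {X : Type*} [TopologicalSpace X] {g : X → ℝ} {x : X}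
    (hg : ContinuousAt g x)
    (h : ∀ᶠ y in 𝓝 x, Complex.exp (2 * Real.pi * Complex.I * (g y : ℂ)) =
      Complex.exp (2 * Real.pi * Complex.I * (g x : ℂ))) : ∀ᶠ y in 𝓝 x, g y = g x := by
  filter_upwards [h, Metric.continuousAt_iff'.1 hg 1 one_pos] with y h1 h2
  obtain ⟨k, hk⟩ := Complex.exp_eq_exp_iff_exists_int.1 h1
  have h3 : (2 * Real.pi * Complex.I : ℂ) ≠ 0 := Complex.two_pi_I_ne_zero
  have h4 : (g y : ℂ) = g x + k := by
    apply mul_left_cancel₀ h3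
    rw [hk]
    ring
  have h5 : g y = g x + k := by exact_mod_cast h4
  rw [Real.dist_eq, h5, add_sub_cancel_left] at h2
  have h6 : k = 0 := by
    rw [← Int.abs_lt_one_iff]
    exact_mod_cast h2
  simp [h5, h6]

/-- Off the crossings `g - arg / π` has constant exponential, so it is locally constant. At a
crossing `g` is continuous while the argument jumps up, so the difference drops. The values of `Θ`
on the crossing set play no role beyond the existence of `g`. -/
theorem IsInvariantLagrangian.crossingSet_eq_empty_of_isTrivialCocycle [T2Space S]
    (h : IsInvariantLagrangian H ι φ) (hconv : IsConvexHamiltonian H)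
    (hnw : nonWanderingSet φ = univ)
    {J : CotangentBundle n S → CotangentModel n →L[ℝ] CotangentModel n}
    (hJ : IsCompatibleComplexStructure (n := n) (S := S) J) {Θ : F → ℂ}
    (hΘ : ∀ x ∉ crossingSet ι, Θ x = (-1) ^ n * Complex.exp (2 * maslovArg J ι x * Complex.I))
    (hc : IsTrivialCocycle Θ) : crossingSet ι = ∅ := by
  obtain ⟨g, hg, hgΘ⟩ := hc
  have hexp : ∀ y ∉ crossingSet ι, Complex.exp (2 * Real.pi * Complex.I *
      ((g y - maslovArg J ι y / Real.pi : ℝ) : ℂ)) = (-1) ^ n := by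
    intro y hy
    have h1 : (2 * Real.pi * Complex.I * ((g y - maslovArg J ι y / Real.pi : ℝ) : ℂ)) =
        2 * Real.pi * Complex.I * (g y : ℂ) - 2 * maslovArg J ι y * Complex.I := by
      have : (Real.pi : ℂ) ≠ 0 := by exact_mod_cast Real.pi_ne_zero
      push_cast
      field_simp
    rw [h1, Complex.exp_sub, ← hgΘ, hΘ y hy, mul_div_assoc, div_self (Complex.exp_ne_zero _),
      mul_one]
  refine h.crossingSet_eq_empty_of_decreasing (c := fun x => g x - maslovArg J ι x / Real.pi)
    hconv (fun x hx => ?_) (fun x hx => ?_) hnw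
  · refine eventually_eq_of_exp_eq (g := fun x => g x - maslovArg J ι x / Real.pi)
      (hg.continuousAt.sub ((h.immersion.continuousAt_maslovArg hJ
        (notMem_crossingSet.1 hx)).div_const _)) ?_
    filter_upwards [h.immersion.eventually_notMem_crossingSet hx] with y hy
    rw [hexp y hy, hexp x hx]
  · obtain ⟨δ, hδ, hj⟩ := h.maslovArg_jump hconv hJ hx
    have h1 : Tendsto (fun t : ℝ => g (φ t x) - g (φ (-t) x)) (𝓝 0) (𝓝 0) := by
      have h2 := hg.comp (h.continuous_orbit x)
      have h3 := (h2.sub (h2.comp continuous_neg)).tendsto 0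
      simp only [Pi.sub_apply, Function.comp_apply, neg_zero, sub_self] at h3
      exact h3
    filter_upwards [hj, nhdsWithin_le_nhds (h1.eventually (gt_mem_nhds
      (div_pos hδ Real.pi_pos)))] with ε h2 h3
    have h4 : (maslovArg J ι (φ (-ε) x) + δ) / Real.pi < maslovArg J ι (φ ε x) / Real.pi :=
      div_lt_div_of_pos_right h2 Real.pi_pos
    rw [add_div] at h4
    linarith

theorem IsLagrangianImmersion.isTrivialCocycle_of_crossingSet_eq_empty
    (hι : IsLagrangianImmersion ι)
    {J : CotangentBundle n S → CotangentModel n →L[ℝ] CotangentModel n}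
    (hJ : IsCompatibleComplexStructure (n := n) (S := S) J) {Θ : F → ℂ}
    (hΘ : ∀ x ∉ crossingSet ι, Θ x = (-1) ^ n * Complex.exp (2 * maslovArg J ι x * Complex.I))
    (hZ : crossingSet ι = ∅) : IsTrivialCocycle Θ := by
  have hx : ∀ x, x ∉ crossingSet ι := fun x => hZ ▸ notMem_empty x
  -- The shift `n / 2` produces the factor `(-1) ^ n`.
  refine ⟨fun x => maslovArg J ι x / Real.pi + n / 2, ?_, fun x => ?_⟩
  · exact (continuous_iff_continuousAt.2 fun x => (hι.continuousAt_maslovArg hJ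
      (notMem_crossingSet.1 (hx x))).div_const _).add continuous_const
  · have h1 : (2 * Real.pi * Complex.I * ((maslovArg J ι x / Real.pi + n / 2 : ℝ) : ℂ)) =
        n * (Real.pi * Complex.I) + 2 * maslovArg J ι x * Complex.I := by
      have : (Real.pi : ℂ) ≠ 0 := by exact_mod_cast Real.pi_ne_zero
      push_cast
      field_simp
      ring
    rw [h1, Complex.exp_add, Complex.exp_nat_mul, Complex.exp_pi_mul_I, hΘ x (hx x)]

theorem IsLagrangianImmersion.isLocalDiffeomorph_iff (hι : IsLagrangianImmersion ι) :
    IsLocalDiffeomorph (𝓡 n) (𝓡 n) ∞ (footPoint ∘ ι) ↔ crossingSet ι = ∅ := by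
  have key : ∀ x, Function.Injective (mfderiv (𝓡 n) (𝓡 n) (footPoint ∘ ι) x) ↔
      x ∉ crossingSet ι := fun x => by
    rw [notMem_crossingSet, ← mfderiv_footPoint_comp (hι.mdifferentiableAt x)]
    rfl
  constructor
  · intro h
    exact eq_empty_iff_forall_notMem.2 fun x => (key x).1 (h.injective_mfderiv x)
  · intro h
    refine isLocalDiffeomorph_of_injective_mfderiv ?_ fun x => (key x).2 (h ▸ notMem_empty x)
    exact (contMDiff_proj (fun q : S => TangentSpace (𝓡 n) q →L[ℝ] ℝ)).comp hι.contMDiff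

end Triviality

end

/-! ### The equivalence of the three conditions -/

theorem mainTheorem8 {n m k : ℕ}
    {S : Type*} [TopologicalSpace S] [T2Space S] [SecondCountableTopology S]
    [ChartedSpace (EuclideanSpace ℝ (Fin n)) S] [IsManifold (𝓡 n) ∞ S]
    {M : Type*} [TopologicalSpace M]
    [ChartedSpace (EuclideanSpace ℝ (Fin m)) M] [IsManifold (𝓡 m) ∞ M]
    {B : Type*} [TopologicalSpace B]
    [ChartedSpace (EuclideanSpace ℝ (Fin k)) B] [IsManifold (𝓡 k) ∞ B]
    {F : Type*} [TopologicalSpace F]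
    [ChartedSpace (EuclideanSpace ℝ (Fin n)) F] [IsManifold (𝓡 n) ∞ F]
    -- a submanifold `M` of `T^*S` fibred by compact lagrangian submanifolds
    (i : M → CotangentBundle n S) (f : M → B)
    (hf : IsLagrangianFibration (m := m) (k := k) i f)
    -- the submanifold `F` of `M` is a fibre of `f`
    (b : B) (j : F → M) (hj : IsSmoothEmbedding (𝓡 n) (𝓡 m) ∞ j) (hjb : range j = f ⁻¹' {b})
    -- a convex hamiltonian, whose flow preserves `F`
    (H : CotangentBundle n S → ℝ) (hH : ContMDiff (cotangentI n) 𝓘(ℝ, ℝ) ∞ H)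
    (hconv : IsConvexHamiltonian H)
    (φ : ℝ → F → F) (hφ : IsRestrictedHamiltonianFlow H (i ∘ j) φ)
    (hnw : nonWanderingSet φ = univ) :
    (IsTrivialMaslovCycle (i ∘ j) (j ⁻¹' maslovSet (m := m) (k := k) i f) ↔
      IsLocalDiffeomorph (𝓡 n) (𝓡 n) ∞ (footPoint ∘ i ∘ j)) ∧
    ∀ J : ∀ θ : CotangentBundle n S,
        TangentSpace (cotangentI n) θ →L[ℝ] TangentSpace (cotangentI n) θ,
      IsCompatibleComplexStructure J →
      ((IsTrivialMaslovCycle (i ∘ j) (j ⁻¹' maslovSet (m := m) (k := k) i f) ↔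
          IsTrivialCocycle (maslovMap (m := m) (k := k) J i f ∘ j)) ∧
        (IsTrivialCocycle (maslovMap (m := m) (k := k) J i f ∘ j) ↔
          IsLocalDiffeomorph (𝓡 n) (𝓡 n) ∞ (footPoint ∘ i ∘ j))) := by
  have hZ : j ⁻¹' maslovSet (m := m) (k := k) i f = crossingSet (n := n) (i ∘ j) :=
    Set.ext fun x => mem_maslovSet hf hj hjb x
  have h : IsInvariantLagrangian H (i ∘ j) φ :=
    ⟨isLagrangianImmersion_fibre hf hj hjb, hf.embedding.isEmbedding.comp hj.isEmbedding,
      exists_local_left_inverse_comp hf hj, hH, hφ⟩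
  have h1 : IsTrivialMaslovCycle (i ∘ j) (crossingSet (n := n) (i ∘ j)) ↔
      crossingSet (n := n) (i ∘ j) = ∅ :=
    ⟨h.crossingSet_eq_empty_of_isTrivialMaslovCycle hconv hnw,
      fun h0 => h0 ▸ isTrivialMaslovCycle_empty _⟩
  have h3 := h.immersion.isLocalDiffeomorph_iff
  rw [hZ, h1]
  refine ⟨h3.symm, fun J hJ => ?_⟩
  have hΘ : ∀ x ∉ crossingSet (n := n) (i ∘ j), (maslovMap (m := m) (k := k) J i f ∘ j) x =
      (-1) ^ n * Complex.exp (2 * maslovArg J (i ∘ j) x * Complex.I) := fun x hx =>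
    maslovMap_eq hf hj hjb hJ (by rwa [← hZ] at hx)
  have h2 : IsTrivialCocycle (maslovMap (m := m) (k := k) J i f ∘ j) ↔
      crossingSet (n := n) (i ∘ j) = ∅ :=
    ⟨h.crossingSet_eq_empty_of_isTrivialCocycle hconv hnw hJ hΘ,
      h.immersion.isTrivialCocycle_of_crossingSet_eq_empty hJ hΘ⟩
  exact ⟨h2.symm, h2.trans h3.symm⟩
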